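/- **Model.** Fix $\sigma_X>0$, $1<\rho\le 2$ and a probability distribution $F$ on $\mathbb R$ with no point mass at zero. For each $q\in(0,1)$ let $G_q$ be a probability distribution on $[0,1]$ with mean $q$ (its distribution function is also denoted by $G_q$), and let $q=q_T\in(0,1)$ depend on $T$. For each $T$ let $a(1),\dots,a(T-1)$ be i.i.d. with distribution $G_q$. Conditionally on the $a(t)$, let $Y(1),\dots,Y(T-1)$ be independent Bernoulli$(a(t))$ variables. Let $\mu(t+1)=\mu(t)+Y(t)\Delta(t)$ for $1\le t\le T-1$, where for each $t$ the conditional distribution of $\Delta(t)$ given $Y(t)=1$ is $F$ (no other assumption is made on the joint law of the $\Delta(t)$ with each other and with the $a(t)$ and $Y(t)$). Conditionally on the $a(t)$, $Y(t)$ and $\mu(t)$, the observations $X(1),\dots,X(T)$ are independent with $X(t)\sim N(\mu(t),\sigma_X^2)$. Let $\tau_1<\dots<\tau_J$ be the elements of $\{t: Y(t)=1\}$, and $\tau_0=0$, $\tau_{J+1}=T$. **Criterion.** For a set $\widehat{\boldsymbol\tau}$ of estimated change-points let $\kappa(\tau_j)=\#\{\widehat\tau\in\widehat{\boldsymbol\tau}: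 |\tau_j-\widehat\tau|<\tfrac12\min(\tau_{j+1}-\tau_j,\tau_j-\tau_{j-1})\}$ and $$\beta_T=P(\tau\in\widehat{\boldsymbol\tau}\text{ and }\kappa(\tau)=1\mid J\ge 1),$$ where $\tau$ is selected uniformly at random from $\tau_1,\dots,\tau_J$. **Algorithm (extended scan-CUSUM with threshold $c_{\rm scan}$).** Let $S(t)=\sum_{u=1}^tX(u)$, $\ell_b=\lceil\rho^b\rceil$, let $b_T$ be the largest $b$ with $2\ell_b\le T-1$, and let $$Z_b(t)=\sqrt{\tfrac1{2\ell_b\sigma_X^2}}\,[S(t+\ell_b)+S(t-\ell_b)-2S(t)].$$ For an interval $I=(u,v)$ and $u<t<v$ let $$Z_I(t)=\sqrt{\tfrac{(v-t)(t-u)}{(v-u)\sigma_X^2}}\Big(\tfrac{S(v)-S(t)}{v-t}-\tfrac{S(t)-S(u)}{t-u}\Big),\qquad L_I(t)=\exp(\tfrac12Z_I^2(t)).$$ Start with $\widehat{\boldsymbol\tau}=\emptyset$. For $b=0,\dots,b_T$ successively: as long as the set $A$ of all $t$ with $\ell_b\le t\le T-\ell_b$ and $|t-\widehat\tau|\ge\ell_b$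 for all $\widehat\tau\in\widehat{\boldsymbol\tau}$ is non-empty and satisfies $\max_{t\in A}|Z_b(t)|\ge c_{\rm scan}$, let $t^*$ maximize $|Z_b(t)|$ over $t\in A$, let $I=(t^*-\ell_b,t^*+\ell_b)$, and add to $\widehat{\boldsymbol\tau}$ a point $\widehat\tau\in I$ that maximizes $a(t)L_I(t)$ over the integers $t\in I$ (ties are broken by an arbitrary fixed rule). **Theorem.** Suppose that $q=o(1/\log T)$ as $T\to\infty$ and $$\tfrac1q\int_0^\infty[1-G_q(x)]^2\,dx\to0\quad\text{as }q\to0.$$ Then the extended scan-CUSUM algorithm with $c_{\rm scan}=\sqrt{2\log(T\log T)}$ achieves $\beta_T\to1$ as $T\to\infty$. -/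

import Mathlib

open scoped ENNReal

namespace ScanCusum

/-! ### The change-point model -/

/-- The set of change-points `{t : Y(t) = 1}` among the locations `1, …, T - 1`. -/
def changePoints (T : ℕ) (y : ℕ → Bool) : Finset ℕ :=
  (Finset.Icc 1 (T - 1)).filter fun t => y t = true

/-- The change-point model for a sequence of length `T` with random intensities:
* `a t`, `1 ≤ t ≤ T - 1`, are i.i.d. with distribution `G`;
* conditionally on `a`, the indicators `Y t` are independent Bernoulli (`a t`) variables;
* given `Y t = 1`, the jump `Δ t` has distribution `F` (nothing is assumed on the joint law of the
  jumps, nor on their dependence on the other indicators and on the intensities);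
* `μ (t + 1) = μ t + Y t * Δ t`;
* conditionally on `a`, `Y`, `μ`, the observations `X t`, `1 ≤ t ≤ T`, are independent with
  distribution `N(μ t, σ ^ 2)`, that is, the errors `X t - μ t` are i.i.d. `N(0, σ ^ 2)` and
  independent of `a`, `Y`, `μ`. -/
structure IsModel (T : ℕ) (G F : MeasureTheory.Measure ℝ) (σ : ℝ)
    {Ω : Type*} [MeasurableSpace Ω] (P : MeasureTheory.Measure Ω)
    (a : ℕ → Ω → ℝ) (Y : ℕ → Ω → Bool) (Δ μ X : ℕ → Ω → ℝ) : Prop where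
  measurable_a : ∀ t ∈ Finset.Icc 1 (T - 1), Measurable (a t)
  measurable_Y : ∀ t ∈ Finset.Icc 1 (T - 1), Measurable (Y t)
  measurable_Δ : ∀ t ∈ Finset.Icc 1 (T - 1), Measurable (Δ t)
  measurable_μ : ∀ t ∈ Finset.Icc 1 T, Measurable (μ t)
  measurable_X : ∀ t ∈ Finset.Icc 1 T, Measurable (X t)
  indep_a : ProbabilityTheory.iIndepFun (fun t : Finset.Icc 1 (T - 1) => a t) P
  law_a : ∀ t ∈ Finset.Icc 1 (T - 1), P.map (a t) = G
  law_Y : ∀ S ⊆ Finset.Icc 1 (T - 1),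
    MeasureTheory.condExp
        (MeasurableSpace.comap (fun ω (t : Finset.Icc 1 (T - 1)) => a t ω) inferInstance) P
        ({ω | changePoints T (fun t => Y t ω) = S}.indicator fun _ => (1 : ℝ))
      =ᵐ[P] fun ω => (∏ t ∈ S, a t ω) * ∏ t ∈ Finset.Icc 1 (T - 1) \ S, (1 - a t ω)
  law_Δ : ∀ t ∈ Finset.Icc 1 (T - 1),
    (ProbabilityTheory.cond P {ω | Y t ω = true}).map (Δ t) = F
  mean_succ : ∀ t ∈ Finset.Icc 1 (T - 1), ∀ ω,
    μ (t + 1) ω = μ t ω + (if Y t ω = true then 1 else 0) * Δ t ω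
  indep_error : ProbabilityTheory.iIndepFun
    (fun (t : Finset.Icc 1 T) ω => X t ω - μ t ω) P
  law_error : ∀ t ∈ Finset.Icc 1 T,
    P.map (fun ω => X t ω - μ t ω) = ProbabilityTheory.gaussianReal 0 (σ ^ 2).toNNReal
  indep_error_signal : ProbabilityTheory.IndepFun
    (fun ω (t : Finset.Icc 1 T) => X t ω - μ t ω)
    (fun ω => ((fun t : Finset.Icc 1 (T - 1) => a t ω),
      (fun t : Finset.Icc 1 (T - 1) => Y t ω), (fun t : Finset.Icc 1 T => μ t ω))) P

/-! ### The error criterion -/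

/-- The change-point preceding `t`, or `0` if there is none. -/
def prevPoint (cps : Finset ℕ) (t : ℕ) : ℕ :=
  (cps.filter (· < t)).sup id

/-- The change-point following `t`, or `T` if there is none. -/
def nextPoint (T : ℕ) (cps : Finset ℕ) (t : ℕ) : ℕ :=
  (insert T (cps.filter (t < ·))).min' (Finset.insert_nonempty _ _)

open Classical in
/-- The number of estimated change-points in `est` whose distance from the change-point `t` is less
than half the distance from `t` to the closest of its two neighbours among
`0 = τ₀ < τ₁ < ⋯ < τ_J < τ_{J + 1} = T`. -/
noncomputable def kappa (T : ℕ) (cps est : Finset ℕ) (t : ℕ) : ℕ :=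
  (est.filter fun u => |(t : ℝ) - (u : ℝ)| <
    1 / 2 * min ((nextPoint T cps t : ℝ) - t) ((t : ℝ) - prevPoint cps t)).card

/-- The set of the change-points `t` that are estimated without error and have `kappa` equal
to `1`. -/
noncomputable def exactPoints (T : ℕ) (cps est : Finset ℕ) : Finset ℕ :=
  cps.filter fun t => t ∈ est ∧ kappa T cps est t = 1

/-- The probability of estimating a change-point with no error: conditionally on there being a
change-point, the probability that a uniformly selected one of the `J` change-points belongs to
`exactPoints`. -/
noncomputable def beta (T : ℕ) {Ω : Type*} [MeasurableSpace Ω] (P : MeasureTheory.Measure Ω)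
    (Y : ℕ → Ω → Bool) (est : Ω → Finset ℕ) : ℝ≥0∞ :=
  ∫⁻ ω, ((exactPoints T (changePoints T fun t => Y t ω) (est ω)).card : ℝ≥0∞) /
      ((changePoints T fun t => Y t ω).card : ℝ≥0∞)
    ∂(ProbabilityTheory.cond P {ω | 1 ≤ (changePoints T fun t => Y t ω).card})

/-! ### The extended scan-CUSUM algorithm -/

/-- `S(t) = X(1) + ⋯ + X(t)`. -/
noncomputable def partialSum (x : ℕ → ℝ) (t : ℕ) : ℝ :=
  ∑ u ∈ Finset.Icc 1 t, x u

/-- The scan statistic at `t` with window length `2 * l`. -/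
noncomputable def scanStat (σ : ℝ) (x : ℕ → ℝ) (l t : ℕ) : ℝ :=
  √(1 / (2 * l * σ ^ 2)) *
    (partialSum x (t + l) + partialSum x (t - l) - 2 * partialSum x t)

/-- The CUSUM statistic at `t` for the interval `(u, v)`. -/
noncomputable def cusum (σ : ℝ) (x : ℕ → ℝ) (u v t : ℕ) : ℝ :=
  √(((v : ℝ) - t) * ((t : ℝ) - u) / (((v : ℝ) - u) * σ ^ 2)) *
    ((partialSum x v - partialSum x t) / ((v : ℝ) - t) -
      (partialSum x t - partialSum x u) / ((t : ℝ) - u))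

/-- The profile likelihood at `t` for the interval `(u, v)`. -/
noncomputable def profileLik (σ : ℝ) (x : ℕ → ℝ) (u v t : ℕ) : ℝ :=
  if u < t ∧ t < v then Real.exp (1 / 2 * cusum σ x u v t ^ 2) else 0

open Classical in
/-- The set of the maximizers of `f` on `A`. -/
noncomputable def argmaxSet (A : Finset ℕ) (f : ℕ → ℝ) : Finset ℕ :=
  A.filter fun t => ∀ s ∈ A, f s ≤ f t

/-- `ℓ_b = ⌈ρ ^ b⌉`. -/
noncomputable def halfLen (ρ : ℝ) (b : ℕ) : ℕ := ⌈ρ ^ b⌉₊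

/-- `b_T`, the largest `b` with `2 * ℓ_b ≤ T - 1` (for `T ≥ 3`). -/
noncomputable def lastScale (ρ : ℝ) (T : ℕ) : ℕ :=
  sSup {b : ℕ | 2 * halfLen ρ b + 1 ≤ T}

/-- The set `A` of the algorithm for half-length `l` when `est` is the current set of estimated
change-points: all `t` with `l ≤ t ≤ T - l` such that there is no estimated change-point `u` with
`t - l + 1 ≤ u ≤ t + l - 1`. -/
def admissible (T l : ℕ) (est : Finset ℕ) : Finset ℕ :=
  (Finset.Icc l (T - l)).filter fun t => ∀ u ∈ est, ¬ (t < u + l ∧ u < t + l)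

/-- The condition of the while loop: the maximum of the absolute scan statistic over `A` is
at least `c`. -/
def Active (σ : ℝ) (T : ℕ) (x : ℕ → ℝ) (c : ℝ) (l : ℕ) (est : Finset ℕ) : Prop :=
  ∃ t ∈ admissible T l est, c ≤ |scanStat σ x l t|

/-- The location `t*` maximizing the absolute scan statistic over `A`; the function `pick` selects
one element of the (nonempty) set of the maximizers. -/
noncomputable def scanMax (pick : Finset ℕ → ℕ) (σ : ℝ) (T : ℕ) (x : ℕ → ℝ) (l : ℕ)
    (est : Finset ℕ) : ℕ :=
  pick (argmaxSet (admissible T l est) fun t => |scanStat σ x l t|)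

/-- The estimate in `I = (s - l, s + l)`, which maximizes `a(t) * L_I(t)` over `t ∈ I`. -/
noncomputable def localize (pick : Finset ℕ → ℕ) (σ : ℝ) (x a : ℕ → ℝ) (l s : ℕ) : ℕ :=
  pick (argmaxSet (Finset.Ioo (s - l) (s + l)) fun t => a t * profileLik σ x (s - l) (s + l) t)

open Classical in
/-- One iteration of the while loop; nothing changes once the loop has ended. -/
noncomputable def scanStep (pick : Finset ℕ → ℕ) (σ : ℝ) (T : ℕ) (x a : ℕ → ℝ) (c : ℝ) (l : ℕ)
    (est : Finset ℕ) : Finset ℕ :=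
  if Active σ T x c l est then insert (localize pick σ x a l (scanMax pick σ T x l est)) est
  else est

/-- The while loop. Every iteration removes `t*` from `A`, so that `T` iterations complete
the loop, see `not_active_scanLoop`. -/
noncomputable def scanLoop (pick : Finset ℕ → ℕ) (σ : ℝ) (T : ℕ) (x a : ℕ → ℝ) (c : ℝ) (l : ℕ)
    (est : Finset ℕ) : Finset ℕ :=
  (scanStep pick σ T x a c l)^[T] est

/-- The set of the change-points estimated by the extended scan-CUSUM algorithm: starting from the
empty set, the while loop is run for `b = 0, …, b_T`. -/
noncomputable def extendedScan (pick : Finset ℕ → ℕ) (ρ σ : ℝ) (T : ℕ) (c : ℝ)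
    (x a : ℕ → ℝ) : Finset ℕ :=
  (List.range (lastScale ρ T + 1)).foldl
    (fun est b => scanLoop pick σ T x a c (halfLen ρ b) est) ∅

/-- The threshold `√(2 log (T log T))`. -/
noncomputable def cScan (T : ℕ) : ℝ := √(2 * Real.log (T * Real.log T))

/-! ### The while loop ends within `T` iterations -/

theorem argmaxSet_nonempty {A : Finset ℕ} (hA : A.Nonempty) (f : ℕ → ℝ) :
    (argmaxSet A f).Nonempty := by
  obtain ⟨t, ht, h⟩ := A.exists_max_image f hA
  exact ⟨t, by simp only [argmaxSet, Finset.mem_filter]; exact ⟨ht, h⟩⟩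

theorem argmaxSet_subset (A : Finset ℕ) (f : ℕ → ℝ) : argmaxSet A f ⊆ A :=
  Finset.filter_subset _ _

theorem card_admissible_scanStep_lt {pick : Finset ℕ → ℕ}
    (hpick : ∀ s : Finset ℕ, s.Nonempty → pick s ∈ s) {σ : ℝ} {T : ℕ} {x a : ℕ → ℝ} {c : ℝ} {l : ℕ}
    (hl : 1 ≤ l) {est : Finset ℕ} (h : Active σ T x c l est) :
    (admissible T l (scanStep pick σ T x a c l est)).card < (admissible T l est).card := by
  have hs : scanMax pick σ T x l est ∈ admissible T l est :=
    argmaxSet_subset _ _ (hpick _ (argmaxSet_nonempty (h.imp fun _ ht => ht.1) _))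
  rw [scanStep, if_pos h]
  generalize scanMax pick σ T x l est = s at hs
  have hu : localize pick σ x a l s ∈ Finset.Ioo (s - l) (s + l) :=
    argmaxSet_subset _ _ (hpick _ (argmaxSet_nonempty
      ⟨s, by simp only [admissible, Finset.mem_filter, Finset.mem_Icc] at hs
             simp only [Finset.mem_Ioo]; omega⟩ _))
  generalize localize pick σ x a l s = u at hu
  refine Finset.card_lt_card ⟨fun t ht => ?_, fun hsub => ?_⟩
  · simp only [admissible, Finset.mem_filter] at ht ⊢
    exact ⟨ht.1, fun v hv => ht.2 v (Finset.mem_insert_of_mem hv)⟩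
  · have h2 := hsub hs
    simp only [admissible, Finset.mem_filter] at h2
    refine h2.2 u (Finset.mem_insert_self _ _) ?_
    simp only [Finset.mem_Ioo] at hu
    omega

/-- When the while loop has been run, its condition fails. -/
theorem not_active_scanLoop {pick : Finset ℕ → ℕ}
    (hpick : ∀ s : Finset ℕ, s.Nonempty → pick s ∈ s) (σ : ℝ) (T : ℕ) (x a : ℕ → ℝ) (c : ℝ) {l : ℕ}
    (hl : 1 ≤ l) (est : Finset ℕ) :
    ¬ Active σ T x c l (scanLoop pick σ T x a c l est) := by
  have key : ∀ (n : ℕ) (e : Finset ℕ), (admissible T l e).card ≤ n →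
      ¬ Active σ T x c l ((scanStep pick σ T x a c l)^[n] e) := by
    intro n
    induction n with
    | zero =>
      rintro e he ⟨t, ht, _⟩
      rw [Nat.le_zero, Finset.card_eq_zero] at he
      simp [he] at ht
    | succ n ih =>
      intro e he
      rw [Function.iterate_succ_apply]
      by_cases h : Active σ T x c l e
      · exact ih _ (by have := card_admissible_scanStep_lt (a := a) hpick hl h; omega)
      · have hfix : scanStep pick σ T x a c l e = e := by rw [scanStep, if_neg h]
        rw [hfix, Function.iterate_fixed hfix]
        exact h
  refine key T est ((Finset.card_filter_le _ _).trans ?_)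
  rw [Nat.card_Icc]
  omega

end ScanCusum

/-!
The theorem holds because almost every change-point can be treated in isolation, in a window whose
length is of the order of `log T`.

* *Locality.* Since `q = o(1 / log T)`, a typical change-point `τ` has no other change-point and no
  end-point within a fixed multiple of `log T`, and its jump lies in a fixed annulus
  `δ ≤ |Δ| ≤ M`, because the law of the jumps has no atom at zero. The threshold exceeds all the
  scan statistics of the pure noise with high probability: there are `O(T log T)` of them, each
  exceeds the threshold with probability at most `exp (-c ^ 2 / 2) / c = 1 / (c T log T)`, and `c`
  tends to infinity (`gaussianReal_abs_tail`). So detections only occur in windows that contain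
  change-points, and `τ` is detected at some half-length of the order of `log T`
  (`HasJump.trigger`). At that detection the signal alone accounts for a fixed fraction of the
  threshold, which forces `τ` to lie well inside the window (`HasJump.inside_of_trigger`).
* *Exact location.* The difference of the squared CUSUM statistics at `τ` and at `τ + k` is the
  difference of two between-group sums of squares (`between_sub_between`), so that the profile
  likelihood falls off by a factor of at least `exp (slope * |k| - loss)`
  (`HasJump.profileLik_le`). Hence the weighted profile likelihood is maximal at `τ` unless
  `a (τ + k) ≥ a τ * exp (slope * |k| - loss)` for some `k`. On `{Y τ = 1}` this has probability
  `E[a; a' ≥ a * κ]` with two independent intensities `a`, `a'`, which is at most a constant times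
  `min (q * exp (-slope * |k|)) (E (min a a'))`. Here `E (min a a') = ∫ (1 - G_q) ^ 2 = o(q)`
  (`IsModel.integral_min`), so the sum over `k` is `o(q)`.
* *The algorithm.* If `τ` and its two neighbours are all good in this sense, then `τ` is estimated
  exactly and no other estimate falls near it (`IsNice.mem_exactPoints`): at small scales the
  windows that trigger a detection are too short to reach from another change-point to the
  surroundings of `τ`, and at large scales the windows avoid `τ` and its neighbours, which have
  all been found. Therefore the number of failures is at most three times the number of bad
  change-points (`card_le_card_exactPoints`).
* *The criterion.* The expected number of bad change-points is `o(T q)`. The proportion of the bad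
  ones given `J ≥ 1` is then small as well, whether `T q` is bounded or not, by second moment
  bounds on `J` (`le_beta`).
-/

namespace ScanCusum

open MeasureTheory ProbabilityTheory

/-! ### The algorithm as a deterministic procedure -/

theorem one_le_halfLen {ρ : ℝ} (hρ : 1 < ρ) (b : ℕ) : 1 ≤ halfLen ρ b :=
  Nat.one_le_ceil_iff.2 (by positivity)

theorem halfLen_mono {ρ : ℝ} (hρ : 1 < ρ) : Monotone (halfLen ρ) := fun _ _ h =>
  Nat.ceil_mono (pow_le_pow_right₀ hρ.le h)

/-- An iteration of the while loop which changes the set of the estimates: the scan statistic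
reaches the threshold at an admissible location `s`, and a maximizer `u` of the weighted profile
likelihood over the window `(s - l, s + l)` is inserted. -/
structure Detects (σ : ℝ) (T : ℕ) (x a : ℕ → ℝ) (c : ℝ) (l : ℕ) (est : Finset ℕ) (s u : ℕ) :
    Prop where
  admissible : s ∈ admissible T l est
  le_scan : c ≤ |scanStat σ x l s|
  lo : s < u + l
  hi : u < s + l
  le_lik : ∀ t ∈ Finset.Ioo (s - l) (s + l),
    a t * profileLik σ x (s - l) (s + l) t ≤ a u * profileLik σ x (s - l) (s + l) u

theorem exists_detects_of_active {pick : Finset ℕ → ℕ}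
    (hpick : ∀ s : Finset ℕ, s.Nonempty → pick s ∈ s) {σ : ℝ} {T : ℕ} {x a : ℕ → ℝ} {c : ℝ} {l : ℕ}
    (hl : 1 ≤ l) {est : Finset ℕ} (h : Active σ T x c l est) :
    ∃ s u, Detects σ T x a c l est s u ∧ scanStep pick σ T x a c l est = insert u est := by
  have hne : (admissible T l est).Nonempty := h.imp fun _ ht => ht.1
  have hs' := hpick _ (argmaxSet_nonempty hne fun t => |scanStat σ x l t|)
  have hs : scanMax pick σ T x l est ∈ admissible T l est := argmaxSet_subset _ _ hs'
  have hsc : c ≤ |scanStat σ x l (scanMax pick σ T x l est)| := by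
    obtain ⟨t, ht, hc⟩ := h
    simp only [argmaxSet, Finset.mem_filter] at hs'
    exact hc.trans (hs'.2 t ht)
  refine ⟨scanMax pick σ T x l est, localize pick σ x a l (scanMax pick σ T x l est), ?_, ?_⟩
  · generalize scanMax pick σ T x l est = s at hs hsc
    have hsl : l ≤ s := by
      simp only [admissible, Finset.mem_filter, Finset.mem_Icc] at hs
      exact hs.1.1
    have hu' := hpick _ (argmaxSet_nonempty (A := Finset.Ioo (s - l) (s + l))
      ⟨s, by simp only [Finset.mem_Ioo]; omega⟩
      (fun t => a t * profileLik σ x (s - l) (s + l) t))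
    change localize pick σ x a l s ∈ _ at hu'
    simp only [argmaxSet, Finset.mem_filter] at hu'
    have hu := Finset.mem_Ioo.1 hu'.1
    exact ⟨hs, hsc, by omega, by omega, hu'.2⟩
  · rw [scanStep, if_pos h]

/-- A property of the set of the estimates that survives every detection at half-length `l`
survives the while loop. -/
theorem scanLoop_induction {pick : Finset ℕ → ℕ}
    (hpick : ∀ s : Finset ℕ, s.Nonempty → pick s ∈ s) {σ : ℝ} {T : ℕ} {x a : ℕ → ℝ} {c : ℝ} {l : ℕ}
    (hl : 1 ≤ l) {p : Finset ℕ → Prop}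
    (hp : ∀ e s u, p e → Detects σ T x a c l e s u → p (insert u e))
    {est : Finset ℕ} (h : p est) : p (scanLoop pick σ T x a c l est) := by
  unfold scanLoop
  generalize T = n at *
  have : ∀ m, p ((scanStep pick σ n x a c l)^[m] est) := by
    intro m
    induction m with
    | zero => exact h
    | succ m ih =>
      rw [Function.iterate_succ_apply']
      by_cases ha : Active σ n x c l ((scanStep pick σ n x a c l)^[m] est)
      · obtain ⟨s, u, hd, he⟩ := exists_detects_of_active (a := a) hpick hl ha
        rw [he]
        exact hp _ _ _ ih hd
      · rwa [scanStep, if_neg ha]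
  exact this n

/-- The change-point `τ` is well separated, every detection at a scale up to `bs` whose window
contains `τ` locates it exactly, and `τ` triggers a detection at the scale `bs`. -/
structure IsGood (ρ σ : ℝ) (T : ℕ) (x a : ℕ → ℝ) (c : ℝ) (bs : ℕ) (cps : Finset ℕ) (τ : ℕ) :
    Prop where
  mem : τ ∈ cps
  left : 4 * halfLen ρ bs ≤ τ
  right : τ + 4 * halfLen ρ bs ≤ T
  sep : ∀ p ∈ cps, p ≠ τ → p + 4 * halfLen ρ bs ≤ τ ∨ τ + 4 * halfLen ρ bs ≤ p
  loc : ∀ b ≤ bs, ∀ s, s < τ + halfLen ρ b → τ < s + halfLen ρ b →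
    c ≤ |scanStat σ x (halfLen ρ b) s| →
    ∀ t, s < t + halfLen ρ b → t < s + halfLen ρ b → t ≠ τ →
    a t * profileLik σ x (s - halfLen ρ b) (s + halfLen ρ b) t <
      a τ * profileLik σ x (s - halfLen ρ b) (s + halfLen ρ b) τ
  det : c ≤ |scanStat σ x (halfLen ρ bs) τ|

/-- A good change-point both of whose neighbours are good, or the end-points `0` and `T`. -/
structure IsNice (ρ σ : ℝ) (T : ℕ) (x a : ℕ → ℝ) (c : ℝ) (bs : ℕ) (cps : Finset ℕ) (τ : ℕ) :
    Prop where
  good : IsGood ρ σ T x a c bs cps τ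
  prev : prevPoint cps τ ∈ cps → IsGood ρ σ T x a c bs cps (prevPoint cps τ)
  next : nextPoint T cps τ ∈ cps → IsGood ρ σ T x a c bs cps (nextPoint T cps τ)

theorem le_prevPoint {cps : Finset ℕ} {p t : ℕ} (hp : p ∈ cps) (h : p < t) :
    p ≤ prevPoint cps t :=
  Finset.le_sup (f := id) (Finset.mem_filter.2 ⟨hp, h⟩)

theorem prevPoint_mem_or (cps : Finset ℕ) (t : ℕ) :
    (prevPoint cps t ∈ cps ∧ prevPoint cps t < t) ∨ prevPoint cps t = 0 := by
  by_cases h : (cps.filter (· < t)).Nonempty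
  · obtain ⟨i, hi, he⟩ := Finset.exists_mem_eq_sup _ h (id : ℕ → ℕ)
    left
    rw [prevPoint, he]
    exact Finset.mem_filter.1 hi
  · right
    rw [Finset.not_nonempty_iff_eq_empty] at h
    simp [prevPoint, h]

theorem nextPoint_le {T : ℕ} {cps : Finset ℕ} {p t : ℕ} (hp : p ∈ cps) (h : t < p) :
    nextPoint T cps t ≤ p :=
  Finset.min'_le _ _ (Finset.mem_insert_of_mem (Finset.mem_filter.2 ⟨hp, h⟩))

theorem nextPoint_mem_or (T : ℕ) (cps : Finset ℕ) (t : ℕ) :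
    (nextPoint T cps t ∈ cps ∧ t < nextPoint T cps t) ∨ nextPoint T cps t = T := by
  have h := Finset.min'_mem (insert T (cps.filter (t < ·))) (Finset.insert_nonempty _ _)
  change nextPoint T cps t ∈ _ at h
  rw [Finset.mem_insert, Finset.mem_filter] at h
  exact h.symm

/-- `u` is closer to `τ` than half the distance from `τ` to each of its neighbours. -/
def Near (T : ℕ) (cps : Finset ℕ) (τ u : ℕ) : Prop :=
  |(τ : ℝ) - (u : ℝ)| < 1 / 2 * min ((nextPoint T cps τ : ℝ) - τ) ((τ : ℝ) - prevPoint cps τ)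

theorem Near.bounds {T : ℕ} {cps : Finset ℕ} {τ u : ℕ} (h : Near T cps τ u) :
    2 * u < τ + nextPoint T cps τ ∧ τ + prevPoint cps τ < 2 * u ∧
    3 * τ < 2 * u + nextPoint T cps τ ∧ 2 * u + prevPoint cps τ < 3 * τ := by
  unfold Near at h
  rw [abs_lt] at h
  have h1 := min_le_left ((nextPoint T cps τ : ℝ) - τ) ((τ : ℝ) - prevPoint cps τ)
  have h2 := min_le_right ((nextPoint T cps τ : ℝ) - τ) ((τ : ℝ) - prevPoint cps τ)
  refine ⟨?_, ?_, ?_, ?_⟩ <;> rify <;> linarith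

section

variable {ρ σ : ℝ} {T : ℕ} {x a : ℕ → ℝ} {c : ℝ} {bs : ℕ} {cps : Finset ℕ} {pick : Finset ℕ → ℕ}

/-- Every detection happens in a window that contains a change-point. -/
def NoFalseAlarm (ρ σ : ℝ) (T : ℕ) (x : ℕ → ℝ) (c : ℝ) (cps : Finset ℕ) : Prop :=
  ∀ b ≤ lastScale ρ T, ∀ s, halfLen ρ b ≤ s → s ≤ T - halfLen ρ b →
    c ≤ |scanStat σ x (halfLen ρ b) s| → ∃ p ∈ cps, s < p + halfLen ρ b ∧ p < s + halfLen ρ b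

/-- Up to the scale `bs`, an estimate near a good change-point is equal to it, and every estimate
is near some change-point. -/
structure EarlyInv (ρ σ : ℝ) (T : ℕ) (x a : ℕ → ℝ) (c : ℝ) (bs : ℕ) (cps e : Finset ℕ) : Prop where
  eq_of_near : ∀ τ, IsGood ρ σ T x a c bs cps τ → ∀ u ∈ e,
    u < τ + 2 * halfLen ρ bs → τ < u + 2 * halfLen ρ bs → u = τ
  near : ∀ u ∈ e, ∃ p ∈ cps, u < p + 2 * halfLen ρ bs ∧ p < u + 2 * halfLen ρ bs

/-- From the scale `bs` on, all good change-points have been found, and a nice change-point has no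
other estimate nearby. -/
structure LateInv (ρ σ : ℝ) (T : ℕ) (x a : ℕ → ℝ) (c : ℝ) (bs : ℕ) (cps e : Finset ℕ) : Prop where
  mem : ∀ τ, IsGood ρ σ T x a c bs cps τ → τ ∈ e
  eq_of_near : ∀ τ, IsNice ρ σ T x a c bs cps τ → ∀ u ∈ e, Near T cps τ u → u = τ

theorem EarlyInv.insert (hρ : 1 < ρ) (hbs : bs ≤ lastScale ρ T)
    (hF : NoFalseAlarm ρ σ T x c cps) {b : ℕ} (hb : b ≤ bs) {e : Finset ℕ} {s u : ℕ}
    (he : EarlyInv ρ σ T x a c bs cps e) (hd : Detects σ T x a c (halfLen ρ b) e s u) :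
    EarlyInv ρ σ T x a c bs cps (insert u e) := by
  have hlen := halfLen_mono hρ hb
  have hs := hd.admissible
  simp only [admissible, Finset.mem_filter, Finset.mem_Icc] at hs
  obtain ⟨p, hp, hp1, hp2⟩ := hF b (hb.trans hbs) s hs.1.1 hs.1.2 hd.le_scan
  have h1 := hd.lo
  have h2 := hd.hi
  refine ⟨fun τ hτ v hv hv1 hv2 => ?_, fun v hv => ?_⟩
  · rcases Finset.mem_insert.1 hv with rfl | hv
    · by_contra hne
      have hpτ : p = τ := by
        by_contra hpne
        have := hτ.sep p hp hpne
        omega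
      subst hpτ
      refine (hτ.loc b hb s hp1 hp2 hd.le_scan v h1 h2 hne).not_ge (hd.le_lik p ?_)
      rw [Finset.mem_Ioo]
      omega
    · exact he.eq_of_near τ hτ v hv hv1 hv2
  · rcases Finset.mem_insert.1 hv with rfl | hv
    · exact ⟨p, hp, by omega, by omega⟩
    · exact he.near v hv

theorem EarlyInv.late (hF : ∀ τ ∈ cps, 1 ≤ τ ∧ τ < T) {e : Finset ℕ}
    (he : EarlyInv ρ σ T x a c bs cps e)
    (hmem : ∀ τ, IsGood ρ σ T x a c bs cps τ → τ ∈ e) : LateInv ρ σ T x a c bs cps e := by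
  refine ⟨hmem, fun τ hτ u hu hn => ?_⟩
  obtain ⟨p, hp, hp1, hp2⟩ := he.near u hu
  obtain ⟨n1, n2, n3, n4⟩ := hn.bounds
  rcases lt_trichotomy p τ with hlt | rfl | hlt
  · exfalso
    have hle := le_prevPoint hp hlt
    have hp0 := (hF p hp).1
    rcases prevPoint_mem_or cps τ with ⟨hm, hl⟩ | h0
    · have := hτ.good.sep _ hm hl.ne
      omega
    · omega
  · exact he.eq_of_near p hτ.good u hu hp1 hp2
  · exfalso
    have hle := nextPoint_le (T := T) hp hlt
    have hp0 := (hF p hp).2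
    rcases nextPoint_mem_or T cps τ with ⟨hm, hl⟩ | h0
    · have := hτ.good.sep _ hm hl.ne'
      omega
    · omega

theorem LateInv.insert (hcps : ∀ τ ∈ cps, 1 ≤ τ ∧ τ < T)
    (hF : NoFalseAlarm ρ σ T x c cps) {b : ℕ} (hb : b ≤ lastScale ρ T) {e : Finset ℕ} {s u : ℕ}
    (he : LateInv ρ σ T x a c bs cps e) (hd : Detects σ T x a c (halfLen ρ b) e s u) :
    LateInv ρ σ T x a c bs cps (insert u e) := by
  have hs := hd.admissible
  simp only [admissible, Finset.mem_filter, Finset.mem_Icc] at hs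
  obtain ⟨p, hp, hp1, hp2⟩ := hF b hb s hs.1.1 hs.1.2 hd.le_scan
  have h1 := hd.lo
  have h2 := hd.hi
  refine ⟨fun τ hτ => Finset.mem_insert_of_mem (he.mem τ hτ), fun τ hτ v hv hn => ?_⟩
  rcases Finset.mem_insert.1 hv with rfl | hv
  · exfalso
    obtain ⟨n1, n2, n3, n4⟩ := hn.bounds
    rcases lt_trichotomy p τ with hlt | rfl | hlt
    · have hle := le_prevPoint hp hlt
      have hp0 := (hcps p hp).1
      rcases prevPoint_mem_or cps τ with ⟨hm, hl⟩ | h0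
      · have := hs.2 _ (he.mem _ (hτ.prev hm))
        omega
      · omega
    · have := hs.2 _ (he.mem _ hτ.good)
      omega
    · have hle := nextPoint_le (T := T) hp hlt
      have hp0 := (hcps p hp).2
      rcases nextPoint_mem_or T cps τ with ⟨hm, hl⟩ | h0
      · have := hs.2 _ (he.mem _ (hτ.next hm))
        omega
      · omega
  · exact he.eq_of_near τ hτ v hv hn

open Classical in
/-- In `kappa` the set of the estimates is coerced to a set of real numbers by means of the monad
structure of `Finset`. -/
theorem mem_bind_pure_cast (s : Finset ℕ) (v : ℝ) :
    v ∈ (do let u ← s; pure (u : ℝ) : Finset ℝ) ↔ ∃ u ∈ s, (u : ℝ) = v := by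
  simp [Finset.bind_def, Finset.pure_def, eq_comm]

/-- A nice change-point is estimated exactly, and by a single estimate. -/
theorem IsNice.mem_exactPoints (hpick : ∀ s : Finset ℕ, s.Nonempty → pick s ∈ s) (hρ : 1 < ρ)
    (hcps : ∀ τ ∈ cps, 1 ≤ τ ∧ τ < T) (hbs : bs ≤ lastScale ρ T)
    (hF : NoFalseAlarm ρ σ T x c cps) {τ : ℕ} (hτ : IsNice ρ σ T x a c bs cps τ) :
    τ ∈ exactPoints T cps (extendedScan pick ρ σ T c x a) := by
  -- `E n` is the set of the estimates after the scales `0, …, n - 1`.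
  set E : ℕ → Finset ℕ := fun n => (List.range n).foldl
    (fun est b => scanLoop pick σ T x a c (halfLen ρ b) est) ∅ with hE
  have hsucc : ∀ n, E (n + 1) = scanLoop pick σ T x a c (halfLen ρ n) (E n) := fun n => by
    simp [hE, List.range_succ]
  have early : ∀ n ≤ bs + 1, EarlyInv ρ σ T x a c bs cps (E n) := by
    intro n
    induction n with
    | zero => exact fun _ => ⟨by simp [hE], by simp [hE]⟩
    | succ n ih =>
      intro hn
      rw [hsucc]
      exact scanLoop_induction hpick (one_le_halfLen hρ n)
        (fun e s u he hd => he.insert hρ hbs hF (by omega) hd) (ih (by omega))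
  have late0 : LateInv ρ σ T x a c bs cps (E (bs + 1)) := by
    refine (early _ le_rfl).late hcps fun t ht => ?_
    by_contra hmem
    have hna := not_active_scanLoop hpick σ T x a c (one_le_halfLen hρ bs) (E bs)
    rw [← hsucc] at hna
    refine hna ⟨t, ?_, ht.det⟩
    have hleft := ht.left
    have hright := ht.right
    simp only [admissible, Finset.mem_filter, Finset.mem_Icc]
    refine ⟨by omega, fun u hu hlt => hmem ?_⟩
    rwa [← (early _ le_rfl).eq_of_near t ht u hu (by omega) (by omega)]
  have late : ∀ n, bs + n ≤ lastScale ρ T → LateInv ρ σ T x a c bs cps (E (bs + n + 1)) := by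
    intro n
    induction n with
    | zero => exact fun _ => late0
    | succ n ih =>
      intro hn
      rw [← add_assoc, hsucc]
      exact scanLoop_induction hpick (one_le_halfLen hρ _)
        (fun e s u he hd => he.insert hcps hF (by omega) hd) (ih (by omega))
  obtain ⟨n, hn⟩ := Nat.exists_eq_add_of_le hbs
  have hfin := late n hn.symm.le
  rw [← hn] at hfin
  change LateInv ρ σ T x a c bs cps (extendedScan pick ρ σ T c x a) at hfin
  have hmem := hfin.mem τ hτ.good
  simp only [exactPoints, Finset.mem_filter]
  refine ⟨hτ.good.mem, hmem, ?_⟩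
  rw [kappa, Finset.card_eq_one]
  refine ⟨(τ : ℝ), Finset.eq_singleton_iff_unique_mem.2 ⟨?_, ?_⟩⟩
  · refine Finset.mem_filter.2 ⟨(mem_bind_pure_cast _ _).2 ⟨τ, hmem, rfl⟩, ?_⟩
    have h1 := hτ.good.left
    have h2 := hτ.good.right
    have h3 := one_le_halfLen hρ bs
    have hp : prevPoint cps τ < τ := by
      rcases prevPoint_mem_or cps τ with h | h <;> omega
    have hn : τ < nextPoint T cps τ := by
      rcases nextPoint_mem_or T cps τ with h | h <;> omega
    rify at hp hn
    rw [sub_self, abs_zero]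
    have := lt_min (sub_pos.2 hn) (sub_pos.2 hp)
    linarith
  · intro v hv
    rw [Finset.mem_filter, mem_bind_pure_cast] at hv
    obtain ⟨⟨u, hu, rfl⟩, hn⟩ := hv
    rw [hfin.eq_of_near τ hτ u hu hn]

open Classical in
/-- A change-point that is not nice is bad or the neighbour of a bad one, and every change-point
has at most two neighbours. -/
theorem card_le_card_exactPoints (hpick : ∀ s : Finset ℕ, s.Nonempty → pick s ∈ s) (hρ : 1 < ρ)
    (hcps : ∀ τ ∈ cps, 1 ≤ τ ∧ τ < T) (hbs : bs ≤ lastScale ρ T)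
    (hF : NoFalseAlarm ρ σ T x c cps) {bad : Finset ℕ}
    (hbad : ∀ τ ∈ cps, τ ∉ bad → IsGood ρ σ T x a c bs cps τ) :
    cps.card ≤ (exactPoints T cps (extendedScan pick ρ σ T c x a)).card + 3 * bad.card := by
  set A := cps.filter fun τ => prevPoint cps τ ∈ cps ∧ prevPoint cps τ ∈ bad
  set B := cps.filter fun τ => nextPoint T cps τ ∈ cps ∧ nextPoint T cps τ ∈ bad
  have hA : A.card ≤ bad.card := by
    refine Finset.card_le_card_of_injOn (prevPoint cps) (fun τ hτ => (Finset.mem_filter.1 hτ).2.2)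
      fun s hs t ht hst => ?_
    rw [Finset.mem_coe, Finset.mem_filter] at hs ht
    have h0 := (hcps _ hs.2.1).1
    have hs2 := prevPoint_mem_or cps s
    have ht2 := prevPoint_mem_or cps t
    rcases lt_trichotomy s t with h | h | h
    · have := le_prevPoint hs.1 h
      omega
    · exact h
    · have := le_prevPoint ht.1 h
      omega
  have hB : B.card ≤ bad.card := by
    refine Finset.card_le_card_of_injOn (nextPoint T cps)
      (fun τ hτ => (Finset.mem_filter.1 hτ).2.2) fun s hs t ht hst => ?_
    rw [Finset.mem_coe, Finset.mem_filter] at hs ht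
    have h0 := (hcps _ hs.2.1).2
    have hs2 := nextPoint_mem_or T cps s
    have ht2 := nextPoint_mem_or T cps t
    rcases lt_trichotomy s t with h | h | h
    · have := nextPoint_le (T := T) ht.1 h
      omega
    · exact h
    · have := nextPoint_le (T := T) hs.1 h
      omega
  have hsub : cps ⊆ exactPoints T cps (extendedScan pick ρ σ T c x a) ∪ (bad ∪ (A ∪ B)) := by
    intro τ hτ
    by_contra hn
    simp only [Finset.mem_union, not_or] at hn
    obtain ⟨hn1, hn2, hn3, hn4⟩ := hn
    refine hn1 (IsNice.mem_exactPoints hpick hρ hcps hbs hF ⟨hbad τ hτ hn2, fun h => ?_, fun h => ?_⟩)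
    · exact hbad _ h fun hb => hn3 (Finset.mem_filter.2 ⟨hτ, h, hb⟩)
    · exact hbad _ h fun hb => hn4 (Finset.mem_filter.2 ⟨hτ, h, hb⟩)
  have := Finset.card_le_card hsub
  have h1 := Finset.card_union_le (exactPoints T cps (extendedScan pick ρ σ T c x a))
    (bad ∪ (A ∪ B))
  have h2 := Finset.card_union_le bad (A ∪ B)
  have h3 := Finset.card_union_le A B
  omega

end

/-! ### Deterministic analysis of the windows around a change-point -/

theorem partialSum_sub (x : ℕ → ℝ) {i j : ℕ} (h : i ≤ j) :
    partialSum x j - partialSum x i = ∑ u ∈ Finset.Ioc i j, x u := by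
  have key : ∀ n, partialSum x n = ∑ u ∈ Finset.Ioc 0 n, x u := fun n => rfl
  rw [key, key, ← Finset.sum_Ioc_consecutive x (Nat.zero_le i) h, add_sub_cancel_left]

/-- The difference of two between-group sums of squares for the splits of three consecutive groups
with sizes `n₁, k, n₃` and sums `A, B, C` after the first and after the second group. -/
theorem between_sub_between {n₁ k n₃ : ℝ} (h₁ : 0 < n₁) (hk : 0 < k) (h₃ : 0 < n₃) (A B C : ℝ) :
    n₁ * (k + n₃) / (n₁ + k + n₃) * ((B + C) / (k + n₃) - A / n₁) ^ 2 -
      (n₁ + k) * n₃ / (n₁ + k + n₃) * (C / n₃ - (A + B) / (n₁ + k)) ^ 2 =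
    k * (n₁ / (n₁ + k) * (B / k - A / n₁) ^ 2 - n₃ / (k + n₃) * (C / n₃ - B / k) ^ 2) := by
  have : n₁ + k + n₃ ≠ 0 := by positivity
  have : n₁ + k ≠ 0 := by positivity
  have : k + n₃ ≠ 0 := by positivity
  field_simp
  ring

/-- If the mean changes by `D` between the first group and the other two, then the split after the
first group beats the split after the second by an amount linear in the size `k` of the second
group, provided that the noise `a, b, c` in the three groups is moderate. -/
theorem split_gain {n₁ k n₃ m D a b c z w c₁ η β d : ℝ} (h₁ : 0 < n₁) (hk : 0 < k) (h₃ : 0 < n₃)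
    (ha : a ^ 2 ≤ z * n₁) (hb : b ^ 2 ≤ k * (β + η * k)) (hc : c ^ 2 ≤ z * n₃)
    (hw₁ : z ≤ w * n₁) (hw₂ : z ≤ w * (k + n₃)) (hc₁ : c₁ * (n₁ + k + n₃) ≤ n₁) (hc₁0 : 0 ≤ c₁)
    (hd : d ≤ D ^ 2) (hd0 : 0 ≤ d) :
    k * (c₁ * d / 2 - 4 * w - 4 * η) - 4 * β ≤
      k * (n₁ / (n₁ + k) * (((m + D) * k + b) / k - (m * n₁ + a) / n₁) ^ 2 -
        n₃ / (k + n₃) * (((m + D) * n₃ + c) / n₃ - ((m + D) * k + b) / k) ^ 2) := by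
  have e1 : ((m + D) * k + b) / k - (m * n₁ + a) / n₁ = D + (b / k - a / n₁) := by
    field_simp; ring
  have e2 : ((m + D) * n₃ + c) / n₃ - ((m + D) * k + b) / k = c / n₃ - b / k := by
    field_simp; ring
  rw [e1, e2]
  have hb' : k * (b / k) ^ 2 ≤ β + η * k := by
    have : k * (b / k) ^ 2 = b ^ 2 / k := by field_simp
    rw [this, div_le_iff₀ hk]; linarith
  have ha' : (a / n₁) ^ 2 ≤ w := by
    rw [div_pow, div_le_iff₀ (by positivity)]
    nlinarith
  have hc' : n₃ / (k + n₃) * (c / n₃) ^ 2 ≤ w := by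
    have : n₃ / (k + n₃) * (c / n₃) ^ 2 = c ^ 2 / (n₃ * (k + n₃)) := by field_simp
    rw [this, div_le_iff₀ (by positivity)]
    nlinarith
  set α := b / k
  set γ := a / n₁
  set κ := c / n₃
  set r := n₁ / (n₁ + k) with hr
  set r' := n₃ / (k + n₃) with hr'
  have r1 : r ≤ 1 := by rw [hr, div_le_one (by positivity)]; linarith
  have r0 : 0 ≤ r := by positivity
  have rc : c₁ ≤ r := by
    rw [hr, le_div_iff₀ (by positivity)]
    nlinarith
  have r1' : r' ≤ 1 := by rw [hr', div_le_one (by positivity)]; linarith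
  have r0' : 0 ≤ r' := by positivity
  have s1 : D ^ 2 / 2 - (2 * α ^ 2 + 2 * γ ^ 2) ≤ (D + (α - γ)) ^ 2 := by
    nlinarith [sq_nonneg (D + 2 * (α - γ)), sq_nonneg (α + γ)]
  have s2 : (κ - α) ^ 2 ≤ 2 * κ ^ 2 + 2 * α ^ 2 := by nlinarith [sq_nonneg (κ + α)]
  have t1 : c₁ * d / 2 - (2 * α ^ 2 + 2 * w) ≤ r * (D + (α - γ)) ^ 2 := by
    have := mul_le_mul_of_nonneg_left s1 r0
    have h2 : c₁ * d ≤ r * D ^ 2 := mul_le_mul rc hd hd0 r0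
    have h3 : r * (2 * α ^ 2 + 2 * γ ^ 2) ≤ 1 * (2 * α ^ 2 + 2 * w) :=
      mul_le_mul r1 (by linarith) (by positivity) zero_le_one
    linarith
  have t2 : r' * (κ - α) ^ 2 ≤ 2 * w + 2 * α ^ 2 := by
    have := mul_le_mul_of_nonneg_left s2 r0'
    have h3 : r' * (2 * α ^ 2) ≤ 1 * (2 * α ^ 2) :=
      mul_le_mul_of_nonneg_right r1' (by positivity)
    linarith
  have t3 : k * (c₁ * d / 2 - 4 * w - 4 * α ^ 2) ≤
      k * (r * (D + (α - γ)) ^ 2 - r' * (κ - α) ^ 2) :=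
    mul_le_mul_of_nonneg_left (by linarith) hk.le
  linarith

theorem cusum_sq {σ : ℝ} (hσ : 0 < σ) (x : ℕ → ℝ) {u t v : ℕ} (hu : u < t) (hv : t < v) :
    σ ^ 2 * cusum σ x u v t ^ 2 =
      ((t : ℝ) - u) * ((v : ℝ) - t) / ((v : ℝ) - u) *
        ((partialSum x v - partialSum x t) / ((v : ℝ) - t) -
          (partialSum x t - partialSum x u) / ((t : ℝ) - u)) ^ 2 := by
  rify at hu hv
  have h1 : (0 : ℝ) < t - u := sub_pos.2 hu
  have h2 : (0 : ℝ) < v - t := sub_pos.2 hv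
  have h3 : (0 : ℝ) < v - u := by linarith
  rw [cusum, mul_pow, Real.sq_sqrt (by positivity)]
  field_simp

/-- In the range `(τ - R, τ + R]` the data `x` are the sum of the noise `e` and a signal with mean
`m` up to `τ` and mean `m + D` after `τ`. -/
structure HasJump (x e : ℕ → ℝ) (τ R : ℕ) (m D : ℝ) : Prop where
  left : ∀ i, τ < i + R → i ≤ τ → x i = m + e i
  right : ∀ i, τ < i → i ≤ τ + R → x i = m + D + e i

/-- The noise around `τ` is moderate: `linear` bounds its partial sums started at `τ`, and `square`
bounds all its increments on the scale of a logarithm. -/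
structure ModerateNoise (e : ℕ → ℝ) (τ R : ℕ) (z η β : ℝ) : Prop where
  linear : ∀ j, τ ≤ j + R → j ≤ τ + R →
    (partialSum e j - partialSum e τ) ^ 2 ≤ |(j : ℝ) - τ| * (β + η * |(j : ℝ) - τ|)
  square : ∀ i j, τ ≤ i + R → i ≤ j → j ≤ τ + R →
    (partialSum e j - partialSum e i) ^ 2 ≤ z * ((j : ℝ) - i)

section

variable {x e : ℕ → ℝ} {τ R : ℕ} {m D z η β : ℝ}

theorem HasJump.sum_left (h : HasJump x e τ R m D) {i j : ℕ} (hi : τ ≤ i + R) (hij : i ≤ j)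
    (hj : j ≤ τ) : partialSum x j - partialSum x i =
      m * ((j : ℝ) - i) + (partialSum e j - partialSum e i) := by
  rw [partialSum_sub x hij, partialSum_sub e hij]
  rw [Finset.sum_congr rfl (g := fun u => m + e u) fun u hu => ?_]
  · rw [Finset.sum_add_distrib, Finset.sum_const, Nat.card_Ioc, nsmul_eq_mul, Nat.cast_sub hij]
    ring
  · rw [Finset.mem_Ioc] at hu
    exact h.left u (by omega) (by omega)

theorem HasJump.sum_right (h : HasJump x e τ R m D) {i j : ℕ} (hi : τ ≤ i) (hij : i ≤ j)
    (hj : j ≤ τ + R) : partialSum x j - partialSum x i =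
      (m + D) * ((j : ℝ) - i) + (partialSum e j - partialSum e i) := by
  rw [partialSum_sub x hij, partialSum_sub e hij]
  rw [Finset.sum_congr rfl (g := fun u => (m + D) + e u) fun u hu => ?_]
  · rw [Finset.sum_add_distrib, Finset.sum_const, Nat.card_Ioc, nsmul_eq_mul, Nat.cast_sub hij]
    ring
  · rw [Finset.mem_Ioc] at hu
    exact h.right u (by omega) (by omega)

/-- In a window where the change-point `τ` is not too close to the boundary, the squared CUSUM
statistic falls off linearly with the distance from `τ`. -/
theorem HasJump.cusum_gain {σ : ℝ} (hσ : 0 < σ) (h : HasJump x e τ R m D)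
    (hn : ModerateNoise e τ R z η β) {u v t : ℕ} (huR : τ ≤ u + R) (hvR : v ≤ τ + R) (hu : u < τ)
    (hv : τ < v) (hut : u < t) (htv : t < v) (hne : t ≠ τ) {w c₁ d : ℝ} (hc₁0 : 0 ≤ c₁)
    (hd : d ≤ D ^ 2) (hd0 : 0 ≤ d)
    (hwu : z ≤ w * ((τ : ℝ) - u)) (hwv : z ≤ w * ((v : ℝ) - τ))
    (hcu : c₁ * ((v : ℝ) - u) ≤ (τ : ℝ) - u) (hcv : c₁ * ((v : ℝ) - u) ≤ (v : ℝ) - τ) :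
    |(t : ℝ) - τ| * (c₁ * d / 2 - 4 * w - 4 * η) - 4 * β ≤
      σ ^ 2 * (cusum σ x u v τ ^ 2 - cusum σ x u v t ^ 2) := by
  rw [mul_sub (σ ^ 2), cusum_sq hσ x hu hv, cusum_sq hσ x hut htv]
  have hu' : (0 : ℝ) < τ - u := sub_pos.2 (by exact_mod_cast hu)
  have hv' : (0 : ℝ) < v - τ := sub_pos.2 (by exact_mod_cast hv)
  have hut' : (0 : ℝ) < t - u := sub_pos.2 (by exact_mod_cast hut)
  have htv' : (0 : ℝ) < v - t := sub_pos.2 (by exact_mod_cast htv)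
  have hl := hn.linear t (by omega) (by omega)
  rcases lt_or_gt_of_ne hne with hlt | hlt
  · -- `t` lies to the left of `τ`: the three groups are `(τ, v]`, `(t, τ]`, `(u, t]`
    have hk : (0 : ℝ) < τ - t := sub_pos.2 (by exact_mod_cast hlt)
    have habs : |(t : ℝ) - τ| = τ - t := by rw [abs_sub_comm, abs_of_pos hk]
    rw [habs] at hl ⊢
    have sA := h.sum_right (i := τ) (j := v) le_rfl hv.le hvR
    have sB := h.sum_left (i := t) (j := τ) (by omega) hlt.le le_rfl
    have sC := h.sum_left (i := u) (j := t) huR hut.le hlt.le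
    have nA := hn.square τ v (by omega) hv.le hvR
    have nC := hn.square u t huR hut.le (by omega)
    have key := split_gain (m := m + D) (D := -D) (n₁ := (v : ℝ) - τ) (k := (τ : ℝ) - t)
      (n₃ := (t : ℝ) - u) (a := partialSum e v - partialSum e τ)
      (b := partialSum e τ - partialSum e t) (c := partialSum e t - partialSum e u)
      (z := z) (w := w) (c₁ := c₁) (η := η) (β := β) (d := d) hv' hk hut' nA
      (by rw [← neg_sq, neg_sub]; exact hl) nC hwv (by linarith) (by linarith) hc₁0
      (by rw [neg_sq]; exact hd) hd0
    refine key.trans (le_of_eq ?_)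
    have id := between_sub_between hv' hk hut' (partialSum x v - partialSum x τ)
      (partialSum x τ - partialSum x t) (partialSum x t - partialSum x u)
    rw [add_neg_cancel_right, ← sA, ← sB, ← sC, ← id]
    have e1 : (v : ℝ) - τ + (τ - t) = v - t := by ring
    have e2 : (τ : ℝ) - t + (t - u) = τ - u := by ring
    have e3 : (v : ℝ) - t + (t - u) = v - u := by ring
    rw [e1, e2, e3, sub_add_sub_cancel, sub_add_sub_cancel]
    ring
  · have hk : (0 : ℝ) < t - τ := sub_pos.2 (by exact_mod_cast hlt)
    rw [abs_of_pos hk] at hl ⊢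
    have sA := h.sum_left (i := u) (j := τ) huR hu.le le_rfl
    have sB := h.sum_right (i := τ) (j := t) le_rfl hlt.le (by omega)
    have sC := h.sum_right (i := t) (j := v) hlt.le htv.le hvR
    have nA := hn.square u τ huR hu.le (by omega)
    have nC := hn.square t v (by omega) htv.le hvR
    have key := split_gain (m := m) (D := D) (n₁ := (τ : ℝ) - u) (k := (t : ℝ) - τ)
      (n₃ := (v : ℝ) - t) (a := partialSum e τ - partialSum e u)
      (b := partialSum e t - partialSum e τ) (c := partialSum e v - partialSum e t)
      (z := z) (w := w) (c₁ := c₁) (η := η) (β := β) (d := d) hu' hk htv' nA hl nC hwu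
      (by linarith) (by linarith) hc₁0 hd hd0
    refine key.trans (le_of_eq ?_)
    have id := between_sub_between hu' hk htv' (partialSum x τ - partialSum x u)
      (partialSum x t - partialSum x τ) (partialSum x v - partialSum x t)
    rw [← sA, ← sB, ← sC, ← id]
    have e1 : (τ : ℝ) - u + (t - τ) = t - u := by ring
    have e2 : (t : ℝ) - τ + (v - t) = v - τ := by ring
    have e3 : (t : ℝ) - u + (v - t) = v - u := by ring
    rw [e1, e2, e3]
    ring

/-- The scan statistic at `s` is that of a triangular signal with peak at `τ`, up to the noise. -/
theorem HasJump.exists_scanStat_eq (h : HasJump x e τ R m D) (hn : ModerateNoise e τ R z η β)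
    {s l : ℕ} (hl : τ + l ≤ s + R) (hr : s + l ≤ τ + R) (hls : l ≤ s)
    (h1 : s < τ + l) (h2 : τ < s + l) (σ : ℝ) :
    ∃ n : ℝ, |n| ≤ 2 * √(z * l) ∧
      scanStat σ x l s = √(1 / (2 * l * σ ^ 2)) * (D * (l - |(s : ℝ) - τ|) + n) := by
  refine ⟨(partialSum e (s + l) - partialSum e s) - (partialSum e s - partialSum e (s - l)), ?_, ?_⟩
  · have n1 := hn.square s (s + l) (by omega) (by omega) (by omega)
    have n2 := hn.square (s - l) s (by omega) (by omega) (by omega)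
    have c1 : ((s + l : ℕ) : ℝ) - s = l := by push_cast; ring
    have c2 : (s : ℝ) - (s - l : ℕ) = l := by push_cast [Nat.cast_sub hls]; ring
    rw [c1] at n1
    rw [c2] at n2
    have := abs_sub (partialSum e (s + l) - partialSum e s)
      (partialSum e s - partialSum e (s - l))
    have := Real.abs_le_sqrt n1
    have := Real.abs_le_sqrt n2
    linarith
  · rw [scanStat]
    congr 1
    rcases le_total s τ with hs | hs
    · have s1 := h.sum_left (i := s) (j := τ) (by omega) hs le_rfl
      have s2 := h.sum_right (i := τ) (j := s + l) le_rfl (by omega) (by omega)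
      have s3 := h.sum_left (i := s - l) (j := s) (by omega) (by omega) hs
      push_cast [Nat.cast_sub hls] at s1 s2 s3
      have : |(s : ℝ) - τ| = τ - s := by
        rw [abs_sub_comm, abs_of_nonneg (sub_nonneg.2 (by exact_mod_cast hs))]
      rw [this]
      linear_combination s1 + s2 - s3
    · have s1 := h.sum_right (i := s) (j := s + l) (by omega) (by omega) (by omega)
      have s2 := h.sum_right (i := τ) (j := s) le_rfl hs (by omega)
      have s3 := h.sum_left (i := s - l) (j := τ) (by omega) (by omega) le_rfl
      push_cast [Nat.cast_sub hls] at s1 s2 s3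
      have : |(s : ℝ) - τ| = s - τ := abs_of_nonneg (sub_nonneg.2 (by exact_mod_cast hs))
      rw [this]
      linear_combination s1 - s2 - s3

end

/-- The constants of the local analysis. The jump lies between `δ` and `M` in absolute value; the
detection happens at a half-length of at most `maxLen * log T`; the change-point then lies at a
distance of at least `2 * c₁` half-lengths from the ends of the window; `ζ`, `η` and `β` bound the
noise as in `ModerateNoise`, with `z = ζ ^ 2 * log T`. -/
structure Tuning (σ : ℝ) where
  (δ M c₁ η ζ β : ℝ)
  hδ : 0 < δ
  hM : 0 < M
  hc₁ : 0 < c₁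
  hη : 0 < η
  hζ : 0 < ζ
  hβ : σ ^ 2 ≤ β
  hζσ : ζ ≤ σ / 2
  hc₁M : 4 * c₁ ^ 2 * M ^ 2 * (48 * σ ^ 2 / δ ^ 2) ≤ σ ^ 2
  noise_le : 16 * (ζ ^ 2 * M ^ 2 / σ ^ 2 + η) ≤ c₁ * δ ^ 2

namespace Tuning

variable {σ : ℝ} (A : Tuning σ)

/-- Detection at or before `maxLen * log T`. -/
noncomputable def maxLen : ℝ := 48 * σ ^ 2 / A.δ ^ 2

/-- The slope of the log-likelihood around a change-point. -/
noncomputable def slope : ℝ := A.c₁ * A.δ ^ 2 / (8 * σ ^ 2)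

/-- The possible loss of log-likelihood at the points next to a change-point. -/
noncomputable def loss : ℝ := 2 * A.β / σ ^ 2

theorem slope_pos (hσ : 0 < σ) : 0 < A.slope := by
  have := A.hc₁
  have := A.hδ
  unfold slope
  positivity

theorem maxLen_pos (hσ : 0 < σ) : 0 < A.maxLen := by
  have := A.hδ
  unfold maxLen
  positivity

theorem loss_pos (hσ : 0 < σ) : 0 < A.loss := by
  have : 0 < A.β := lt_of_lt_of_le (by positivity) A.hβ
  unfold loss
  positivity

end Tuning

theorem sqrt_window {σ l : ℝ} (hσ : 0 < σ) (hl : 0 < l) :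
    √(1 / (2 * l * σ ^ 2)) = (√2 * √l * σ)⁻¹ := by
  rw [one_div, Real.sqrt_inv, Real.sqrt_mul (by positivity), Real.sqrt_mul (by positivity),
    Real.sqrt_sq hσ.le]

section

variable {σ : ℝ} (A : Tuning σ) {x e : ℕ → ℝ} {τ R : ℕ} {m D L c : ℝ}

/-- A window which contains `τ` and triggers a detection has `τ` well inside. -/
theorem HasJump.inside_of_trigger (hσ : 0 < σ) (h : HasJump x e τ R m D)
    (hn : ModerateNoise e τ R (A.ζ ^ 2 * L) A.η A.β) (hL : 0 < L) (hcL : √2 * √L ≤ c)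
    (hDM : |D| ≤ A.M) {s l : ℕ} (hl : τ + l ≤ s + R) (hr : s + l ≤ τ + R) (hls : l ≤ s)
    (hl0 : 0 < l) (h1 : s < τ + l) (h2 : τ < s + l) (hlL : (l : ℝ) ≤ A.maxLen * L)
    (hc : c ≤ |scanStat σ x l s|) :
    L ≤ A.M ^ 2 / σ ^ 2 * (l - |(s : ℝ) - τ|) ∧ 2 * A.c₁ * l ≤ l - |(s : ℝ) - τ| := by
  obtain ⟨n, hn1, hn2⟩ := h.exists_scanStat_eq hn hl hr hls h1 h2 σ
  have hl0' : (0 : ℝ) < l := by exact_mod_cast hl0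
  have hδ := A.hδ
  have hM := A.hM
  have hc₁ := A.hc₁
  have hζ := A.hζ
  rw [hn2, sqrt_window hσ hl0', abs_mul, abs_of_pos (by positivity), ← div_eq_inv_mul,
    le_div_iff₀ (by positivity)] at hc
  have hpos : 0 < (l : ℝ) - |(s : ℝ) - τ| := by
    have : |(s : ℝ) - τ| < l := by
      rw [abs_lt]
      constructor
      · have : (τ : ℝ) < s + l := by exact_mod_cast h2
        linarith
      · have : (s : ℝ) < τ + l := by exact_mod_cast h1
        linarith
    linarith
  set N := (l : ℝ) - |(s : ℝ) - τ|
  have hNl : N ≤ l := by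
    have := abs_nonneg ((s : ℝ) - τ)
    simp only [N]
    linarith
  have hsq : √(A.ζ ^ 2 * L * l) = A.ζ * (√L * √l) := by
    rw [mul_assoc, Real.sqrt_mul (by positivity), Real.sqrt_sq hζ.le, Real.sqrt_mul hL.le]
  rw [hsq] at hn1
  set y := √L * √(l : ℝ) with hy
  have hy0 : 0 < y := by positivity
  have hy2 : y ^ 2 = L * l := by
    rw [hy, mul_pow, Real.sq_sqrt hL.le, Real.sq_sqrt hl0'.le]
  have hup : |D * N + n| ≤ A.M * N + σ * y := by
    refine (abs_add_le _ _).trans ?_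
    rw [abs_mul, abs_of_pos hpos]
    have := mul_le_mul_of_nonneg_right hDM hpos.le
    have := mul_le_mul_of_nonneg_right A.hζσ hy0.le
    linarith
  -- The threshold is at least twice the bound `2 * ζ * y ≤ σ * y` on the noise, so the signal
  -- `D * N` accounts for at least half of it.
  have hlow : 2 * (σ * y) ≤ c * (√2 * √(l : ℝ) * σ) := by
    have := mul_le_mul_of_nonneg_right hcL (by positivity : 0 ≤ √2 * √(l : ℝ) * σ)
    have e : √2 * √L * (√2 * √(l : ℝ) * σ) = (√2 * √2) * (σ * y) := by rw [hy]; ring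
    rw [e, Real.mul_self_sqrt zero_le_two] at this
    exact this
  have hmain : σ * y ≤ A.M * N := by linarith
  have hsq2 : σ ^ 2 * (L * l) ≤ A.M ^ 2 * N ^ 2 := by
    have := pow_le_pow_left₀ (by positivity) hmain 2
    rwa [mul_pow σ, mul_pow A.M, hy2] at this
  constructor
  · have : σ ^ 2 * L * l ≤ A.M ^ 2 * N * l := by
      have : A.M ^ 2 * N * N ≤ A.M ^ 2 * N * l := mul_le_mul_of_nonneg_left hNl (by positivity)
      linarith
    have := le_of_mul_le_mul_right this hl0'
    rw [div_mul_eq_mul_div, le_div_iff₀ (by positivity)]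
    linarith
  · have hC := A.maxLen_pos hσ
    have h3 : σ ^ 2 * l ^ 2 ≤ A.maxLen * (A.M ^ 2 * N ^ 2) := by
      calc σ ^ 2 * (l : ℝ) ^ 2 = σ ^ 2 * l * l := by ring
        _ ≤ σ ^ 2 * l * (A.maxLen * L) := mul_le_mul_of_nonneg_left hlL (by positivity)
        _ = A.maxLen * (σ ^ 2 * (L * l)) := by ring
        _ ≤ _ := mul_le_mul_of_nonneg_left hsq2 hC.le
    have h4 : (2 * A.c₁ * l) ^ 2 * (A.M ^ 2 * A.maxLen) ≤ N ^ 2 * (A.M ^ 2 * A.maxLen) := by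
      have := mul_le_mul_of_nonneg_right A.hc₁M (sq_nonneg (l : ℝ))
      rw [← Tuning.maxLen] at this
      linarith
    have h5 := le_of_mul_le_mul_right h4 (by positivity)
    exact (sq_le_sq₀ (by positivity) hpos.le).1 h5

/-- In a window which contains `τ` and triggers a detection, the profile likelihood falls off
exponentially with the distance from `τ`. -/
theorem HasJump.profileLik_le (hσ : 0 < σ) (h : HasJump x e τ R m D)
    (hn : ModerateNoise e τ R (A.ζ ^ 2 * L) A.η A.β) (hL : 0 < L) (hcL : √2 * √L ≤ c)
    (hδD : A.δ ≤ |D|) (hDM : |D| ≤ A.M) {s l : ℕ} (hl : τ + l ≤ s + R) (hr : s + l ≤ τ + R)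
    (hls : l ≤ s) (h1 : s < τ + l) (h2 : τ < s + l) (hlL : (l : ℝ) ≤ A.maxLen * L)
    (hc : c ≤ |scanStat σ x l s|) {t : ℕ} (ht1 : s < t + l) (ht2 : t < s + l) (hne : t ≠ τ) :
    Real.exp (A.slope * |(t : ℝ) - τ| - A.loss) * profileLik σ x (s - l) (s + l) t ≤
      profileLik σ x (s - l) (s + l) τ := by
  obtain ⟨i1, i2⟩ := h.inside_of_trigger A hσ hn hL hcL hDM hl hr hls (by omega) h1 h2 hlL hc
  set K := A.M ^ 2 / σ ^ 2 with hK
  have hc₁ := A.hc₁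
  have hM := A.hM
  have hζ := A.hζ
  have hK0 : 0 ≤ K := by positivity
  have cu : ((s - l : ℕ) : ℝ) = s - l := by push_cast [Nat.cast_sub hls]; ring
  have cv : ((s + l : ℕ) : ℝ) = s + l := by push_cast; ring
  have au : (l : ℝ) - |(s : ℝ) - τ| ≤ (τ : ℝ) - (s - l : ℕ) := by
    rw [cu]; linarith [le_abs_self ((s : ℝ) - τ)]
  have av : (l : ℝ) - |(s : ℝ) - τ| ≤ ((s + l : ℕ) : ℝ) - τ := by
    rw [cv]; linarith [neg_abs_le ((s : ℝ) - τ)]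
  have ww : ∀ y, (l : ℝ) - |(s : ℝ) - τ| ≤ y → A.ζ ^ 2 * L ≤ A.ζ ^ 2 * K * y := fun y hy => by
    rw [mul_assoc]
    exact mul_le_mul_of_nonneg_left (i1.trans (mul_le_mul_of_nonneg_left hy hK0)) (by positivity)
  have gain := h.cusum_gain hσ hn (u := s - l) (v := s + l) (t := t) (by omega) hr (by omega) h2
    (by omega) ht2 hne (w := A.ζ ^ 2 * K) (c₁ := A.c₁) (d := A.δ ^ 2) hc₁.le
    (by rw [← sq_abs D]; exact pow_le_pow_left₀ A.hδ.le hδD 2) (by positivity) (ww _ au) (ww _ av)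
    (by rw [cu, cv] at *; linarith) (by rw [cu, cv] at *; linarith)
  have hnl := A.noise_le
  have e1 : A.ζ ^ 2 * K = A.ζ ^ 2 * A.M ^ 2 / σ ^ 2 := by rw [hK]; ring
  rw [← e1] at hnl
  have hk := abs_nonneg ((t : ℝ) - τ)
  have h5 : |(t : ℝ) - τ| * (A.c₁ * A.δ ^ 2 / 4) ≤
      |(t : ℝ) - τ| * (A.c₁ * A.δ ^ 2 / 2 - 4 * (A.ζ ^ 2 * K) - 4 * A.η) :=
    mul_le_mul_of_nonneg_left (by linarith) hk
  rw [profileLik, profileLik, if_pos (by omega), if_pos (by omega), ← Real.exp_add]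
  refine Real.exp_le_exp.2 ?_
  have h6 : (A.slope * |(t : ℝ) - τ| - A.loss) * (2 * σ ^ 2) =
      |(t : ℝ) - τ| * (A.c₁ * A.δ ^ 2 / 4) - 4 * A.β := by
    unfold Tuning.slope Tuning.loss
    field_simp
    ring
  have hσ2 : 0 < 2 * σ ^ 2 := by positivity
  refine le_of_mul_le_mul_right ?_ hσ2
  rw [add_mul, h6]
  linarith

/-- A change-point triggers a detection as soon as the half-length is large enough. -/
theorem HasJump.trigger (hσ : 0 < σ) (h : HasJump x e τ R m D)
    (hn : ModerateNoise e τ R (A.ζ ^ 2 * L) A.η A.β) (hL : 0 < L) (hcL : c ≤ 2 * √L)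
    (hδD : A.δ ≤ |D|) {l : ℕ} (hl : l ≤ R) (hlτ : l ≤ τ) (hlL : 16 * σ ^ 2 / A.δ ^ 2 * L ≤ l) :
    c ≤ |scanStat σ x l τ| := by
  have hδ := A.hδ
  have hζ := A.hζ
  have hl0' : (0 : ℝ) < l := lt_of_lt_of_le (by positivity) hlL
  have hl0 : 0 < l := by exact_mod_cast hl0'
  obtain ⟨n, hn1, hn2⟩ := h.exists_scanStat_eq hn (s := τ) (l := l) (by omega) (by omega) hlτ
    (by omega) (by omega) σ
  rw [hn2, sqrt_window hσ hl0', abs_mul, abs_of_pos (by positivity), ← div_eq_inv_mul,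
    le_div_iff₀ (by positivity), sub_self, abs_zero, sub_zero]
  have hsq : √(A.ζ ^ 2 * L * l) = A.ζ * (√L * √l) := by
    rw [mul_assoc, Real.sqrt_mul (by positivity), Real.sqrt_sq hζ.le, Real.sqrt_mul hL.le]
  rw [hsq] at hn1
  -- The signal `δ l` is at least `4 σ √(L l)`, while the threshold is at most `2 √2 σ √(L l)` and
  -- the noise at most `2 ζ √(L l) ≤ σ √(L l)`.
  have hr : 4 * σ / A.δ * √L ≤ √(l : ℝ) := by
    refine Real.le_sqrt_of_sq_le ?_
    rw [mul_pow, Real.sq_sqrt hL.le, div_pow, mul_pow]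
    norm_num
    exact hlL
  have hr' : 4 * σ * √L ≤ A.δ * √(l : ℝ) := by
    have := mul_le_mul_of_nonneg_left hr hδ.le
    field_simp at this
    linarith
  have h1 : 4 * (σ * (√L * √(l : ℝ))) ≤ A.δ * l := by
    have := mul_le_mul_of_nonneg_right hr' (Real.sqrt_nonneg (l : ℝ))
    have e : √(l : ℝ) * √(l : ℝ) = l := Real.mul_self_sqrt hl0'.le
    calc 4 * (σ * (√L * √(l : ℝ))) = 4 * σ * √L * √(l : ℝ) := by ring
      _ ≤ _ := this
      _ = _ := by rw [mul_assoc, e]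
  have hy0 : 0 < √L * √(l : ℝ) := by positivity
  have h2 := mul_le_mul_of_nonneg_right A.hζσ hy0.le
  have h3 : √2 ≤ 3 / 2 := by
    rw [Real.sqrt_le_left (by norm_num)]
    norm_num
  have h4 : c * (√2 * √(l : ℝ) * σ) ≤ 3 * (σ * (√L * √(l : ℝ))) := by
    calc c * (√2 * √(l : ℝ) * σ) ≤ 2 * √L * (√2 * √(l : ℝ) * σ) :=
          mul_le_mul_of_nonneg_right hcL (by positivity)
      _ = √2 * (2 * (σ * (√L * √(l : ℝ)))) := by ring
      _ ≤ 3 / 2 * (2 * (σ * (√L * √(l : ℝ)))) := mul_le_mul_of_nonneg_right h3 (by positivity)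
      _ = _ := by ring
  have h5 : A.δ * l - |n| ≤ |D * l + n| := by
    have := abs_sub_abs_le_abs_sub (D * l) (-n)
    rw [abs_neg, sub_neg_eq_add, abs_mul, abs_of_pos hl0'] at this
    have := mul_le_mul_of_nonneg_right hδD hl0'.le
    linarith
  linarith

/-- Conditions on the signal and on the noise under which a change-point is good. -/
theorem IsGood.of_moderateNoise {ρ : ℝ} (hρ : 1 < ρ) {T : ℕ} {a : ℕ → ℝ} {bs : ℕ}
    {cps : Finset ℕ} (hσ : 0 < σ)
    (hmem : τ ∈ cps) (hleft : 4 * halfLen ρ bs ≤ τ) (hright : τ + 4 * halfLen ρ bs ≤ T)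
    (hsep : ∀ p ∈ cps, p ≠ τ → p + 4 * halfLen ρ bs ≤ τ ∨ τ + 4 * halfLen ρ bs ≤ p)
    (h : HasJump x e τ (4 * halfLen ρ bs) m D)
    (hn : ModerateNoise e τ (4 * halfLen ρ bs) (A.ζ ^ 2 * L) A.η A.β)
    (hL : 0 < L) (hcL : √2 * √L ≤ c) (hcL' : c ≤ 2 * √L)
    (hδD : A.δ ≤ |D|) (hDM : |D| ≤ A.M) (hlo : 16 * σ ^ 2 / A.δ ^ 2 * L ≤ halfLen ρ bs)
    (hhi : (halfLen ρ bs : ℝ) ≤ A.maxLen * L)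
    (hτ : 0 ≤ a τ) (ha : ∀ t, t < τ + 4 * halfLen ρ bs → τ < t + 4 * halfLen ρ bs → t ≠ τ →
      a t < a τ * Real.exp (A.slope * |(t : ℝ) - τ| - A.loss)) :
    IsGood ρ σ T x a c bs cps τ := by
  refine ⟨hmem, hleft, hright, hsep, fun b hb s h1 h2 hc t ht1 ht2 hne => ?_,
    h.trigger A hσ hn hL hcL' hδD (by omega) (by omega) hlo⟩
  have hlen := halfLen_mono hρ hb
  have hlen' : (halfLen ρ b : ℝ) ≤ halfLen ρ bs := by exact_mod_cast hlen
  have hp := h.profileLik_le A hσ hn hL hcL hδD hDM (s := s) (l := halfLen ρ b) (by omega)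
    (by omega) (by omega) h1 h2 (hlen'.trans hhi) hc ht1 ht2 hne
  have hat := ha t (by omega) (by omega) hne
  have hpos : 0 < profileLik σ x (s - halfLen ρ b) (s + halfLen ρ b) t := by
    rw [profileLik, if_pos (by omega)]
    positivity
  calc _ < a τ * Real.exp (A.slope * |(t : ℝ) - τ| - A.loss) *
        profileLik σ x (s - halfLen ρ b) (s + halfLen ρ b) t := mul_lt_mul_of_pos_right hat hpos
    _ = a τ * (Real.exp (A.slope * |(t : ℝ) - τ| - A.loss) *
        profileLik σ x (s - halfLen ρ b) (s + halfLen ρ b) t) := by ring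
    _ ≤ _ := mul_le_mul_of_nonneg_left hp hτ

end

/-! ### From the model to signal plus noise -/

section

variable {T : ℕ} {y : ℕ → Bool} {m d x : ℕ → ℝ}

theorem mem_changePoints {t : ℕ} :
    t ∈ changePoints T y ↔ t ∈ Finset.Icc 1 (T - 1) ∧ y t = true := Finset.mem_filter

theorem mean_eq_of_no_changePoint
    (hm : ∀ t ∈ Finset.Icc 1 (T - 1), m (t + 1) = m t + (if y t = true then 1 else 0) * d t)
    {i j : ℕ} (hi : 1 ≤ i) (hij : i ≤ j) (hj : j ≤ T)
    (hno : ∀ p ∈ changePoints T y, i ≤ p → j ≤ p) : m j = m i := by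
  induction j, hij using Nat.le_induction with
  | base => rfl
  | succ j hij ih =>
    have hjm : j ∈ Finset.Icc 1 (T - 1) := Finset.mem_Icc.2 ⟨by omega, by omega⟩
    have hy : y j ≠ true := fun h => by
      have := hno j (mem_changePoints.2 ⟨hjm, h⟩) hij
      omega
    rw [hm j hjm, if_neg hy, zero_mul, add_zero]
    exact ih (by omega) fun p hp h => by
      have := hno p hp h
      omega

theorem hasJump_of_mean_succ
    (hm : ∀ t ∈ Finset.Icc 1 (T - 1), m (t + 1) = m t + (if y t = true then 1 else 0) * d t)
    {τ R : ℕ} (hτ : τ ∈ changePoints T y) (hl : R ≤ τ) (hr : τ + R ≤ T)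
    (hsep : ∀ p ∈ changePoints T y, p ≠ τ → p + R ≤ τ ∨ τ + R ≤ p) :
    HasJump x (fun t => x t - m t) τ R (m τ) (d τ) := by
  have hτ' := mem_changePoints.1 hτ
  have hτ1 := Finset.mem_Icc.1 hτ'.1
  constructor
  · intro i h1 h2
    rw [mean_eq_of_no_changePoint hm (by omega) h2 (by omega) fun p hp h => ?_]
    · ring
    · by_contra hlt
      have := hsep p hp (by omega)
      omega
  · intro i h1 h2
    have := hm τ hτ'.1
    rw [if_pos hτ'.2, one_mul] at this
    rw [← this, mean_eq_of_no_changePoint hm (i := τ + 1) (j := i) (by omega) h1 (by omega)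
      fun p hp h => ?_]
    · ring
    · by_contra hlt
      have := hsep p hp (by omega)
      omega

theorem noFalseAlarm_of_noise {ρ : ℝ} (hρ : 1 < ρ)
    (hm : ∀ t ∈ Finset.Icc 1 (T - 1), m (t + 1) = m t + (if y t = true then 1 else 0) * d t)
    {σ c : ℝ} (hnoise : ∀ b ≤ lastScale ρ T, ∀ s, halfLen ρ b ≤ s → s + halfLen ρ b ≤ T →
      |scanStat σ (fun t => x t - m t) (halfLen ρ b) s| < c) :
    NoFalseAlarm ρ σ T x c (changePoints T y) := by
  intro b hb s h1 h2 hc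
  by_contra! hno
  have hl := one_le_halfLen hρ b
  have hs : s + halfLen ρ b ≤ T := by omega
  refine (hnoise b hb s h1 hs).not_ge (hc.trans_eq (congrArg abs ?_))
  set l := halfLen ρ b
  have hmean : ∀ i, s - l < i → i ≤ s + l → m i = m (s - l + 1) := fun i hi1 hi2 =>
    mean_eq_of_no_changePoint hm (by omega) (by omega) (by omega) fun p hp h => by
      have := hno p hp (by omega)
      omega
  have key : ∀ i j, s - l ≤ i → i ≤ j → j ≤ s + l → partialSum x j - partialSum x i =
      m (s - l + 1) * ((j : ℝ) - i) +
        (partialSum (fun t => x t - m t) j - partialSum (fun t => x t - m t) i) := by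
    intro i j hi hij hj
    rw [partialSum_sub _ hij, partialSum_sub _ hij, Finset.sum_sub_distrib]
    rw [Finset.sum_congr (s₁ := Finset.Ioc i j) (f := m) rfl (g := fun _ => m (s - l + 1)) fun u hu => ?_]
    · rw [Finset.sum_const, Nat.card_Ioc, nsmul_eq_mul, Nat.cast_sub hij]
      ring
    · rw [Finset.mem_Ioc] at hu
      exact hmean u (by omega) (by omega)
  have k1 := key s (s + l) (by omega) (by omega) le_rfl
  have k2 := key (s - l) s le_rfl (by omega) (by omega)
  push_cast [Nat.cast_sub h1] at k1 k2
  rw [scanStat, scanStat]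
  congr 1
  linear_combination k1 - k2

end

/-! ### Gaussian tails -/

theorem integral_Ioi_mul_exp_neg_sq (x : ℝ) :
    IntegrableOn (fun y : ℝ => y * Real.exp (-y ^ 2 / 2)) (Set.Ioi x) ∧
    ∫ y in Set.Ioi x, y * Real.exp (-y ^ 2 / 2) = Real.exp (-x ^ 2 / 2) := by
  have hint : Integrable fun y : ℝ => y * Real.exp (-y ^ 2 / 2) := by
    refine (integrable_mul_exp_neg_mul_sq (b := 1 / 2) (by norm_num)).congr (.of_forall fun y => ?_)
    simp only
    congr 2
    ring
  refine ⟨hint.integrableOn, ?_⟩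
  have h := integral_Ioi_of_hasDerivAt_of_tendsto' (f := fun y : ℝ => -Real.exp (-y ^ 2 / 2))
    (f' := fun y => y * Real.exp (-y ^ 2 / 2)) (a := x) (m := 0) (fun y _ => ?_)
    hint.integrableOn ?_
  · rw [h]; ring
  · have h1 : HasDerivAt (fun y : ℝ => -y ^ 2 / 2) (-y) y := by
      have := ((hasDerivAt_pow 2 y).neg).div_const 2
      refine this.congr_deriv ?_
      norm_num
      ring
    exact h1.exp.neg.congr_deriv (by ring)
  · rw [← neg_zero]
    refine (Real.tendsto_exp_atBot.comp ?_).neg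
    have : Filter.Tendsto (fun y : ℝ => y ^ 2 / 2) Filter.atTop Filter.atTop :=
      (Filter.tendsto_pow_atTop two_ne_zero).atTop_div_const (by norm_num)
    refine (Filter.tendsto_neg_atTop_atBot.comp this).congr fun y => ?_
    simp only [Function.comp]
    ring

/-- The tail bound for the standard Gaussian distribution. The factor `1 / x` matters at the
threshold of the scan. -/
theorem gaussianReal_abs_tail {x : ℝ} (hx : 0 < x) :
    gaussianReal 0 1 {y | x ≤ |y|} ≤ ENNReal.ofReal (Real.exp (-x ^ 2 / 2) / x) := by
  have hright : gaussianReal 0 1 (Set.Ici x) ≤ ENNReal.ofReal (Real.exp (-x ^ 2 / 2) / x / 2) := by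
    rw [gaussianReal_apply_eq_integral 0 one_ne_zero]
    refine ENNReal.ofReal_le_ofReal ?_
    obtain ⟨h1, h2⟩ := integral_Ioi_mul_exp_neg_sq x
    have h3 : 2 ≤ √(2 * Real.pi) := by
      refine Real.le_sqrt_of_sq_le ?_
      linarith [Real.pi_gt_three]
    calc ∫ y in Set.Ici x, gaussianPDFReal 0 1 y
        = ∫ y in Set.Ioi x, gaussianPDFReal 0 1 y := integral_Ici_eq_integral_Ioi
      _ ≤ ∫ y in Set.Ioi x, (1 / (2 * x)) * (y * Real.exp (-y ^ 2 / 2)) := by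
          refine setIntegral_mono_on (integrable_gaussianPDFReal 0 1).integrableOn
            (h1.const_mul _) measurableSet_Ioi fun y hy => ?_
          have hy : x < y := hy
          rw [gaussianPDFReal]
          simp only [NNReal.coe_one, mul_one, sub_zero]
          have e0 := Real.exp_pos (-y ^ 2 / 2)
          calc (√(2 * Real.pi))⁻¹ * Real.exp (-y ^ 2 / 2) ≤ 2⁻¹ * Real.exp (-y ^ 2 / 2) :=
                mul_le_mul_of_nonneg_right (inv_anti₀ two_pos h3) e0.le
            _ ≤ 2⁻¹ * (y / x) * Real.exp (-y ^ 2 / 2) := by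
                refine mul_le_mul_of_nonneg_right ?_ e0.le
                have : 1 ≤ y / x := (one_le_div hx).2 hy.le
                linarith
            _ = _ := by field_simp
      _ = Real.exp (-x ^ 2 / 2) / x / 2 := by
          rw [integral_const_mul, h2]
          field_simp
  have hleft : gaussianReal 0 1 (Set.Iic (-x)) = gaussianReal 0 1 (Set.Ici x) := by
    conv_rhs => rw [← neg_zero, ← gaussianReal_map_neg,
      Measure.map_apply measurable_neg measurableSet_Ici]
    congr 1
    ext y
    simp
  calc gaussianReal 0 1 {y | x ≤ |y|} ≤ gaussianReal 0 1 (Set.Ici x ∪ Set.Iic (-x)) := by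
        refine measure_mono fun y hy => ?_
        rcases le_abs.1 (show x ≤ |y| from hy) with h | h
        · exact Or.inl h
        · exact Or.inr (le_neg.1 h)
    _ ≤ _ := measure_union_le _ _
    _ ≤ ENNReal.ofReal (Real.exp (-x ^ 2 / 2) / x / 2) +
        ENNReal.ofReal (Real.exp (-x ^ 2 / 2) / x / 2) := by
        rw [hleft]
        gcongr
    _ = _ := by
        rw [← ENNReal.ofReal_add (by positivity) (by positivity)]
        congr 1
        ring

section

variable {Ω : Type*} [MeasurableSpace Ω] {P : Measure Ω}

theorem map_const_mul_gaussianReal {Z : Ω → ℝ} (hZ : Measurable Z) {v : ℝ} (hv : 0 ≤ v)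
    (hlaw : P.map Z = gaussianReal 0 v.toNNReal) (c : ℝ) :
    P.map (fun ω => c * Z ω) = gaussianReal 0 (c ^ 2 * v).toNNReal := by
  have := gaussianReal_map_const_mul (μ := 0) (v := v.toNNReal) c
  rw [← hlaw, Measure.map_map (measurable_const_mul _) hZ, mul_zero] at this
  refine this.trans ?_
  congr 1
  ext
  rw [Real.coe_toNNReal _ (by positivity), NNReal.coe_mul, Real.coe_toNNReal _ hv]
  rfl

/-- A linear combination of independent centred Gaussian variables is a centred Gaussian
variable. -/
theorem map_sum_gaussianReal [IsProbabilityMeasure P] {ι : Type*} {e : ι → Ω → ℝ} (hm : ∀ i, Measurable (e i))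
    (hind : iIndepFun e P) {v : ℝ} (hv : 0 ≤ v)
    (hlaw : ∀ i, P.map (e i) = gaussianReal 0 v.toNNReal) (w : ι → ℝ) (s : Finset ι) :
    P.map (fun ω => ∑ i ∈ s, w i * e i ω) = gaussianReal 0 (∑ i ∈ s, w i ^ 2 * v).toNNReal := by
  classical
  have hmw : ∀ i, Measurable fun ω => w i * e i ω := fun i => (hm i).const_mul _
  have hind' : iIndepFun (fun i ω => w i * e i ω) P :=
    hind.comp (fun i y => w i * y) fun i => measurable_const_mul _
  induction s using Finset.induction_on with
  | empty => simp [Measure.map_const]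
  | insert i s hi ih =>
    have hlawi := map_const_mul_gaussianReal (hm i) hv (hlaw i) (w i)
    have hs : IndepFun (fun ω => w i * e i ω) (fun ω => ∑ j ∈ s, w j * e j ω) P := by
      have := (hind'.indepFun_finsetSum_of_notMem hmw hi).symm
      convert this using 1
      ext ω
      simp
    have := gaussianReal_add_gaussianReal_of_indepFun hs hlawi ih
    rw [add_zero, ← Real.toNNReal_add (by positivity) (by positivity),
      ← Finset.sum_insert (f := fun j => w j ^ 2 * v) hi] at this
    rw [← this]
    congr 1
    ext ω
    simp [Finset.sum_insert hi]

theorem measure_abs_ge_of_gaussianReal {Z : Ω → ℝ} (hZ : Measurable Z) {s : ℝ} (hs : 0 < s)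
    (hlaw : P.map Z = gaussianReal 0 (s ^ 2).toNNReal) {x : ℝ} (hx : 0 < x) :
    P {ω | s * x ≤ |Z ω|} ≤ ENNReal.ofReal (Real.exp (-x ^ 2 / 2) / x) := by
  have h1 : P.map (fun ω => s⁻¹ * Z ω) = gaussianReal 0 1 := by
    rw [map_const_mul_gaussianReal hZ (by positivity) hlaw, ← mul_pow, inv_mul_cancel₀ hs.ne',
      one_pow, Real.toNNReal_one]
  refine le_trans (le_of_eq ?_) (gaussianReal_abs_tail hx)
  rw [← h1, Measure.map_apply (hZ.const_mul _)
    (measurableSet_le measurable_const measurable_abs)]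
  congr 1
  ext ω
  simp only [Set.mem_ofPred_eq, Set.mem_preimage, abs_mul, abs_inv, abs_of_pos hs]
  rw [← div_eq_inv_mul, le_div_iff₀ hs, mul_comm]

end

/-! ### Change-points and intensities in the model -/

section

theorem sum_powerset_superset_prod {ι : Type*} [DecidableEq ι] (f : ι → ℝ) {W U : Finset ι}
    (hW : W ⊆ U) :
    ∑ S ∈ U.powerset.filter (W ⊆ ·), (∏ t ∈ S, f t) * ∏ t ∈ U \ S, (1 - f t) = ∏ t ∈ W, f t := by
  have h := Finset.prod_add f (fun t => if t ∈ W then 0 else 1 - f t) U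
  have h1 : ∏ t ∈ U, (f t + if t ∈ W then 0 else 1 - f t) = ∏ t ∈ W, f t := by
    rw [← Finset.prod_subset hW fun t _ ht => ?_]
    · exact Finset.prod_congr rfl fun t ht => by rw [if_pos ht, add_zero]
    · rw [if_neg ht]; ring
  rw [← h1, h, Finset.sum_filter]
  refine Finset.sum_congr rfl fun S _ => ?_
  split_ifs with hS
  · congr 1
    exact Finset.prod_congr rfl fun t ht => by
      rw [if_neg fun hw => (Finset.mem_sdiff.1 ht).2 (hS hw)]
  · obtain ⟨t, htW, htS⟩ := Finset.not_subset.1 hS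
    have h0 : ∏ t ∈ U \ S, (if t ∈ W then 0 else 1 - f t) = 0 :=
      Finset.prod_eq_zero (Finset.mem_sdiff.2 ⟨hW htW, htS⟩) (if_pos htW)
    rw [h0, mul_zero]

theorem measurable_comap_restrict {Ω : Type*} (a : ℕ → Ω → ℝ) {s : Finset ℕ} {t : ℕ} (ht : t ∈ s) :
    Measurable[MeasurableSpace.comap (fun ω (t : s) => a t ω) inferInstance] (a t) :=
  (measurable_pi_apply (⟨t, ht⟩ : s)).comp (comap_measurable (fun ω (t : s) => a t ω))

variable {T : ℕ} {G F : Measure ℝ} {σ : ℝ} {Ω : Type*} [MeasurableSpace Ω] {P : Measure Ω}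
  {a : ℕ → Ω → ℝ} {Y : ℕ → Ω → Bool} {Δ μ X : ℕ → Ω → ℝ}

namespace IsModel

theorem measurableSet_Y (hM : IsModel T G F σ P a Y Δ μ X) {t : ℕ}
    (ht : t ∈ Finset.Icc 1 (T - 1)) : MeasurableSet {ω | Y t ω = true} :=
  hM.measurable_Y t ht (measurableSet_singleton true)

theorem measurableSet_changePoints_eq (hM : IsModel T G F σ P a Y Δ μ X) (S : Finset ℕ) :
    MeasurableSet {ω | changePoints T (fun t => Y t ω) = S} := by
  have hg : Measurable fun (y : Finset.Icc 1 (T - 1) → Bool) =>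
      changePoints T fun t => if h : t ∈ Finset.Icc 1 (T - 1) then y ⟨t, h⟩ else false :=
    measurable_of_countable _
  have hY : Measurable fun ω (t : Finset.Icc 1 (T - 1)) => Y t ω :=
    measurable_pi_lambda _ fun t => hM.measurable_Y t t.2
  convert (hg.comp hY) (MeasurableSet.of_discrete (s := {S})) using 1
  ext ω
  simp only [Set.mem_ofPred_eq, Set.mem_preimage, Function.comp, Set.mem_singleton_iff]
  refine iff_of_eq (congrArg (· = S) (Finset.filter_congr fun t ht => ?_))
  simp only [dif_pos ht]

theorem comap_le (hM : IsModel T G F σ P a Y Δ μ X) :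
    MeasurableSpace.comap (fun ω (t : Finset.Icc 1 (T - 1)) => a t ω) inferInstance ≤
      (inferInstance : MeasurableSpace Ω) :=
  Measurable.comap_le (measurable_pi_lambda _ fun t => hM.measurable_a t t.2)

/-- Given the intensities, the probability that all of `W` are change-points is the product of the
intensities in `W`. -/
theorem measureReal_inter [IsProbabilityMeasure P] (hM : IsModel T G F σ P a Y Δ μ X) {A : Set Ω}
    (hA : MeasurableSet[MeasurableSpace.comap (fun ω (t : Finset.Icc 1 (T - 1)) => a t ω)
      inferInstance] A) {W : Finset ℕ} (hW : W ⊆ Finset.Icc 1 (T - 1)) :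
    P.real (A ∩ {ω | ∀ t ∈ W, Y t ω = true}) = ∫ ω in A, ∏ t ∈ W, a t ω ∂P := by
  have hA' := hM.comap_le _ hA
  have hset : A ∩ {ω | ∀ t ∈ W, Y t ω = true} = ⋃ S ∈ (Finset.Icc 1 (T - 1)).powerset.filter
      (W ⊆ ·), A ∩ {ω | changePoints T (fun t => Y t ω) = S} := by
    ext ω
    simp only [Set.mem_inter_iff, Set.mem_ofPred_eq, Set.mem_iUnion, Finset.mem_filter,
      Finset.mem_powerset, exists_prop]
    constructor
    · rintro ⟨h1, h2⟩
      exact ⟨_, ⟨Finset.filter_subset _ _, fun t ht => mem_changePoints.2 ⟨hW ht, h2 t ht⟩⟩, h1, rfl⟩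
    · rintro ⟨S, ⟨_, h2⟩, h1, rfl⟩
      exact ⟨h1, fun t ht => (mem_changePoints.1 (h2 ht)).2⟩
  have hS : ∀ S ⊆ Finset.Icc 1 (T - 1),
      P.real (A ∩ {ω | changePoints T (fun t => Y t ω) = S}) =
        ∫ ω in A, (∏ t ∈ S, a t ω) * ∏ t ∈ Finset.Icc 1 (T - 1) \ S, (1 - a t ω) ∂P := by
    intro S hS
    rw [← setIntegral_congr_ae hA' ((hM.law_Y S hS).mono fun ω h _ => h),
      setIntegral_condExp hM.comap_le _ hA, integral_indicator_const, smul_eq_mul, mul_one,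
      measureReal_restrict_apply (hM.measurableSet_changePoints_eq S), Set.inter_comm]
    · exact hM.measurableSet_changePoints_eq S
    · exact (integrable_const _).indicator (hM.measurableSet_changePoints_eq S)
  rw [hset, measureReal_biUnion_finset]
  · rw [Finset.sum_congr rfl fun S h => hS S (Finset.mem_powerset.1 (Finset.mem_filter.1 h).1),
      ← integral_finsetSum]
    · exact integral_congr_ae (.of_forall fun ω => sum_powerset_superset_prod (fun t => a t ω) hW)
    · intro S h
      exact (integrable_condExp.congr (hM.law_Y S
        (Finset.mem_powerset.1 (Finset.mem_filter.1 h).1))).integrableOn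
  · intro S _ S' _ hne
    refine Set.disjoint_left.2 fun ω h1 h2 => hne ?_
    exact h1.2.symm.trans h2.2
  · exact fun S _ => hA'.inter (hM.measurableSet_changePoints_eq S)

theorem ae_mem_Icc (hM : IsModel T G F σ P a Y Δ μ X) (hG : G (Set.Icc 0 1)ᶜ = 0) {t : ℕ}
    (ht : t ∈ Finset.Icc 1 (T - 1)) : ∀ᵐ ω ∂P, a t ω ∈ Set.Icc (0 : ℝ) 1 := by
  rw [← hM.law_a t ht] at hG
  exact ae_of_ae_map (hM.measurable_a t ht).aemeasurable hG

theorem integrable_a [IsProbabilityMeasure P] (hM : IsModel T G F σ P a Y Δ μ X)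
    (hG : G (Set.Icc 0 1)ᶜ = 0) {t : ℕ} (ht : t ∈ Finset.Icc 1 (T - 1)) : Integrable (a t) P :=
  Integrable.of_mem_Icc 0 1 (hM.measurable_a t ht).aemeasurable (hM.ae_mem_Icc hG ht)

theorem integral_a (hM : IsModel T G F σ P a Y Δ μ X) {t : ℕ} (ht : t ∈ Finset.Icc 1 (T - 1)) :
    ∫ ω, a t ω ∂P = ∫ x, x ∂G := by
  rw [← hM.law_a t ht, integral_map (hM.measurable_a t ht).aemeasurable
    (f := fun x => x) aestronglyMeasurable_id]

theorem indepFun_a (hM : IsModel T G F σ P a Y Δ μ X) {s t : ℕ} (hs : s ∈ Finset.Icc 1 (T - 1))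
    (ht : t ∈ Finset.Icc 1 (T - 1)) (hne : s ≠ t) : IndepFun (a s) (a t) P :=
  hM.indep_a.indepFun (i := ⟨s, hs⟩) (j := ⟨t, ht⟩) fun h => hne (congrArg Subtype.val h)

variable [IsProbabilityMeasure P]

theorem measureReal_Y (hM : IsModel T G F σ P a Y Δ μ X) {t : ℕ} (ht : t ∈ Finset.Icc 1 (T - 1)) :
    P.real {ω | Y t ω = true} = ∫ x, x ∂G := by
  have := hM.measureReal_inter (A := Set.univ) MeasurableSet.univ (W := {t}) (by simpa using ht)
  simpa [hM.integral_a ht] using this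

theorem measureReal_Y_inter_Y (hM : IsModel T G F σ P a Y Δ μ X) {s t : ℕ}
    (hs : s ∈ Finset.Icc 1 (T - 1)) (ht : t ∈ Finset.Icc 1 (T - 1)) (hne : s ≠ t) :
    P.real ({ω | Y s ω = true} ∩ {ω | Y t ω = true}) = (∫ x, x ∂G) ^ 2 := by
  have := hM.measureReal_inter (A := Set.univ) MeasurableSet.univ (W := {s, t})
    (by intro x hx; rcases Finset.mem_insert.1 hx with rfl | hx
        · exact hs
        · rwa [Finset.mem_singleton.1 hx])
  rw [Set.univ_inter, setIntegral_univ] at this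
  simp only [Finset.prod_pair hne, Finset.forall_mem_insert, Finset.mem_singleton, forall_eq]
    at this
  rw [(hM.indepFun_a hs ht hne).integral_fun_mul_eq_mul_integral
    (hM.measurable_a s hs).aestronglyMeasurable (hM.measurable_a t ht).aestronglyMeasurable,
    hM.integral_a hs, hM.integral_a ht, ← sq] at this
  exact this

/-- The mean of the minimum of two independent intensities. -/
theorem integral_min (hM : IsModel T G F σ P a Y Δ μ X) [IsProbabilityMeasure G]
    (hG : G (Set.Icc 0 1)ᶜ = 0) {s t : ℕ}
    (hs : s ∈ Finset.Icc 1 (T - 1)) (ht : t ∈ Finset.Icc 1 (T - 1)) (hne : s ≠ t) :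
    ∫ ω, min (a s ω) (a t ω) ∂P = ∫ x in Set.Ioi (0 : ℝ), (1 - cdf G x) ^ 2 := by
  rw [Integrable.integral_eq_integral_meas_lt]
  · refine integral_congr_ae (.of_forall fun x => ?_)
    have hset : {ω | x < min (a s ω) (a t ω)} = a s ⁻¹' Set.Ioi x ∩ a t ⁻¹' Set.Ioi x := by
      ext ω
      simp
    have hone : ∀ r ∈ Finset.Icc 1 (T - 1), P (a r ⁻¹' Set.Ioi x) = G (Set.Ioi x) := fun r hr => by
      rw [← hM.law_a r hr, Measure.map_apply (hM.measurable_a r hr) measurableSet_Ioi]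
    simp only
    rw [hset, measureReal_def, (hM.indepFun_a hs ht hne).measure_inter_preimage_eq_mul _ _
      measurableSet_Ioi measurableSet_Ioi, hone s hs, hone t ht, ENNReal.toReal_mul, ← sq,
      cdf_eq_real, ← probReal_compl_eq_one_sub measurableSet_Iic, Set.compl_Iic, measureReal_def]
  · exact (hM.integrable_a hG hs).inf (hM.integrable_a hG ht)
  · filter_upwards [hM.ae_mem_Icc hG hs, hM.ae_mem_Icc hG ht] with ω h1 h2
    exact le_min h1.1 h2.1

/-- The probability that `t` is a change-point while the intensity at `s` is not much smaller than
the intensity at `t`. -/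
theorem measureReal_Y_inter_a_le (hM : IsModel T G F σ P a Y Δ μ X) [IsProbabilityMeasure G]
    (hG : G (Set.Icc 0 1)ᶜ = 0) {s t : ℕ}
    (hs : s ∈ Finset.Icc 1 (T - 1)) (ht : t ∈ Finset.Icc 1 (T - 1)) (hne : s ≠ t) {κ κ' : ℝ}
    (hκ : 0 < κ) (hκ' : 0 < κ') (h1 : κ' ≤ 1) (hle : κ' ≤ κ) :
    P.real ({ω | Y t ω = true} ∩ {ω | a t ω * κ ≤ a s ω}) ≤
      min (κ⁻¹ * ∫ x, x ∂G) (κ'⁻¹ * ∫ x in Set.Ioi (0 : ℝ), (1 - cdf G x) ^ 2) := by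
  have hmeas := measurableSet_le ((measurable_comap_restrict a ht).mul_const κ)
    (measurable_comap_restrict a hs)
  have h := hM.measureReal_inter hmeas (W := {t}) (by simpa using ht)
  have hmeas' := hM.comap_le _ hmeas
  simp only [Finset.mem_singleton, forall_eq, Finset.prod_singleton] at h
  rw [Set.inter_comm, h, le_min_iff]
  have key : ∀ f : Ω → ℝ, Integrable f P → 0 ≤ᵐ[P] f →
      (∀ᵐ ω ∂P, a t ω * κ ≤ a s ω → a t ω ≤ f ω) →
      ∫ ω in {ω | a t ω * κ ≤ a s ω}, a t ω ∂P ≤ ∫ ω, f ω ∂P := fun f hf h0 hle =>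
    (setIntegral_mono_on_ae (hM.integrable_a hG ht).integrableOn hf.integrableOn hmeas' hle).trans
      (setIntegral_le_integral hf h0)
  constructor
  · rw [← hM.integral_a hs, ← integral_const_mul]
    refine key _ ((hM.integrable_a hG hs).const_mul _) ?_ (.of_forall fun ω hω => ?_)
    · filter_upwards [hM.ae_mem_Icc hG hs] with ω hω
      exact mul_nonneg (by positivity) hω.1
    · rw [inv_mul_eq_div, le_div_iff₀ hκ]
      exact hω
  · rw [← hM.integral_min hG hs ht hne, ← integral_const_mul]
    refine key _ (((hM.integrable_a hG hs).inf (hM.integrable_a hG ht)).const_mul _) ?_ ?_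
    · filter_upwards [hM.ae_mem_Icc hG hs, hM.ae_mem_Icc hG ht] with ω h1 h2
      exact mul_nonneg (by positivity) (le_min h1.1 h2.1)
    · filter_upwards [hM.ae_mem_Icc hG ht] with ω h3 hω
      rw [inv_mul_eq_div, le_div_iff₀ hκ']
      refine le_min ((mul_le_mul_of_nonneg_left hle h3.1).trans hω) ?_
      exact mul_le_of_le_one_right h3.1 h1

theorem measureReal_Y_inter_Δ (hM : IsModel T G F σ P a Y Δ μ X) {t : ℕ}
    (ht : t ∈ Finset.Icc 1 (T - 1)) {B : Set ℝ} (hB : MeasurableSet B) :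
    P.real ({ω | Y t ω = true} ∩ Δ t ⁻¹' B) = (∫ x, x ∂G) * F.real B := by
  rw [measureReal_def, ← cond_mul_eq_inter (hM.measurableSet_Y ht), ENNReal.toReal_mul, mul_comm,
    ← measureReal_def, hM.measureReal_Y ht, ← hM.law_Δ t ht,
    map_measureReal_apply (hM.measurable_Δ t ht) hB, measureReal_def]

end IsModel

end

/-! ### The noise in the model -/

section

theorem partialSum_sub_eq_sum (e : ℕ → ℝ) {i j T : ℕ} (hij : i ≤ j) (hj : j ≤ T) :
    partialSum e j - partialSum e i =
      ∑ t ∈ Finset.Icc 1 T, (if i < t ∧ t ≤ j then 1 else 0) * e t := by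
  rw [partialSum_sub e hij]
  simp only [ite_mul, one_mul, zero_mul]
  rw [← Finset.sum_filter]
  refine Finset.sum_congr ?_ fun _ _ => rfl
  ext t
  simp only [Finset.mem_Ioc, Finset.mem_filter, Finset.mem_Icc]
  omega

theorem sum_indicator_Ioc {i j T : ℕ} (hij : i ≤ j) (hj : j ≤ T) :
    ∑ t ∈ Finset.Icc 1 T, (if i < t ∧ t ≤ j then (1 : ℝ) else 0) = (j : ℝ) - i := by
  have h := partialSum_sub_eq_sum (fun _ => 1) hij hj
  simp only [mul_one] at h
  rw [← h]
  simp [partialSum]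

variable {T : ℕ} {G F : Measure ℝ} {σ : ℝ} {Ω : Type*} [MeasurableSpace Ω] {P : Measure Ω}
  [IsProbabilityMeasure P] {a : ℕ → Ω → ℝ} {Y : ℕ → Ω → Bool} {Δ μ X : ℕ → Ω → ℝ}

namespace IsModel

/-- Gaussian tail of a linear combination of the errors, on the event that `t` is a change-point,
which is independent of the errors. -/
theorem measureReal_Y_inter_noise (hM : IsModel T G F σ P a Y Δ μ X) (hσ : 0 < σ) {t : ℕ}
    (ht : t ∈ Finset.Icc 1 (T - 1)) {w : ℕ → ℝ} {v : ℝ} (hv : 0 < v)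
    (hw : ∑ i ∈ Finset.Icc 1 T, w i ^ 2 = v) {x : ℝ} (hx : 0 < x) :
    P.real ({ω | Y t ω = true} ∩
        {ω | √v * σ * x ≤ |∑ i ∈ Finset.Icc 1 T, w i * (X i ω - μ i ω)|}) ≤
      (∫ y, y ∂G) * (Real.exp (-x ^ 2 / 2) / x) := by
  set Z : Ω → ℝ := fun ω => ∑ i ∈ Finset.Icc 1 T, w i * (X i ω - μ i ω)
  have hm : ∀ i : Finset.Icc 1 T, Measurable fun ω => X i ω - μ i ω := fun i =>
    (hM.measurable_X i i.2).sub (hM.measurable_μ i i.2)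
  have hZ' : Z = fun ω => ∑ i : Finset.Icc 1 T, w i * (X i ω - μ i ω) := by
    ext ω
    exact (Finset.sum_coe_sort (Finset.Icc 1 T) fun i => w i * (X i ω - μ i ω)).symm
  have hZ : Measurable Z := by
    rw [hZ']
    exact Finset.measurable_sum _ fun i _ => (hm i).const_mul _
  have hlaw : P.map Z = gaussianReal 0 ((√v * σ) ^ 2).toNNReal := by
    have := map_sum_gaussianReal hm hM.indep_error (sq_nonneg σ) (fun i => hM.law_error i i.2)
      (fun i => w i) Finset.univ
    rw [hZ', this, ← Finset.sum_mul, Finset.sum_coe_sort (Finset.Icc 1 T) fun i => w i ^ 2, hw,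
      mul_pow, Real.sq_sqrt hv.le]
  have htail := measure_abs_ge_of_gaussianReal hZ (by positivity) hlaw hx
  have hind : IndepFun Z (Y t) P := by
    have hψ : Measurable fun z : (Finset.Icc 1 (T - 1) → ℝ) × (Finset.Icc 1 (T - 1) → Bool) ×
        (Finset.Icc 1 T → ℝ) => z.2.1 ⟨t, ht⟩ := by fun_prop
    have := hM.indep_error_signal.comp
      (φ := fun e : Finset.Icc 1 T → ℝ => ∑ i : Finset.Icc 1 T, w i * e i)
      (Finset.measurable_sum _ fun i _ => (measurable_pi_apply i).const_mul _) hψ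
    rw [hZ']
    exact this
  have hinter := hind.measure_inter_preimage_eq_mul {z | √v * σ * x ≤ |z|} {true}
    (measurableSet_le measurable_const measurable_abs) (measurableSet_singleton _)
  have hinter' : P.real ({ω | √v * σ * x ≤ |Z ω|} ∩ {ω | Y t ω = true}) =
      P.real {ω | √v * σ * x ≤ |Z ω|} * P.real {ω | Y t ω = true} := by
    simp only [measureReal_def]
    rw [← ENNReal.toReal_mul]
    exact congrArg _ hinter
  rw [Set.inter_comm, ← hM.measureReal_Y ht]
  refine hinter'.trans_le ?_
  rw [mul_comm]
  exact mul_le_mul_of_nonneg_left (ENNReal.toReal_le_of_le_ofReal (by positivity) htail)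
    measureReal_nonneg

theorem measureReal_Y_inter_increment (hM : IsModel T G F σ P a Y Δ μ X) (hσ : 0 < σ) {t : ℕ}
    (ht : t ∈ Finset.Icc 1 (T - 1)) {i j : ℕ} (hij : i < j) (hj : j ≤ T) {x : ℝ} (hx : 0 < x) :
    P.real ({ω | Y t ω = true} ∩ {ω | √((j : ℝ) - i) * σ * x ≤
        |partialSum (fun u => X u ω - μ u ω) j - partialSum (fun u => X u ω - μ u ω) i|}) ≤
      (∫ y, y ∂G) * (Real.exp (-x ^ 2 / 2) / x) := by
  have hpos : (0 : ℝ) < j - i := sub_pos.2 (by exact_mod_cast hij)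
  simp only [partialSum_sub_eq_sum _ hij.le hj]
  refine hM.measureReal_Y_inter_noise hσ ht hpos ?_ hx
  rw [← sum_indicator_Ioc hij.le hj]
  exact Finset.sum_congr rfl fun u _ => by split_ifs <;> norm_num

theorem measureReal_Y_inter_scan (hM : IsModel T G F σ P a Y Δ μ X) (hσ : 0 < σ) {t : ℕ}
    (ht : t ∈ Finset.Icc 1 (T - 1)) {s l : ℕ} (hl : 0 < l) (hls : l ≤ s) (hs : s + l ≤ T) {c : ℝ}
    (hc : 0 < c) :
    P.real ({ω | Y t ω = true} ∩ {ω | c ≤ |scanStat σ (fun u => X u ω - μ u ω) l s|}) ≤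
      (∫ y, y ∂G) * (Real.exp (-c ^ 2 / 2) / c) := by
  have hl' : (0 : ℝ) < l := by exact_mod_cast hl
  have hset : ∀ ω, c ≤ |scanStat σ (fun u => X u ω - μ u ω) l s| ↔ √(2 * l) * σ * c ≤
      |∑ i ∈ Finset.Icc 1 T, ((if s < i ∧ i ≤ s + l then 1 else 0) -
        (if s - l < i ∧ i ≤ s then 1 else 0)) * (X i ω - μ i ω)| := by
    intro ω
    simp only [sub_mul, Finset.sum_sub_distrib]
    rw [← partialSum_sub_eq_sum _ (by omega) hs, ← partialSum_sub_eq_sum _ (by omega) (by omega),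
      scanStat, sqrt_window hσ hl', abs_mul, abs_of_pos (by positivity), ← div_eq_inv_mul,
      le_div_iff₀ (by positivity), Real.sqrt_mul zero_le_two]
    refine iff_of_eq ?_
    congr 1
    · ring
    · congr 1
      ring
  simp only [hset]
  refine hM.measureReal_Y_inter_noise hσ ht (by positivity) ?_ hc
  have h1 := sum_indicator_Ioc (i := s) (j := s + l) (by omega) hs
  have h2 := sum_indicator_Ioc (i := s - l) (j := s) (T := T) (by omega) (by omega)
  push_cast [Nat.cast_sub hls] at h1 h2
  have : (2 : ℝ) * l = ((s : ℝ) + l - s) + (s - (s - l)) := by ring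
  rw [this, ← h1, ← h2, ← Finset.sum_add_distrib]
  refine Finset.sum_congr rfl fun u _ => ?_
  split_ifs
  · omega
  all_goals norm_num

end IsModel

end

/-! ### The events that make a change-point bad -/

section

variable {T : ℕ} {σ : ℝ} {Ω : Type*} {a : ℕ → Ω → ℝ} {Y : ℕ → Ω → Bool} {Δ μ X : ℕ → Ω → ℝ}

/-- `t` is a change-point whose jump is too small or too large. -/
def badJump (A : Tuning σ) (Y : ℕ → Ω → Bool) (Δ : ℕ → Ω → ℝ) (t : ℕ) : Set Ω :=
  {ω | Y t ω = true} ∩ Δ t ⁻¹' {x | A.δ ≤ |x| ∧ |x| ≤ A.M}ᶜ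

/-- `t` and `s` are change-points. -/
def badNeighbour (Y : ℕ → Ω → Bool) (t s : ℕ) : Set Ω :=
  {ω | Y t ω = true} ∩ {ω | Y s ω = true}

/-- `t` is a change-point and the intensity at `s`, which lies at distance `k`, is too large. -/
def badIntensity (A : Tuning σ) (a : ℕ → Ω → ℝ) (Y : ℕ → Ω → Bool) (t k s : ℕ) : Set Ω :=
  {ω | Y t ω = true} ∩ {ω | a t ω * Real.exp (A.slope * k - A.loss) ≤ a s ω}

/-- `t` is a change-point and the increment of the noise between `i` and `j` is at least `σ * x`
times the square root of the distance. -/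
def badIncrement (σ x : ℝ) (Y : ℕ → Ω → Bool) (μ X : ℕ → Ω → ℝ) (t i j : ℕ) : Set Ω :=
  {ω | Y t ω = true} ∩ {ω | √((j : ℝ) - i) * σ * x ≤
    |partialSum (fun u => X u ω - μ u ω) j - partialSum (fun u => X u ω - μ u ω) i|}

/-- `t` is a change-point and the noise triggers a detection at `s`. -/
def badScan (σ c : ℝ) (Y : ℕ → Ω → Bool) (μ X : ℕ → Ω → ℝ) (t l s : ℕ) : Set Ω :=
  {ω | Y t ω = true} ∩ {ω | c ≤ |scanStat σ (fun u => X u ω - μ u ω) l s|}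

/-- `t` is a change-point at distance at least `R` from the end-points, but something goes wrong
with the jump, the intensities or the noise. -/
def badInterior (A : Tuning σ) (ρ : ℝ) (T R : ℕ) (L c : ℝ) (a : ℕ → Ω → ℝ) (Y : ℕ → Ω → Bool)
    (Δ μ X : ℕ → Ω → ℝ) (t : ℕ) : Set Ω :=
  badJump A Y Δ t ∪ ({ω | Y t ω = true} ∩ {ω | a t ω < 0}) ∪
  (⋃ k ∈ Finset.Icc 1 (R - 1), badNeighbour Y t (t + k) ∪ badNeighbour Y t (t - k)) ∪
  (⋃ k ∈ Finset.Icc 1 (R - 1), badIntensity A a Y t k (t + k) ∪ badIntensity A a Y t k (t - k)) ∪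
  (⋃ k ∈ Finset.Icc 1 R, badIncrement σ (√(A.β + A.η * k) / σ) Y μ X t t (t + k) ∪
    badIncrement σ (√(A.β + A.η * k) / σ) Y μ X t (t - k) t) ∪
  (⋃ z ∈ ((Finset.Icc (t - R) (t + R)) ×ˢ (Finset.Icc (t - R) (t + R))).filter
    (fun z => z.1 < z.2), badIncrement σ (A.ζ * √L / σ) Y μ X t z.1 z.2) ∪
  (⋃ z ∈ (Finset.range (lastScale ρ T + 1)).sigma
    (fun b => Finset.Icc (halfLen ρ b) (T - halfLen ρ b)), badScan σ c Y μ X t (halfLen ρ z.1) z.2)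

open Classical in
/-- `t` is a change-point close to an end-point, or something goes wrong with it. -/
def badEvent (A : Tuning σ) (ρ : ℝ) (T R : ℕ) (L c : ℝ) (a : ℕ → Ω → ℝ) (Y : ℕ → Ω → Bool)
    (Δ μ X : ℕ → Ω → ℝ) (t : ℕ) : Set Ω :=
  if R ≤ t ∧ t + R ≤ T then badInterior A ρ T R L c a Y Δ μ X t else {ω | Y t ω = true}

theorem sq_le_of_abs_lt {d k σ y : ℝ} (hσ : 0 < σ) (hk : 0 ≤ k) (hy : 0 ≤ y)
    (h : |d| < √k * σ * (√y / σ)) : d ^ 2 ≤ k * y := by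
  have e : √k * σ * (√y / σ) = √(k * y) := by
    rw [Real.sqrt_mul hk]
    field_simp
  rw [e] at h
  rw [← sq_abs, ← Real.sq_sqrt (mul_nonneg hk hy)]
  exact pow_le_pow_left₀ (abs_nonneg _) h.le 2

theorem lt_of_notMem_badIncrement {x : ℝ} {t i j : ℕ} {ω : Ω} (hY : Y t ω = true)
    (h : ω ∉ badIncrement σ x Y μ X t i j) :
    |partialSum (fun u => X u ω - μ u ω) j - partialSum (fun u => X u ω - μ u ω) i| <
      √((j : ℝ) - i) * σ * x :=
  not_le.1 fun hle => h ⟨hY, hle⟩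

theorem lt_of_notMem_badIntensity {A : Tuning σ} {t k s : ℕ} {ω : Ω} (hY : Y t ω = true)
    (h : ω ∉ badIntensity A a Y t k s) :
    a s ω < a t ω * Real.exp (A.slope * k - A.loss) :=
  not_le.1 fun hle => h ⟨hY, hle⟩

theorem badEvent_of_scan {A : Tuning σ} {ρ : ℝ} {R : ℕ} {L c : ℝ} {t : ℕ} {ω : Ω}
    (hY : Y t ω = true) (hρ : 1 < ρ) (hgood : ω ∉ badEvent A ρ T R L c a Y Δ μ X t)
    (b : ℕ) (hb : b ≤ lastScale ρ T) (s : ℕ) (hs : halfLen ρ b ≤ s) (hs' : s + halfLen ρ b ≤ T) :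
    |scanStat σ (fun u => X u ω - μ u ω) (halfLen ρ b) s| < c := by
  by_contra! hc
  rw [badEvent] at hgood
  split_ifs at hgood with h
  · simp only [badInterior, Set.mem_union, not_or] at hgood
    refine hgood.2 ?_
    simp only [Set.mem_iUnion]
    refine ⟨⟨b, s⟩, ?_, hY, hc⟩
    have := one_le_halfLen hρ b
    simp only [Finset.mem_sigma, Finset.mem_range, Finset.mem_Icc]
    omega
  · exact hgood hY

theorem badEvent_subset {A : Tuning σ} {ρ : ℝ} {R : ℕ} {L c : ℝ} {t : ℕ} :
    badEvent A ρ T R L c a Y Δ μ X t ⊆ {ω | Y t ω = true} := by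
  rw [badEvent]
  split_ifs
  · have h2 : ∀ s s' : Set Ω, {ω | Y t ω = true} ∩ s ∪ {ω | Y t ω = true} ∩ s' ⊆
        {ω | Y t ω = true} :=
      fun s s' => Set.union_subset Set.inter_subset_left Set.inter_subset_left
    refine Set.union_subset (Set.union_subset (Set.union_subset (Set.union_subset
      (Set.union_subset (h2 _ _) ?_) ?_) ?_) ?_) ?_
    · exact Set.iUnion₂_subset fun k _ => h2 _ _
    · exact Set.iUnion₂_subset fun k _ => h2 _ _
    · exact Set.iUnion₂_subset fun k _ => h2 _ _
    · exact Set.iUnion₂_subset fun z _ => Set.inter_subset_left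
    · exact Set.iUnion₂_subset fun z _ => Set.inter_subset_left
  · exact subset_rfl

variable {G F : Measure ℝ} [MeasurableSpace Ω] {P : Measure Ω}

theorem isGood_of_notMem_badEvent (hM : IsModel T G F σ P a Y Δ μ X) (hσ : 0 < σ) {ρ : ℝ}
    (hρ : 1 < ρ) (A : Tuning σ) {bs : ℕ} {L c : ℝ} (hL : 0 < L) (hcL : √2 * √L ≤ c)
    (hcL' : c ≤ 2 * √L) (hlo : 16 * σ ^ 2 / A.δ ^ 2 * L ≤ halfLen ρ bs)
    (hhi : (halfLen ρ bs : ℝ) ≤ A.maxLen * L) {t : ℕ} {ω : Ω}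
    (ht : t ∈ changePoints T fun t => Y t ω)
    (hgood : ω ∉ badEvent A ρ T (4 * halfLen ρ bs) L c a Y Δ μ X t) :
    IsGood ρ σ T (fun t => X t ω) (fun t => a t ω) c bs (changePoints T fun t => Y t ω) t := by
  have hY : Y t ω = true := (mem_changePoints.1 ht).2
  set R := 4 * halfLen ρ bs with hR
  rw [badEvent] at hgood
  split_ifs at hgood with hint
  swap
  · exact absurd hY hgood
  obtain ⟨hleft, hright⟩ := hint
  simp only [badInterior, Set.mem_union, not_or, Set.mem_iUnion, not_exists] at hgood
  obtain ⟨⟨⟨⟨⟨⟨hΔ, ha0⟩, hN⟩, hI⟩, hE⟩, hE2⟩, -⟩ := hgood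
  have hβ : 0 < A.β := lt_of_lt_of_le (by positivity) A.hβ
  have hη := A.hη
  have hζ := A.hζ
  have hJ : A.δ ≤ |Δ t ω| ∧ |Δ t ω| ≤ A.M := by
    by_contra h
    exact hΔ ⟨hY, h⟩
  have hsep : ∀ p ∈ changePoints T (fun t => Y t ω), p ≠ t → p + R ≤ t ∨ t + R ≤ p := by
    intro p hp hne
    have hYp : Y p ω = true := (mem_changePoints.1 hp).2
    by_contra! h
    rcases lt_or_gt_of_ne hne with hlt | hlt
    · refine (hN (t - p) (Finset.mem_Icc.2 (by omega))).2 ⟨hY, ?_⟩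
      rwa [Nat.sub_sub_self hlt.le]
    · refine (hN (p - t) (Finset.mem_Icc.2 (by omega))).1 ⟨hY, ?_⟩
      rwa [Nat.add_sub_cancel' (show t ≤ p from hlt.le)]
  have hjump := hasJump_of_mean_succ (m := fun t => μ t ω) (d := fun t => Δ t ω)
    (x := fun t => X t ω) (fun s hs => hM.mean_succ s hs ω) ht hleft hright hsep
  refine IsGood.of_moderateNoise A hρ hσ ht hleft hright hsep hjump ⟨?_, ?_⟩ hL hcL hcL' hJ.1 hJ.2
    hlo hhi (not_lt.1 fun h => ha0 ⟨hY, h⟩) ?_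
  · intro j h1 h2
    rcases lt_trichotomy j t with hlt | rfl | hlt
    · have h := (hE (t - j) (Finset.mem_Icc.2 (by omega))).2
      rw [Nat.sub_sub_self hlt.le] at h
      have h' := lt_of_notMem_badIncrement hY h
      have habs : |(j : ℝ) - t| = t - j := by
        rw [abs_sub_comm, abs_of_nonneg (sub_nonneg.2 (by exact_mod_cast hlt.le))]
      have hpos : (0 : ℝ) ≤ t - j := sub_nonneg.2 (by exact_mod_cast hlt.le)
      rw [Nat.cast_sub hlt.le] at h'
      rw [habs, ← neg_sq, neg_sub]
      exact sq_le_of_abs_lt hσ hpos (by positivity) h'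
    · simp
    · have h := (hE (j - t) (Finset.mem_Icc.2 (by omega))).1
      rw [Nat.add_sub_cancel' (show t ≤ j from hlt.le)] at h
      have h' := lt_of_notMem_badIncrement hY h
      have hpos : (0 : ℝ) ≤ j - t := sub_nonneg.2 (by exact_mod_cast hlt.le)
      rw [Nat.cast_sub hlt.le] at h'
      rw [abs_of_nonneg hpos]
      exact sq_le_of_abs_lt hσ hpos (by positivity) h'
  · intro i j h1 h2 h3
    rcases h2.eq_or_lt with rfl | hlt
    · simp
    have h := hE2 (i, j) (Finset.mem_filter.2 ⟨Finset.mem_product.2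
      ⟨Finset.mem_Icc.2 (by simp only; omega), Finset.mem_Icc.2 (by simp only; omega)⟩, hlt⟩)
    have h' := lt_of_notMem_badIncrement hY h
    have hpos : (0 : ℝ) ≤ j - i := sub_nonneg.2 (by exact_mod_cast hlt.le)
    rw [mul_comm]
    refine sq_le_of_abs_lt hσ hpos (by positivity) ?_
    rwa [Real.sqrt_mul (by positivity), Real.sqrt_sq hζ.le]
  · intro p h1 h2 hne
    rcases lt_or_gt_of_ne hne with hlt | hlt
    · have h := (hI (t - p) (Finset.mem_Icc.2 (by omega))).2
      rw [Nat.sub_sub_self hlt.le] at h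
      have h' := lt_of_notMem_badIntensity hY h
      rw [Nat.cast_sub hlt.le] at h'
      rwa [abs_sub_comm, abs_of_nonneg (sub_nonneg.2 (by exact_mod_cast hlt.le))]
    · have h := (hI (p - t) (Finset.mem_Icc.2 (by omega))).1
      rw [Nat.add_sub_cancel' (show t ≤ p from hlt.le)] at h
      have h' := lt_of_notMem_badIntensity hY h
      rw [Nat.cast_sub hlt.le] at h'
      rwa [abs_of_nonneg (sub_nonneg.2 (by exact_mod_cast hlt.le))]

open Classical in
/-- The number of the change-points which are not estimated exactly is at most three times the
number of bad events. -/
theorem card_changePoints_le (hM : IsModel T G F σ P a Y Δ μ X) (hσ : 0 < σ) {ρ : ℝ}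
    (hρ : 1 < ρ) (A : Tuning σ) {bs : ℕ} {L c : ℝ} (hL : 0 < L) (hcL : √2 * √L ≤ c)
    (hcL' : c ≤ 2 * √L) (hlo : 16 * σ ^ 2 / A.δ ^ 2 * L ≤ halfLen ρ bs)
    (hhi : (halfLen ρ bs : ℝ) ≤ A.maxLen * L) (hbs : bs ≤ lastScale ρ T)
    {pick : Finset ℕ → ℕ} (hpick : ∀ s : Finset ℕ, s.Nonempty → pick s ∈ s) (ω : Ω) :
    (changePoints T fun t => Y t ω).card ≤
      (exactPoints T (changePoints T fun t => Y t ω)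
        (extendedScan pick ρ σ T c (fun t => X t ω) (fun t => a t ω))).card +
      3 * ((Finset.Icc 1 (T - 1)).filter fun t =>
        ω ∈ badEvent A ρ T (4 * halfLen ρ bs) L c a Y Δ μ X t).card := by
  set cps := changePoints T fun t => Y t ω with hcps
  set bad := (Finset.Icc 1 (T - 1)).filter fun t =>
        ω ∈ badEvent A ρ T (4 * halfLen ρ bs) L c a Y Δ μ X t with hbad
  by_cases hall : cps ⊆ bad
  · have := Finset.card_le_card hall
    omega
  obtain ⟨t, ht, htb⟩ := Finset.not_subset.1 hall
  have hmem : ∀ t ∈ cps, t ∉ bad → ω ∉ badEvent A ρ T (4 * halfLen ρ bs) L c a Y Δ μ X t :=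
    fun t ht htb hb => htb (Finset.mem_filter.2 ⟨(mem_changePoints.1 ht).1, hb⟩)
  refine card_le_card_exactPoints hpick hρ (fun τ hτ => ?_) hbs ?_ fun τ hτ hb =>
    isGood_of_notMem_badEvent hM hσ hρ A hL hcL hcL' hlo hhi hτ (hmem τ hτ hb)
  · have := Finset.mem_Icc.1 (mem_changePoints.1 hτ).1
    omega
  · exact noFalseAlarm_of_noise hρ (d := fun t => Δ t ω) (fun s hs => hM.mean_succ s hs ω)
      fun b hb s hs hs' =>
        badEvent_of_scan (mem_changePoints.1 ht).2 hρ (hmem t ht htb) b hb s hs hs'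

end

/-! ### The probability of the bad events -/

section

/-- The bound on the probability that a change-point at distance at least `R` from the end-points
is bad. Here `N` is the number of the scan statistics and `θ` is the mean of the minimum of two
intensities divided by the mean `p` of an intensity. -/
noncomputable def badBound {σ : ℝ} (A : Tuning σ) (F : Measure ℝ) (R : ℕ) (L c p N θ : ℝ) : ℝ :=
  F.real {x | A.δ ≤ |x| ∧ |x| ≤ A.M}ᶜ + 2 * R * p +
  2 * (Real.exp A.loss * √θ * (1 - Real.exp (-A.slope / 2))⁻¹) +
  2 * (Real.exp (-A.β / (2 * σ ^ 2)) * (1 - Real.exp (-A.η / (2 * σ ^ 2)))⁻¹) +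
  (2 * R + 1) ^ 2 * Real.exp (-(A.ζ ^ 2 * L) / (2 * σ ^ 2)) +
  N * (Real.exp (-c ^ 2 / 2) / c)

theorem sum_exp_neg_mul_le {r : ℝ} (hr : 0 < r) (R : ℕ) :
    ∑ k ∈ Finset.Icc 1 R, Real.exp (-r * k) ≤ (1 - Real.exp (-r))⁻¹ := by
  have h1 : Real.exp (-r) < 1 := Real.exp_lt_one_iff.2 (by linarith)
  have h0 := (Real.exp_pos (-r)).le
  rw [← tsum_geometric_of_lt_one h0 h1]
  have : ∀ k : ℕ, Real.exp (-r * k) = Real.exp (-r) ^ k := fun k => by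
    rw [← Real.exp_nat_mul]; ring_nf
  simp only [this]
  exact (summable_geometric_of_lt_one h0 h1).sum_le_tsum _ fun _ _ => by positivity

theorem measureReal_union_le_add {Ω : Type*} [MeasurableSpace Ω] {P : Measure Ω}
    {s t : Set Ω} {x y : ℝ} (hs : P.real s ≤ x) (ht : P.real t ≤ y) : P.real (s ∪ t) ≤ x + y :=
  (measureReal_union_le s t).trans (add_le_add hs ht)

theorem measureReal_union_le_two_mul {Ω : Type*} [MeasurableSpace Ω] {P : Measure Ω}
    {s t : Set Ω} {x : ℝ} (hs : P.real s ≤ x) (ht : P.real t ≤ x) : P.real (s ∪ t) ≤ 2 * x :=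
  (measureReal_union_le s t).trans (by linarith)

variable {T : ℕ} {G F : Measure ℝ} {σ : ℝ} {Ω : Type*} [MeasurableSpace Ω] {P : Measure Ω}
  {a : ℕ → Ω → ℝ} {Y : ℕ → Ω → Bool} {Δ μ X : ℕ → Ω → ℝ} [IsProbabilityMeasure P]

theorem measureReal_badIncrement_le (hM : IsModel T G F σ P a Y Δ μ X) (hσ : 0 < σ) {t : ℕ}
    (ht : t ∈ Finset.Icc 1 (T - 1)) {p : ℝ} (hp : ∫ x, x ∂G = p) (hp0 : 0 < p) {i j : ℕ}
    (hij : i < j) (hj : j ≤ T) {x y : ℝ} (hx : 1 ≤ x) (hy : x ^ 2 / 2 = y) :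
    P.real (badIncrement σ x Y μ X t i j) ≤ p * Real.exp (-y) := by
  refine (hM.measureReal_Y_inter_increment hσ ht hij hj (by linarith)).trans ?_
  rw [hp, neg_div, hy]
  exact mul_le_mul_of_nonneg_left (div_le_self (Real.exp_pos _).le hx) hp0.le

theorem measureReal_iUnion_badScan_le (hM : IsModel T G F σ P a Y Δ μ X) (hσ : 0 < σ) {p : ℝ}
    (hp : ∫ x, x ∂G = p) (hp0 : 0 < p) {ρ : ℝ} (hρ : 1 < ρ) {c : ℝ} (hc : 0 < c) {t : ℕ}
    (ht : t ∈ Finset.Icc 1 (T - 1)) :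
    P.real (⋃ z ∈ (Finset.range (lastScale ρ T + 1)).sigma
      (fun b => Finset.Icc (halfLen ρ b) (T - halfLen ρ b)),
        badScan σ c Y μ X t (halfLen ρ z.1) z.2) ≤
      p * (((lastScale ρ T + 1) * T : ℝ) * (Real.exp (-c ^ 2 / 2) / c)) := by
  have hone : ∀ z ∈ (Finset.range (lastScale ρ T + 1)).sigma
      (fun b => Finset.Icc (halfLen ρ b) (T - halfLen ρ b)),
      P.real (badScan σ c Y μ X t (halfLen ρ z.1) z.2) ≤ p * (Real.exp (-c ^ 2 / 2) / c) := by
    intro z hz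
    have h1 := Finset.mem_Icc.1 (Finset.mem_sigma.1 hz).2
    have h2 := one_le_halfLen hρ z.1
    rw [badScan, ← hp]
    exact hM.measureReal_Y_inter_scan hσ ht h2 h1.1 (by omega) hc
  refine (measureReal_biUnion_finset_le _ _).trans ((Finset.sum_le_sum hone).trans ?_)
  rw [Finset.sum_const, nsmul_eq_mul, Finset.card_sigma]
  have h1 : ∑ b ∈ Finset.range (lastScale ρ T + 1),
      (Finset.Icc (halfLen ρ b) (T - halfLen ρ b)).card ≤ (lastScale ρ T + 1) * T := by
    refine (Finset.sum_le_card_nsmul _ _ T fun b _ => ?_).trans ?_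
    · have := one_le_halfLen hρ b
      rw [Nat.card_Icc]
      omega
    · rw [Finset.card_range, smul_eq_mul]
  have h2 := (Nat.cast_le (α := ℝ)).2 h1
  push_cast at h2
  push_cast
  calc _ ≤ ((lastScale ρ T : ℝ) + 1) * T * (p * (Real.exp (-c ^ 2 / 2) / c)) :=
        mul_le_mul_of_nonneg_right h2 (by positivity)
    _ = _ := by ring

theorem measureReal_badIntensity_le (hM : IsModel T G F σ P a Y Δ μ X) (hσ : 0 < σ)
    (A : Tuning σ) [IsProbabilityMeasure G] (hG : G (Set.Icc 0 1)ᶜ = 0) {p : ℝ}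
    (hp : ∫ x, x ∂G = p) (hp0 : 0 < p) {θ : ℝ}
    (hθ : p⁻¹ * ∫ x in Set.Ioi (0 : ℝ), (1 - cdf G x) ^ 2 = θ) {s t k : ℕ}
    (hs : s ∈ Finset.Icc 1 (T - 1)) (ht : t ∈ Finset.Icc 1 (T - 1)) (hne : s ≠ t) :
    P.real (badIntensity A a Y t k s) ≤
      p * (Real.exp A.loss * √θ * Real.exp (-(A.slope / 2) * k)) := by
  have hsl := A.slope_pos hσ
  have hlo := A.loss_pos hσ
  have hθ0 : 0 ≤ θ := by
    rw [← hθ]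
    have : 0 ≤ ∫ x in Set.Ioi (0 : ℝ), (1 - cdf G x) ^ 2 := integral_nonneg fun x => sq_nonneg _
    positivity
  have h := hM.measureReal_Y_inter_a_le hG hs ht hne (Real.exp_pos (A.slope * k - A.loss))
    (Real.exp_pos (-A.loss)) (Real.exp_le_one_iff.2 (by linarith))
    (Real.exp_le_exp.2 (by have : 0 ≤ A.slope * k := by positivity
                           linarith))
  refine h.trans ?_
  have hint : ∫ x in Set.Ioi (0 : ℝ), (1 - cdf G x) ^ 2 = p * θ := by
    rw [← hθ, mul_inv_cancel_left₀ hp0.ne']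
  rw [hp, hint, ← Real.exp_neg, ← Real.exp_neg, neg_neg]
  -- the minimum is at most the geometric mean
  set u := Real.exp (-(A.slope / 2) * k)
  have e1 : Real.exp (-(A.slope * k - A.loss)) = Real.exp A.loss * u ^ 2 := by
    rw [← Real.exp_nat_mul, ← Real.exp_add]
    congr 1
    push_cast
    ring
  have hu : 0 ≤ u := (Real.exp_pos _).le
  have hl := Real.exp_pos A.loss
  rw [e1]
  rcases le_total u (√θ) with hle | hle
  · refine (min_le_left _ _).trans ?_
    have : u * u ≤ √θ * u := mul_le_mul_of_nonneg_right hle hu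
    calc Real.exp A.loss * u ^ 2 * p = p * (Real.exp A.loss * (u * u)) := by ring
      _ ≤ p * (Real.exp A.loss * (√θ * u)) := by gcongr
      _ = _ := by ring
  · refine (min_le_right _ _).trans ?_
    have : θ ≤ √θ * u := by
      calc θ = √θ * √θ := (Real.mul_self_sqrt hθ0).symm
        _ ≤ _ := mul_le_mul_of_nonneg_left hle (Real.sqrt_nonneg _)
    calc Real.exp A.loss * (p * θ) = p * (Real.exp A.loss * θ) := by ring
      _ ≤ p * (Real.exp A.loss * (√θ * u)) := by gcongr
      _ = _ := by ring

theorem measureReal_badInterior_le (hM : IsModel T G F σ P a Y Δ μ X) (hσ : 0 < σ)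
    (A : Tuning σ) [IsProbabilityMeasure G] (hG : G (Set.Icc 0 1)ᶜ = 0) {p : ℝ}
    (hp : ∫ x, x ∂G = p) (hp0 : 0 < p) {θ : ℝ}
    (hθ : p⁻¹ * ∫ x in Set.Ioi (0 : ℝ), (1 - cdf G x) ^ 2 = θ) {ρ : ℝ} (hρ : 1 < ρ) {R : ℕ}
    {L c : ℝ} (hL : σ ^ 2 ≤ A.ζ ^ 2 * L) (hc : 0 < c) {t : ℕ} (ht : t ∈ Finset.Icc 1 (T - 1))
    (hleft : R ≤ t) (hright : t + R ≤ T) :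
    P.real (badInterior A ρ T R L c a Y Δ μ X t) ≤
      p * badBound A F R L c p ((lastScale ρ T + 1) * T) θ := by
  have hβσ := A.hβ
  have hβ : 0 < A.β := lt_of_lt_of_le (by positivity) A.hβ
  have hη := A.hη
  have hζ := A.hζ
  have ht' := Finset.mem_Icc.1 ht
  have hσ2 : 0 < σ ^ 2 := by positivity
  have hL0 : 0 ≤ L := by
    by_contra! hneg
    have : A.ζ ^ 2 * L < 0 := mul_neg_of_pos_of_neg (by positivity) hneg
    linarith
  have hnb : ∀ k ∈ Finset.Icc 1 (R - 1), t + k ∈ Finset.Icc 1 (T - 1) ∧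
      t - k ∈ Finset.Icc 1 (T - 1) ∧ t + k ≠ t ∧ t - k ≠ t := by
    intro k hk
    simp only [Finset.mem_Icc] at hk ⊢
    omega
  have b1 : P.real (badJump A Y Δ t) ≤ p * F.real {x | A.δ ≤ |x| ∧ |x| ≤ A.M}ᶜ := by
    rw [← hp]
    exact (hM.measureReal_Y_inter_Δ ht ((measurableSet_le measurable_const measurable_abs).inter
      (measurableSet_le measurable_abs measurable_const)).compl).le
  have b2 : P.real ({ω | Y t ω = true} ∩ {ω | a t ω < 0}) ≤ 0 := by
    have h0 : P {ω | a t ω < 0} = 0 := by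
      refine measure_mono_null (fun ω h => ?_) (ae_iff.1 (hM.ae_mem_Icc hG ht))
      exact fun h' => not_lt.2 h'.1 h
    rw [measureReal_def, measure_mono_null Set.inter_subset_right h0, ENNReal.toReal_zero]
  have b3 : P.real (⋃ k ∈ Finset.Icc 1 (R - 1), badNeighbour Y t (t + k) ∪
      badNeighbour Y t (t - k)) ≤ p * (2 * R * p) := by
    refine (measureReal_biUnion_finset_le _ _).trans ((Finset.sum_le_sum fun k hk =>
      measureReal_union_le_two_mul (x := p ^ 2) ?_ ?_).trans ?_)
    · exact (hp ▸ hM.measureReal_Y_inter_Y ht (hnb k hk).1 (hnb k hk).2.2.1.symm).le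
    · exact (hp ▸ hM.measureReal_Y_inter_Y ht (hnb k hk).2.1 (hnb k hk).2.2.2.symm).le
    · rw [Finset.sum_const, Nat.card_Icc, nsmul_eq_mul]
      have : ((R - 1 + 1 - 1 : ℕ) : ℝ) ≤ R := by exact_mod_cast (by omega)
      calc _ ≤ (R : ℝ) * (2 * p ^ 2) := mul_le_mul_of_nonneg_right this (by positivity)
        _ = _ := by ring
  have b4 : P.real (⋃ k ∈ Finset.Icc 1 (R - 1), badIntensity A a Y t k (t + k) ∪
      badIntensity A a Y t k (t - k)) ≤
      p * (2 * (Real.exp A.loss * √θ * (1 - Real.exp (-A.slope / 2))⁻¹)) := by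
    refine (measureReal_biUnion_finset_le _ _).trans ((Finset.sum_le_sum fun k hk =>
      measureReal_union_le_two_mul
        (measureReal_badIntensity_le hM hσ A hG hp hp0 hθ (hnb k hk).1 ht (hnb k hk).2.2.1)
        (measureReal_badIntensity_le hM hσ A hG hp hp0 hθ (hnb k hk).2.1 ht
          (hnb k hk).2.2.2)).trans ?_)
    simp only [← Finset.mul_sum]
    have := sum_exp_neg_mul_le (half_pos (A.slope_pos hσ)) (R - 1)
    rw [neg_div]
    calc 2 * (p * (Real.exp A.loss * √θ *
          ∑ k ∈ Finset.Icc 1 (R - 1), Real.exp (-(A.slope / 2) * k)))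
        ≤ 2 * (p * (Real.exp A.loss * √θ * (1 - Real.exp (-(A.slope / 2)))⁻¹)) := by gcongr
      _ = _ := by ring
  have b5 : P.real (⋃ k ∈ Finset.Icc 1 R, badIncrement σ (√(A.β + A.η * k) / σ) Y μ X t t (t + k) ∪
      badIncrement σ (√(A.β + A.η * k) / σ) Y μ X t (t - k) t) ≤
      p * (2 * (Real.exp (-A.β / (2 * σ ^ 2)) * (1 - Real.exp (-A.η / (2 * σ ^ 2)))⁻¹)) := by
    have hx : ∀ k : ℕ, 1 ≤ √(A.β + A.η * k) / σ := fun k => by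
      rw [one_le_div hσ]
      refine Real.le_sqrt_of_sq_le ?_
      have : 0 ≤ A.η * k := by positivity
      linarith
    have hy : ∀ k : ℕ, (√(A.β + A.η * k) / σ) ^ 2 / 2 = (A.β + A.η * k) / (2 * σ ^ 2) :=
      fun k => by
        rw [div_pow, Real.sq_sqrt (by positivity)]
        field_simp
    refine (measureReal_biUnion_finset_le _ _).trans ((Finset.sum_le_sum fun k hk =>
      measureReal_union_le_two_mul
        (measureReal_badIncrement_le hM hσ ht hp hp0 (i := t) (j := t + k) ?_ ?_ (hx k) (hy k))
        (measureReal_badIncrement_le hM hσ ht hp hp0 (i := t - k) (j := t) ?_ ?_ (hx k)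
          (hy k))).trans ?_)
    · have := Finset.mem_Icc.1 hk
      omega
    · have := Finset.mem_Icc.1 hk
      omega
    · have := Finset.mem_Icc.1 hk
      omega
    · omega
    · have e : ∀ k : ℕ, Real.exp (-((A.β + A.η * k) / (2 * σ ^ 2))) =
          Real.exp (-A.β / (2 * σ ^ 2)) * Real.exp (-(A.η / (2 * σ ^ 2)) * k) := fun k => by
        rw [← Real.exp_add]
        congr 1
        ring
      simp only [e, ← Finset.mul_sum]
      have := sum_exp_neg_mul_le (r := A.η / (2 * σ ^ 2)) (by positivity) R
      rw [neg_div _ A.η]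
      calc 2 * (p * (Real.exp (-A.β / (2 * σ ^ 2)) *
            ∑ k ∈ Finset.Icc 1 R, Real.exp (-(A.η / (2 * σ ^ 2)) * k)))
          ≤ 2 * (p * (Real.exp (-A.β / (2 * σ ^ 2)) *
            (1 - Real.exp (-(A.η / (2 * σ ^ 2))))⁻¹)) := by gcongr
        _ = _ := by ring
  have b6 : P.real (⋃ z ∈ ((Finset.Icc (t - R) (t + R)) ×ˢ (Finset.Icc (t - R) (t + R))).filter
      (fun z => z.1 < z.2), badIncrement σ (A.ζ * √L / σ) Y μ X t z.1 z.2) ≤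
      p * ((2 * R + 1) ^ 2 * Real.exp (-(A.ζ ^ 2 * L) / (2 * σ ^ 2))) := by
    have hx : 1 ≤ A.ζ * √L / σ := by
      rw [one_le_div hσ, ← Real.sqrt_sq hζ.le, ← Real.sqrt_mul (sq_nonneg _)]
      exact Real.le_sqrt_of_sq_le hL
    have hy : (A.ζ * √L / σ) ^ 2 / 2 = A.ζ ^ 2 * L / (2 * σ ^ 2) := by
      rw [div_pow, mul_pow, Real.sq_sqrt hL0]
      field_simp
    refine (measureReal_biUnion_finset_le _ _).trans ((Finset.sum_le_sum fun z hz =>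
      measureReal_badIncrement_le hM hσ ht hp hp0 (Finset.mem_filter.1 hz).2 ?_ hx hy).trans ?_)
    · have h1 := (Finset.mem_product.1 (Finset.mem_filter.1 hz).1).2
      have := Finset.mem_Icc.1 h1
      omega
    · rw [Finset.sum_const, nsmul_eq_mul, neg_div]
      have h1 : (((Finset.Icc (t - R) (t + R)) ×ˢ (Finset.Icc (t - R) (t + R))).filter
          (fun z => z.1 < z.2)).card ≤ (2 * R + 1) ^ 2 := by
        refine (Finset.card_filter_le _ _).trans (le_of_eq ?_)
        rw [Finset.card_product, Nat.card_Icc, sq]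
        congr 1 <;> omega
      have h2 := (Nat.cast_le (α := ℝ)).2 h1
      push_cast at h2
      calc _ ≤ (2 * (R : ℝ) + 1) ^ 2 * (p * Real.exp (-(A.ζ ^ 2 * L / (2 * σ ^ 2)))) :=
            mul_le_mul_of_nonneg_right h2 (by positivity)
        _ = _ := by ring
  have b7 := measureReal_iUnion_badScan_le hM hσ hp hp0 hρ hc ht
  rw [badInterior, badBound]
  exact (measureReal_union_le_add (measureReal_union_le_add (measureReal_union_le_add
    (measureReal_union_le_add (measureReal_union_le_add (measureReal_union_le_add b1 b2) b3) b4)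
    b5) b6) b7).trans_eq (by ring)

end

/-! ### From the expected number of bad change-points to the error criterion -/

section

variable {T : ℕ} {G F : Measure ℝ} {σ : ℝ} {Ω : Type*}

theorem card_changePoints_eq_sum (Y : ℕ → Ω → Bool) (ω : Ω) :
    ((changePoints T fun t => Y t ω).card : ℝ) =
      ∑ t ∈ Finset.Icc 1 (T - 1), {ω | Y t ω = true}.indicator (fun _ => (1 : ℝ)) ω := by
  rw [changePoints, Finset.card_filter]
  push_cast
  refine Finset.sum_congr rfl fun t _ => ?_
  simp [Set.indicator_apply]

theorem card_sq_eq_sum (Y : ℕ → Ω → Bool) (ω : Ω) :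
    ((changePoints T fun t => Y t ω).card : ℝ) ^ 2 =
      ∑ s ∈ Finset.Icc 1 (T - 1), ∑ t ∈ Finset.Icc 1 (T - 1),
        ({ω | Y s ω = true} ∩ {ω | Y t ω = true}).indicator (fun _ => (1 : ℝ)) ω := by
  rw [card_changePoints_eq_sum, sq, Finset.sum_mul_sum]
  refine Finset.sum_congr rfl fun s _ => Finset.sum_congr rfl fun t _ => ?_
  simp only [Set.indicator_apply, Set.mem_inter_iff]
  split_ifs <;> simp_all

variable [MeasurableSpace Ω] {P : Measure Ω}
  {a : ℕ → Ω → ℝ} {Y : ℕ → Ω → Bool} {Δ μ X : ℕ → Ω → ℝ}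

namespace IsModel

theorem measurable_card (hM : IsModel T G F σ P a Y Δ μ X) :
    Measurable fun ω => ((changePoints T fun t => Y t ω).card : ℝ) := by
  simp only [card_changePoints_eq_sum]
  exact Finset.measurable_sum _ fun t ht => measurable_const.indicator (hM.measurableSet_Y ht)

theorem measurableSet_card_ge (hM : IsModel T G F σ P a Y Δ μ X) :
    MeasurableSet {ω | 1 ≤ (changePoints T fun t => Y t ω).card} := by
  have := measurableSet_le (measurable_const (a := (1 : ℝ))) hM.measurable_card
  convert this using 2
  ext ω
  simp

variable [IsProbabilityMeasure P]

theorem integrable_card (hM : IsModel T G F σ P a Y Δ μ X) :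
    Integrable (fun ω => ((changePoints T fun t => Y t ω).card : ℝ)) P := by
  simp only [card_changePoints_eq_sum]
  exact integrable_finsetSum _ fun t ht =>
    (integrable_const _).indicator (hM.measurableSet_Y ht)

theorem integral_card (hM : IsModel T G F σ P a Y Δ μ X) :
    ∫ ω, ((changePoints T fun t => Y t ω).card : ℝ) ∂P = ((T - 1 : ℕ) : ℝ) * ∫ x, x ∂G := by
  simp only [card_changePoints_eq_sum]
  rw [integral_finsetSum _ fun t ht => (integrable_const _).indicator (hM.measurableSet_Y ht)]
  rw [Finset.sum_congr rfl (g := fun _ => ∫ x, x ∂G) fun t ht => ?_]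
  · simp
  · rw [integral_indicator_const _ (hM.measurableSet_Y ht), hM.measureReal_Y ht, smul_eq_mul,
      mul_one]

theorem integrable_card_sq (hM : IsModel T G F σ P a Y Δ μ X) :
    Integrable (fun ω => ((changePoints T fun t => Y t ω).card : ℝ) ^ 2) P := by
  simp only [card_sq_eq_sum]
  exact integrable_finsetSum _ fun s hs => integrable_finsetSum _ fun t ht =>
    (integrable_const _).indicator ((hM.measurableSet_Y hs).inter (hM.measurableSet_Y ht))

theorem integral_card_sq_le (hM : IsModel T G F σ P a Y Δ μ X) {p : ℝ} (hp : ∫ x, x ∂G = p) :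
    ∫ ω, ((changePoints T fun t => Y t ω).card : ℝ) ^ 2 ∂P ≤
      ((T - 1 : ℕ) : ℝ) * p + (((T - 1 : ℕ) : ℝ) * p) ^ 2 := by
  simp only [card_sq_eq_sum]
  rw [integral_finsetSum _ fun s hs => integrable_finsetSum _ fun t ht =>
    (integrable_const _).indicator ((hM.measurableSet_Y hs).inter (hM.measurableSet_Y ht))]
  have hst : ∀ s ∈ Finset.Icc 1 (T - 1), ∀ t ∈ Finset.Icc 1 (T - 1),
      ∫ ω, ({ω | Y s ω = true} ∩ {ω | Y t ω = true}).indicator (fun _ => (1 : ℝ)) ω ∂P ≤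
        (if s = t then p else 0) + p ^ 2 := by
    intro s hs t ht
    rw [integral_indicator_const _ ((hM.measurableSet_Y hs).inter (hM.measurableSet_Y ht)),
      smul_eq_mul, mul_one]
    split_ifs with h
    · subst h
      rw [Set.inter_self, hM.measureReal_Y hs, hp]
      linarith [sq_nonneg p]
    · rw [hM.measureReal_Y_inter_Y hs ht h, hp]
      linarith
  have hs' : ∀ s ∈ Finset.Icc 1 (T - 1), ∫ ω, ∑ t ∈ Finset.Icc 1 (T - 1),
      ({ω | Y s ω = true} ∩ {ω | Y t ω = true}).indicator (fun _ => (1 : ℝ)) ω ∂P ≤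
        p + ((T - 1 : ℕ) : ℝ) * p ^ 2 := by
    intro s hs
    rw [integral_finsetSum _ fun t ht =>
      (integrable_const _).indicator ((hM.measurableSet_Y hs).inter (hM.measurableSet_Y ht))]
    refine (Finset.sum_le_sum fun t ht => hst s hs t ht).trans_eq ?_
    rw [Finset.sum_add_distrib, Finset.sum_ite_eq, if_pos hs]
    simp
  refine (Finset.sum_le_sum hs').trans_eq ?_
  rw [Finset.sum_const, Nat.card_Icc, nsmul_eq_mul, Nat.add_sub_cancel]
  ring

/-- Second moment bound on the probability of having a change-point. -/
theorem le_measureReal_card_ge (hM : IsModel T G F σ P a Y Δ μ X) {p m : ℝ} (hp : ∫ x, x ∂G = p)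
    (hp0 : 0 ≤ p) (hm : ((T - 1 : ℕ) : ℝ) * p = m) :
    m / (1 + m) ≤ P.real {ω | 1 ≤ (changePoints T fun t => Y t ω).card} := by
  have hm0 : 0 ≤ m := by rw [← hm]; positivity
  have hm1 : 0 < 1 + m := by linarith
  have h1 := hM.integral_card
  have h2 := hM.integral_card_sq_le hp
  rw [hp, hm] at h1
  rw [hm] at h2
  rw [← mul_one (P.real _), ← smul_eq_mul, ← integral_indicator_const _ hM.measurableSet_card_ge]
  -- The indicator of `1 ≤ J` is at least `2 r J - r² J²` for every `r`; this `r` optimizes the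
  -- expectation of the right-hand side.
  set r := (1 + m)⁻¹ with hr
  have hr0 : 0 < r := by positivity
  calc m / (1 + m) ≤ 2 * r * m - r ^ 2 * (m + m ^ 2) := by
        apply le_of_eq
        rw [hr]
        field_simp
        ring
    _ ≤ 2 * r * ∫ ω, ((changePoints T fun t => Y t ω).card : ℝ) ∂P -
        r ^ 2 * ∫ ω, ((changePoints T fun t => Y t ω).card : ℝ) ^ 2 ∂P := by
        rw [h1]
        gcongr
    _ = ∫ ω, (2 * r * ((changePoints T fun t => Y t ω).card : ℝ) -
        r ^ 2 * ((changePoints T fun t => Y t ω).card : ℝ) ^ 2) ∂P := by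
        rw [integral_sub (hM.integrable_card.const_mul _) (hM.integrable_card_sq.const_mul _),
          integral_const_mul, integral_const_mul]
    _ ≤ _ := by
        refine integral_mono ((hM.integrable_card.const_mul _).sub
          (hM.integrable_card_sq.const_mul _))
          ((integrable_const _).indicator hM.measurableSet_card_ge) fun ω => ?_
        simp only [Set.indicator_apply, Set.mem_ofPred_eq]
        split_ifs with h
        · nlinarith [sq_nonneg (1 - r * ((changePoints T fun t => Y t ω).card : ℝ))]
        · have : (changePoints T fun t => Y t ω).card = 0 := by omega
          simp [this]

/-- Chebyshev bound on the probability of having few change-points. -/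
theorem measureReal_card_lt_le (hM : IsModel T G F σ P a Y Δ μ X) {p m : ℝ}
    (hp : ∫ x, x ∂G = p) (hm : ((T - 1 : ℕ) : ℝ) * p = m) (hm0 : 0 < m) :
    P.real {ω | ((changePoints T fun t => Y t ω).card : ℝ) < m / 2} ≤ 4 / m := by
  have h1 := hM.integral_card
  have h2 := hM.integral_card_sq_le hp
  rw [hp, hm] at h1
  rw [hm] at h2
  have hmeas : MeasurableSet {ω | ((changePoints T fun t => Y t ω).card : ℝ) < m / 2} :=
    measurableSet_lt hM.measurable_card measurable_const
  have hint : Integrable (fun ω => ((changePoints T fun t => Y t ω).card : ℝ) ^ 2 -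
      2 * m * ((changePoints T fun t => Y t ω).card : ℝ) + m ^ 2) P :=
    (hM.integrable_card_sq.sub (hM.integrable_card.const_mul _)).add (integrable_const _)
  rw [← mul_one (P.real _), ← smul_eq_mul, ← integral_indicator_const _ hmeas]
  calc _ ≤ ∫ ω, 4 / m ^ 2 * (((changePoints T fun t => Y t ω).card : ℝ) ^ 2 -
          2 * m * ((changePoints T fun t => Y t ω).card : ℝ) + m ^ 2) ∂P := by
        refine integral_mono ((integrable_const _).indicator hmeas) (hint.const_mul _) fun ω => ?_
        simp only [Set.indicator_apply, Set.mem_ofPred_eq]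
        set J := ((changePoints T fun t => Y t ω).card : ℝ)
        rw [div_mul_eq_mul_div]
        split_ifs with h
        · rw [one_le_div (by positivity)]
          nlinarith
        · have : J ^ 2 - 2 * m * J + m ^ 2 = (J - m) ^ 2 := by ring
          rw [this]
          positivity
    _ = 4 / m ^ 2 * (∫ ω, ((changePoints T fun t => Y t ω).card : ℝ) ^ 2 ∂P -
          2 * m * ∫ ω, ((changePoints T fun t => Y t ω).card : ℝ) ∂P + m ^ 2) := by
        have hsub : Integrable (fun ω => ((changePoints T fun t => Y t ω).card : ℝ) ^ 2 -
            2 * m * ((changePoints T fun t => Y t ω).card : ℝ)) P :=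
          hM.integrable_card_sq.sub (hM.integrable_card.const_mul _)
        rw [integral_const_mul, integral_add hsub (integrable_const _), integral_sub
          hM.integrable_card_sq (hM.integrable_card.const_mul _), integral_const_mul]
        simp
    _ ≤ 4 / m ^ 2 * m := by
        rw [h1]
        refine mul_le_mul_of_nonneg_left ?_ (by positivity)
        linarith
    _ = 4 / m := by field_simp

end IsModel

theorem beta_le_one (P : Measure Ω) (Y : ℕ → Ω → Bool) (est : Ω → Finset ℕ) : beta T P Y est ≤ 1 := by
  rw [beta]
  refine (lintegral_mono (g := fun _ => 1) fun ω => ?_).trans ?_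
  · refine ENNReal.div_le_of_le_mul ?_
    rw [one_mul]
    exact_mod_cast Finset.card_filter_le _ _
  · rw [lintegral_const, one_mul]
    exact prob_le_one

open Classical in
/-- If the expected number of bad change-points is small compared with the expected number of
change-points, then the error criterion is close to one. -/
theorem le_beta [IsProbabilityMeasure P] (hM : IsModel T G F σ P a Y Δ μ X) {p m κ : ℝ} (hp : ∫ x, x ∂G = p)
    (hp0 : 0 < p) (hm : ((T - 1 : ℕ) : ℝ) * p = m) (hm0 : 0 < m) (hκ : 0 < κ) (hκ1 : κ ≤ 1)
    {est : Ω → Finset ℕ} {bad : ℕ → Set Ω}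
    (hmeas : ∀ t ∈ Finset.Icc 1 (T - 1), MeasurableSet (bad t))
    (hsub : ∀ t ∈ Finset.Icc 1 (T - 1), bad t ⊆ {ω | Y t ω = true})
    (hsum : ∑ t ∈ Finset.Icc 1 (T - 1), P.real (bad t) ≤ κ ^ 2 * m)
    (hcard : ∀ ω, (changePoints T fun t => Y t ω).card ≤
      (exactPoints T (changePoints T fun t => Y t ω) (est ω)).card +
        3 * ((Finset.Icc 1 (T - 1)).filter fun t => ω ∈ bad t).card) :
    ENNReal.ofReal (1 - 36 * κ) ≤ beta T P Y est := by
  set A := {ω | 1 ≤ (changePoints T fun t => Y t ω).card} with hA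
  set J : Ω → ℝ≥0∞ := fun ω => ((changePoints T fun t => Y t ω).card : ℝ≥0∞) with hJ
  set B : Ω → ℝ≥0∞ := fun ω => (((Finset.Icc 1 (T - 1)).filter fun t => ω ∈ bad t).card : ℝ≥0∞)
    with hB
  have hAm : MeasurableSet A := hM.measurableSet_card_ge
  have hPA := hM.le_measureReal_card_ge hp hp0.le hm
  have hPA0 : 0 < P.real A := lt_of_lt_of_le (by positivity) hPA
  have hPA' : P A ≠ 0 := fun h => by simp [measureReal_def, h] at hPA0
  have := cond_isProbabilityMeasure hPA'
  have hB' : B = fun ω => ∑ t ∈ Finset.Icc 1 (T - 1), (bad t).indicator (fun _ => (1 : ℝ≥0∞)) ω := by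
    ext ω
    simp only [hB, Finset.card_filter]
    push_cast
    exact Finset.sum_congr rfl fun t _ => by simp [Set.indicator_apply]
  have hBm : Measurable B := by
    rw [hB']
    exact Finset.measurable_sum _ fun t ht => measurable_const.indicator (hmeas t ht)
  have hJm : Measurable J := by
    have := hM.measurable_card.ennreal_ofReal
    simpa using this
  have hBint : ∫⁻ ω, B ω ∂P ≤ ENNReal.ofReal (κ ^ 2 * m) := by
    rw [hB', lintegral_finsetSum _ fun t ht => measurable_const.indicator (hmeas t ht)]
    refine le_trans (le_of_eq ?_) (ENNReal.ofReal_le_ofReal hsum)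
    rw [ENNReal.ofReal_sum_of_nonneg fun _ _ => measureReal_nonneg]
    refine Finset.sum_congr rfl fun t ht => ?_
    rw [lintegral_indicator_const (hmeas t ht), one_mul, ofReal_measureReal]
  have hBJ : ∀ ω, B ω ≤ J ω := fun ω => by
    refine Nat.cast_le.2 (Finset.card_le_card fun t ht => ?_)
    have := Finset.mem_filter.1 ht
    exact mem_changePoints.2 ⟨this.1, hsub t this.1 this.2⟩
  have key : ∫⁻ ω in A, B ω / J ω ∂P ≤ ENNReal.ofReal (12 * κ * P.real A) := by
    -- If `m ≤ 1 / κ`, then `1 / J ≤ 1` suffices, since `P A ≥ m / (1 + m)`. Otherwise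
    -- `1 / J ≤ 2 / m` outside the event `J < m / 2`, whose probability is small, while
    -- `B / J ≤ 1` on that event.
    rcases le_or_gt (κ * m) 1 with hcase | hcase
    · calc ∫⁻ ω in A, B ω / J ω ∂P ≤ ∫⁻ ω in A, B ω ∂P := by
            refine setLIntegral_mono hBm fun ω hω => ?_
            refine ENNReal.div_le_of_le_mul ?_
            have : (1 : ℝ≥0∞) ≤ J ω := by
              have : 1 ≤ (changePoints T fun t => Y t ω).card := hω
              simp only [hJ]
              exact_mod_cast this
            exact le_mul_of_one_le_right (by simp) this
        _ ≤ ∫⁻ ω, B ω ∂P := setLIntegral_le_lintegral _ _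
        _ ≤ ENNReal.ofReal (κ ^ 2 * m) := hBint
        _ ≤ _ := by
            refine ENNReal.ofReal_le_ofReal ?_
            calc κ ^ 2 * m ≤ 12 * κ * (m / (1 + m)) := by
                  rw [← mul_div_assoc, le_div_iff₀ (by positivity)]
                  have : κ * (1 + m) ≤ 12 := by linarith
                  calc κ ^ 2 * m * (1 + m) = κ * m * (κ * (1 + m)) := by ring
                    _ ≤ κ * m * 12 := mul_le_mul_of_nonneg_left this (by positivity)
                    _ = _ := by ring
              _ ≤ _ := mul_le_mul_of_nonneg_left hPA (by positivity)
    · have hm1 : 1 ≤ m := by nlinarith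
      have hJm' : MeasurableSet {ω | ((changePoints T fun t => Y t ω).card : ℝ) < m / 2} :=
        measurableSet_lt hM.measurable_card measurable_const
      calc ∫⁻ ω in A, B ω / J ω ∂P ≤ ∫⁻ ω, B ω / J ω ∂P := setLIntegral_le_lintegral _ _
        _ ≤ ∫⁻ ω, ({ω | ((changePoints T fun t => Y t ω).card : ℝ) < m / 2}.indicator
              (fun _ => (1 : ℝ≥0∞)) ω + ENNReal.ofReal (2 / m) * B ω) ∂P := by
            refine lintegral_mono fun ω => ?_
            by_cases h : ((changePoints T fun t => Y t ω).card : ℝ) < m / 2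
            · rw [Set.indicator_of_mem (by exact h)]
              refine le_add_right (ENNReal.div_le_of_le_mul ?_)
              rw [one_mul]
              exact hBJ ω
            · rw [Set.indicator_of_notMem (by exact h), zero_add, div_eq_mul_inv, mul_comm]
              refine mul_le_mul_left ?_ _
              rw [ENNReal.inv_le_iff_inv_le, ← ENNReal.ofReal_inv_of_pos (by positivity), inv_div]
              refine (ENNReal.ofReal_le_ofReal (not_lt.1 h)).trans_eq ?_
              rw [hJ, ENNReal.ofReal_natCast]
        _ = P {ω | ((changePoints T fun t => Y t ω).card : ℝ) < m / 2} +
              ENNReal.ofReal (2 / m) * ∫⁻ ω, B ω ∂P := by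
            rw [lintegral_add_left (measurable_const.indicator hJm'),
              lintegral_indicator_const hJm', one_mul, lintegral_const_mul _ hBm]
        _ ≤ ENNReal.ofReal (4 / m) + ENNReal.ofReal (2 / m) * ENNReal.ofReal (κ ^ 2 * m) := by
            gcongr
            rw [← ofReal_measureReal]
            exact ENNReal.ofReal_le_ofReal (hM.measureReal_card_lt_le hp hm hm0)
        _ = ENNReal.ofReal (4 / m + 2 / m * (κ ^ 2 * m)) := by
            rw [← ENNReal.ofReal_mul (by positivity), ← ENNReal.ofReal_add (by positivity)
              (by positivity)]
        _ ≤ _ := by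
            refine ENNReal.ofReal_le_ofReal ?_
            have h1 : 1 / 2 ≤ m / (1 + m) := by
              rw [div_le_div_iff₀ (by norm_num) (by positivity)]
              linarith
            have h2 : 4 / m ≤ 4 * κ := by
              rw [div_le_iff₀ hm0]
              linarith
            have h3 : 2 / m * (κ ^ 2 * m) = 2 * κ ^ 2 := by field_simp
            have h4 : κ ^ 2 ≤ κ := by nlinarith
            have h5 : 12 * κ * (1 / 2) ≤ 12 * κ * P.real A :=
              mul_le_mul_of_nonneg_left (h1.trans hPA) (by positivity)
            linarith
  have key2 : ∫⁻ ω, B ω / J ω ∂(cond P A) ≤ ENNReal.ofReal (12 * κ) := by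
    rw [ProbabilityTheory.cond, lintegral_smul_measure, smul_eq_mul, mul_comm, ← div_eq_mul_inv]
    refine ENNReal.div_le_of_le_mul (key.trans_eq ?_)
    rw [ENNReal.ofReal_mul (by positivity), ofReal_measureReal]
  have hone : (1 : ℝ≥0∞) ≤ beta T P Y est + 3 * ∫⁻ ω, B ω / J ω ∂(cond P A) := by
    -- The estimates need not be measurable, so `beta` is a lower integral of an arbitrary function;
    -- additivity only needs the other summand to be measurable.
    have hBJm : Measurable fun ω => B ω / J ω := hBm.div hJm
    rw [beta, ← lintegral_const_mul _ hBJm, ← lintegral_add_right _ (hBJm.const_mul _)]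
    have h1 : ∫⁻ _ω, (1 : ℝ≥0∞) ∂(cond P A) = 1 := by simp
    refine h1.symm.trans_le (lintegral_mono_ae ?_)
    filter_upwards [ae_cond_mem hAm] with ω hω
    have hJ0 : J ω ≠ 0 := by
      have : (changePoints T fun t => Y t ω).card ≠ 0 := by
        have : 1 ≤ (changePoints T fun t => Y t ω).card := hω
        omega
      simp only [hJ]
      exact_mod_cast this
    have hJt : J ω ≠ ∞ := ENNReal.natCast_ne_top _
    rw [← ENNReal.div_self hJ0 hJt, ← mul_div_assoc, ← ENNReal.add_div]
    refine ENNReal.div_le_div_right ?_ _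
    simp only [hJ, hB]
    exact_mod_cast hcard ω
  rw [ENNReal.ofReal_sub _ (by positivity), ENNReal.ofReal_one, tsub_le_iff_right]
  refine hone.trans (add_le_add_right ?_ _)
  calc 3 * ∫⁻ ω, B ω / J ω ∂(cond P A) ≤ 3 * ENNReal.ofReal (12 * κ) := by gcongr
    _ = ENNReal.ofReal (36 * κ) := by
        rw [← ENNReal.ofReal_ofNat, ← ENNReal.ofReal_mul (by norm_num)]
        congr 1
        ring

end

/-! ### The expected number of bad change-points -/

section

variable {T : ℕ} {G F : Measure ℝ} {σ : ℝ} {Ω : Type*} [MeasurableSpace Ω] {P : Measure Ω}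
  {a : ℕ → Ω → ℝ} {Y : ℕ → Ω → Bool} {Δ μ X : ℕ → Ω → ℝ}

theorem IsModel.measurable_partialSum (hM : IsModel T G F σ P a Y Δ μ X) {j : ℕ} (hj : j ≤ T) :
    Measurable fun ω => partialSum (fun u => X u ω - μ u ω) j := by
  refine Finset.measurable_sum _ fun u hu => ?_
  have hu' : u ∈ Finset.Icc 1 T := by
    rw [Finset.mem_Icc] at hu ⊢
    omega
  exact (hM.measurable_X u hu').sub (hM.measurable_μ u hu')

theorem IsModel.measurableSet_badIncrement (hM : IsModel T G F σ P a Y Δ μ X) {t : ℕ}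
    (ht : t ∈ Finset.Icc 1 (T - 1)) {i j : ℕ} (hi : i ≤ T) (hj : j ≤ T) (x : ℝ) :
    MeasurableSet (badIncrement σ x Y μ X t i j) :=
  (hM.measurableSet_Y ht).inter (measurableSet_le measurable_const
    (((hM.measurable_partialSum hj).sub (hM.measurable_partialSum hi)).abs))

theorem IsModel.measurableSet_badScan (hM : IsModel T G F σ P a Y Δ μ X) {t : ℕ}
    (ht : t ∈ Finset.Icc 1 (T - 1)) {s l : ℕ} (hs : s + l ≤ T) (c : ℝ) :
    MeasurableSet (badScan σ c Y μ X t l s) :=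
  (hM.measurableSet_Y ht).inter (measurableSet_le measurable_const
    ((((hM.measurable_partialSum hs).add (hM.measurable_partialSum (by omega))).sub
      ((hM.measurable_partialSum (by omega)).const_mul _)).const_mul _).abs)

theorem IsModel.measurableSet_badIntensity (hM : IsModel T G F σ P a Y Δ μ X) (A : Tuning σ)
    {t s : ℕ} (ht : t ∈ Finset.Icc 1 (T - 1)) (hs : s ∈ Finset.Icc 1 (T - 1)) (k : ℕ) :
    MeasurableSet (badIntensity A a Y t k s) :=
  (hM.measurableSet_Y ht).inter
    (measurableSet_le ((hM.measurable_a t ht).mul_const _) (hM.measurable_a s hs))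

theorem IsModel.measurableSet_badEvent (hM : IsModel T G F σ P a Y Δ μ X) (A : Tuning σ) {ρ : ℝ}
    (hρ : 1 < ρ) {R : ℕ} {L c : ℝ} {t : ℕ} (ht : t ∈ Finset.Icc 1 (T - 1)) :
    MeasurableSet (badEvent A ρ T R L c a Y Δ μ X t) := by
  rw [badEvent]
  have ht' := Finset.mem_Icc.1 ht
  split_ifs with h
  swap
  · exact hM.measurableSet_Y ht
  have hnb : ∀ k ∈ Finset.Icc 1 (R - 1), t + k ∈ Finset.Icc 1 (T - 1) ∧
      t - k ∈ Finset.Icc 1 (T - 1) := by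
    intro k hk
    simp only [Finset.mem_Icc] at hk ⊢
    omega
  refine (((((MeasurableSet.union ?_ ?_).union ?_).union ?_).union ?_).union ?_).union ?_
  · exact (hM.measurableSet_Y ht).inter (hM.measurable_Δ t ht
      ((measurableSet_le measurable_const measurable_abs).inter
        (measurableSet_le measurable_abs measurable_const)).compl)
  · exact (hM.measurableSet_Y ht).inter (measurableSet_lt (hM.measurable_a t ht) measurable_const)
  · exact Finset.measurableSet_biUnion _ fun k hk =>
      ((hM.measurableSet_Y ht).inter (hM.measurableSet_Y (hnb k hk).1)).union
        ((hM.measurableSet_Y ht).inter (hM.measurableSet_Y (hnb k hk).2))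
  · exact Finset.measurableSet_biUnion _ fun k hk =>
      (hM.measurableSet_badIntensity A ht (hnb k hk).1 k).union
        (hM.measurableSet_badIntensity A ht (hnb k hk).2 k)
  · refine Finset.measurableSet_biUnion _ fun k hk => ?_
    have := Finset.mem_Icc.1 hk
    exact (hM.measurableSet_badIncrement ht (by omega) (by omega) _).union
      (hM.measurableSet_badIncrement ht (by omega) (by omega) _)
  · refine Finset.measurableSet_biUnion _ fun z hz => ?_
    have h1 := Finset.mem_product.1 (Finset.mem_filter.1 hz).1
    have h2 := Finset.mem_Icc.1 h1.1
    have h3 := Finset.mem_Icc.1 h1.2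
    exact hM.measurableSet_badIncrement ht (by omega) (by omega) _
  · refine Finset.measurableSet_biUnion _ fun z hz => ?_
    have h1 := Finset.mem_Icc.1 (Finset.mem_sigma.1 hz).2
    have := one_le_halfLen hρ z.1
    exact hM.measurableSet_badScan ht (by omega) _

theorem badBound_nonneg (A : Tuning σ) (F : Measure ℝ) (R : ℕ) {L c p N θ : ℝ} (hσ : 0 < σ)
    (hc : 0 < c) (hp : 0 ≤ p) (hN : 0 ≤ N) : 0 ≤ badBound A F R L c p N θ := by
  have h1 : 0 ≤ (1 - Real.exp (-A.slope / 2))⁻¹ :=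
    inv_nonneg.2 (sub_nonneg.2 (Real.exp_le_one_iff.2 (by linarith [A.slope_pos hσ])))
  have h2 : 0 ≤ (1 - Real.exp (-A.η / (2 * σ ^ 2)))⁻¹ := by
    refine inv_nonneg.2 (sub_nonneg.2 (Real.exp_le_one_iff.2 ?_))
    rw [neg_div, neg_nonpos]
    have := A.hη
    positivity
  unfold badBound
  positivity

theorem sum_badEvent_le [IsProbabilityMeasure P] (hM : IsModel T G F σ P a Y Δ μ X) (hσ : 0 < σ)
    (A : Tuning σ) [IsProbabilityMeasure G] (hG : G (Set.Icc 0 1)ᶜ = 0) {p : ℝ}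
    (hp : ∫ x, x ∂G = p) (hp0 : 0 < p) {θ : ℝ}
    (hθ : p⁻¹ * ∫ x in Set.Ioi (0 : ℝ), (1 - cdf G x) ^ 2 = θ) {ρ : ℝ} (hρ : 1 < ρ) {R : ℕ}
    {L c : ℝ} (hL : σ ^ 2 ≤ A.ζ ^ 2 * L) (hc : 0 < c) :
    ∑ t ∈ Finset.Icc 1 (T - 1), P.real (badEvent A ρ T R L c a Y Δ μ X t) ≤
      ((T - 1 : ℕ) : ℝ) * p * badBound A F R L c p ((lastScale ρ T + 1) * T) θ + 2 * R * p := by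
  have hb0 : 0 ≤ badBound A F R L c p ((lastScale ρ T + 1) * T) θ :=
    badBound_nonneg A F R hσ hc hp0.le (by positivity)
  set Q := badBound A F R L c p ((lastScale ρ T + 1) * T) θ
  have hone : ∀ t ∈ Finset.Icc 1 (T - 1), P.real (badEvent A ρ T R L c a Y Δ μ X t) ≤
      p * Q + if R ≤ t ∧ t + R ≤ T then 0 else p := by
    intro t ht
    rw [badEvent]
    split_ifs with h
    · rw [add_zero]
      exact measureReal_badInterior_le hM hσ A hG hp hp0 hθ hρ hL hc ht h.1 h.2
    · rw [hM.measureReal_Y ht, hp]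
      have : 0 ≤ p * Q := by positivity
      linarith
  refine (Finset.sum_le_sum hone).trans ?_
  rw [Finset.sum_add_distrib, Finset.sum_const, Nat.card_Icc, nsmul_eq_mul, Nat.add_sub_cancel]
  have hcard : ((Finset.Icc 1 (T - 1)).filter fun t => ¬(R ≤ t ∧ t + R ≤ T)).card ≤ 2 * R := by
    have hsub : ((Finset.Icc 1 (T - 1)).filter fun t => ¬(R ≤ t ∧ t + R ≤ T)) ⊆
        Finset.Icc 1 R ∪ Finset.Ioc (T - R) T := by
      intro t ht
      simp only [Finset.mem_filter, Finset.mem_union, Finset.mem_Icc, Finset.mem_Ioc] at ht ⊢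
      omega
    refine (Finset.card_le_card hsub).trans ((Finset.card_union_le _ _).trans ?_)
    rw [Nat.card_Icc, Nat.card_Ioc]
    omega
  have hsum : ∑ t ∈ Finset.Icc 1 (T - 1), (if R ≤ t ∧ t + R ≤ T then 0 else p) ≤ 2 * R * p := by
    rw [Finset.sum_congr rfl (g := fun t => if ¬(R ≤ t ∧ t + R ≤ T) then p else 0)
      fun t _ => (ite_not _ _ _).symm, ← Finset.sum_filter, Finset.sum_const, nsmul_eq_mul]
    exact mul_le_mul_of_nonneg_right (by exact_mod_cast hcard) hp0.le
  linarith

/-! ### The choice of the constants -/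

theorem exists_annulus (F : Measure ℝ) [IsProbabilityMeasure F] (hF : F {0} = 0) {ε : ℝ}
    (hε : 0 < ε) : ∃ δ M : ℝ, 0 < δ ∧ 0 < M ∧ F.real {x | δ ≤ |x| ∧ |x| ≤ M}ᶜ ≤ ε := by
  set S : ℕ → Set ℝ := fun n => {x | 1 / ((n : ℝ) + 1) ≤ |x| ∧ |x| ≤ (n : ℝ) + 1}ᶜ with hS
  have hmeas : ∀ n, MeasurableSet (S n) := fun n =>
    ((measurableSet_le measurable_const measurable_abs).inter
      (measurableSet_le measurable_abs measurable_const)).compl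
  have hanti : Antitone S := by
    intro m n hmn
    refine Set.compl_subset_compl.2 fun x hx => ?_
    have h1 : (m : ℝ) + 1 ≤ n + 1 := by
      have : (m : ℝ) ≤ n := by exact_mod_cast hmn
      linarith
    exact ⟨(one_div_le_one_div_of_le (by positivity) h1).trans hx.1, hx.2.trans h1⟩
  have hinter : ⋂ n, S n = {0} := by
    ext x
    simp only [hS, Set.mem_iInter, Set.mem_compl_iff, Set.mem_ofPred_eq, Set.mem_singleton_iff]
    constructor
    · intro h
      by_contra hx
      have hx0 : 0 < |x| := abs_pos.2 hx
      obtain ⟨n, hn⟩ := exists_nat_ge (max |x| (1 / |x|))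
      have h1 : |x| ≤ n + 1 := by linarith [le_max_left |x| (1 / |x|)]
      have h2 : 1 / |x| ≤ n + 1 := by linarith [le_max_right |x| (1 / |x|)]
      exact h n ⟨by rw [one_div_le (by positivity) hx0]; exact h2, h1⟩
    · rintro rfl n ⟨h1, _⟩
      rw [abs_zero] at h1
      have : (0 : ℝ) < 1 / (n + 1) := by positivity
      linarith
  have hlim := tendsto_measure_iInter_atTop (μ := F) (fun n => (hmeas n).nullMeasurableSet) hanti
    ⟨0, measure_ne_top _ _⟩
  rw [hinter, hF] at hlim
  have hev := hlim.eventually (gt_mem_nhds (ENNReal.ofReal_pos.2 hε))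
  obtain ⟨n, hn⟩ := hev.exists
  refine ⟨1 / ((n : ℝ) + 1), (n : ℝ) + 1, by positivity, by positivity, ?_⟩
  exact ENNReal.toReal_le_of_le_ofReal hε.le hn.le

theorem exists_tuning (F : Measure ℝ) [IsProbabilityMeasure F] (hF : F {0} = 0) (hσ : 0 < σ)
    {ε : ℝ} (hε : 0 < ε) :
    ∃ A : Tuning σ, F.real {x | A.δ ≤ |x| ∧ |x| ≤ A.M}ᶜ ≤ ε ∧
      2 * (Real.exp (-A.β / (2 * σ ^ 2)) * (1 - Real.exp (-A.η / (2 * σ ^ 2)))⁻¹) ≤ ε := by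
  obtain ⟨δ, M, hδ, hM, hδM⟩ := exists_annulus F hF hε
  -- `c₁` makes `4 c₁² M² (48 σ² / δ²) = 3 σ² / 4` at most `σ²`; the constants `η` and `ζ` are then
  -- small against `c₁ δ²`, and `β` is taken large at the end.
  set c₁ := δ / (16 * M) with hc₁
  have hc₁0 : 0 < c₁ := by positivity
  set η := c₁ * δ ^ 2 / 32 with hη
  have hη0 : 0 < η := by positivity
  set ζ := min (σ / 2) (√η * σ / M) with hζ
  have hζ0 : 0 < ζ := lt_min (by positivity) (by positivity)
  have hζη : ζ ^ 2 * M ^ 2 / σ ^ 2 ≤ η := by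
    have h1 : ζ ^ 2 ≤ (√η * σ / M) ^ 2 := pow_le_pow_left₀ hζ0.le (min_le_right _ _) 2
    rw [div_pow, mul_pow, Real.sq_sqrt hη0.le, le_div_iff₀ (by positivity)] at h1
    rwa [div_le_iff₀ (by positivity)]
  have hlim : Filter.Tendsto (fun β : ℝ => 2 * (Real.exp (-β / (2 * σ ^ 2)) *
      (1 - Real.exp (-η / (2 * σ ^ 2)))⁻¹)) Filter.atTop (nhds 0) := by
    have h1 : Filter.Tendsto (fun β : ℝ => Real.exp (-β / (2 * σ ^ 2))) Filter.atTop (nhds 0) :=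
      Real.tendsto_exp_atBot.comp
        (Filter.tendsto_neg_atTop_atBot.atBot_div_const (by positivity))
    simpa using (h1.mul_const (1 - Real.exp (-η / (2 * σ ^ 2)))⁻¹).const_mul 2
  obtain ⟨β, hβ, hβσ⟩ := ((hlim.eventually (gt_mem_nhds hε)).and
    (Filter.eventually_ge_atTop (σ ^ 2))).exists
  refine ⟨⟨δ, M, c₁, η, ζ, β, hδ, hM, hc₁0, hη0, hζ0, hβσ, min_le_left _ _, ?_, ?_⟩, hδM, hβ.le⟩
  · rw [hc₁]
    have : 4 * (δ / (16 * M)) ^ 2 * M ^ 2 * (48 * σ ^ 2 / δ ^ 2) = 3 / 4 * σ ^ 2 := by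
      field_simp
      norm_num
    rw [this]
    nlinarith [sq_nonneg σ]
  · have : 16 * (η + η) = c₁ * δ ^ 2 := by rw [hη]; ring
    linarith

end

/-! ### Asymptotics -/

section

open Filter Topology

theorem lastScale_le {ρ : ℝ} (hρ : 1 < ρ) {T : ℕ} (hT : 1 ≤ T) :
    (lastScale ρ T : ℝ) ≤ Real.log T / Real.log ρ := by
  have hlρ := Real.log_pos hρ
  have hT' : (1 : ℝ) ≤ T := by exact_mod_cast hT
  have h : lastScale ρ T ≤ ⌊Real.log T / Real.log ρ⌋₊ := by
    refine csSup_le' fun b hb => Nat.le_floor ?_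
    have hb' : 2 * halfLen ρ b + 1 ≤ T := hb
    rw [le_div_iff₀ hlρ, ← Real.log_pow]
    refine Real.log_le_log (by positivity) ((Nat.le_ceil _).trans ?_)
    have : halfLen ρ b ≤ T := by omega
    exact_mod_cast this
  exact (Nat.cast_le.2 h).trans (Nat.floor_le (div_nonneg (Real.log_nonneg hT') hlρ.le))

theorem le_lastScale {ρ : ℝ} (hρ : 1 < ρ) {T b : ℕ} (hb : 2 * halfLen ρ b + 1 ≤ T) :
    b ≤ lastScale ρ T := by
  have hlρ := Real.log_pos hρ
  refine le_csSup ⟨⌊Real.log T / Real.log ρ⌋₊, fun b' hb' => Nat.le_floor ?_⟩ hb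
  have hb'' : 2 * halfLen ρ b' + 1 ≤ T := hb'
  rw [le_div_iff₀ hlρ, ← Real.log_pow]
  refine Real.log_le_log (by positivity) ((Nat.le_ceil _).trans ?_)
  have : halfLen ρ b' ≤ T := by omega
  exact_mod_cast this

/-- The half-lengths are dense enough on the logarithmic scale. -/
theorem exists_halfLen {ρ : ℝ} (hρ : 1 < ρ) (hρ' : ρ ≤ 2) {y : ℝ} (hy : 1 ≤ y) :
    ∃ b, y ≤ halfLen ρ b ∧ (halfLen ρ b : ℝ) ≤ 3 * y := by
  obtain ⟨n, h1, h2⟩ := exists_nat_pow_near hy hρ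
  refine ⟨n + 1, h2.le.trans (Nat.le_ceil _), ?_⟩
  have h3 : ρ ^ (n + 1) ≤ 2 * y := by
    rw [pow_succ, mul_comm]
    exact mul_le_mul hρ' h1 (by positivity) zero_le_two
  have h4 := (Nat.ceil_lt_add_one (show 0 ≤ ρ ^ (n + 1) by positivity)).le
  rw [halfLen]
  linarith

theorem cScan_bounds {T : ℕ} (h : 1 ≤ Real.log T) :
    √2 * √(Real.log T) ≤ cScan T ∧ cScan T ≤ 2 * √(Real.log T) ∧
      Real.exp (-cScan T ^ 2 / 2) = (T * Real.log T)⁻¹ := by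
  have hT : (0 : ℝ) < T := by
    by_contra! h0
    have : (T : ℝ) = 0 := le_antisymm h0 (Nat.cast_nonneg T)
    rw [this, Real.log_zero] at h
    linarith
  have hL : 0 < Real.log T := by linarith
  have hlog : Real.log (T * Real.log T) = Real.log T + Real.log (Real.log T) :=
    Real.log_mul hT.ne' hL.ne'
  have hll := Real.log_nonneg h
  have hll' := Real.log_le_self hL.le
  refine ⟨?_, ?_, ?_⟩
  · rw [← Real.sqrt_mul zero_le_two, cScan, hlog]
    exact Real.sqrt_le_sqrt (by linarith)
  · rw [cScan, hlog]
    refine (Real.sqrt_le_sqrt (y := 2 ^ 2 * Real.log T) (by linarith)).trans_eq ?_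
    rw [Real.sqrt_mul (by norm_num), Real.sqrt_sq zero_le_two]
  · rw [cScan, Real.sq_sqrt (by rw [hlog]; linarith), neg_mul_eq_mul_neg,
      mul_div_cancel_left₀ _ (two_ne_zero), Real.exp_neg, Real.exp_log (by positivity)]

theorem tendsto_log_natCast : Tendsto (fun T : ℕ => Real.log T) atTop atTop :=
  Real.tendsto_log_atTop.comp tendsto_natCast_atTop_atTop

/-- The part of the bound on the proportion of bad change-points that vanishes as `T → ∞`. -/
theorem tendsto_vanishing_part {q θ : ℕ → ℝ} (hq : q =o[atTop] fun T : ℕ => 1 / Real.log T)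
    (hθ : Tendsto θ atTop (𝓝 0)) (K C r g : ℝ) (hr : 0 < r) :
    Tendsto (fun T : ℕ => K * (Real.log T * q T) + C * √(θ T) +
      (K * Real.log T + 1) ^ 2 * Real.exp (-r * Real.log T) +
      (g + (Real.log T)⁻¹) * (√(Real.log T))⁻¹ + K * (Real.log T / ((T - 1 : ℕ) : ℝ)))
      atTop (𝓝 0) := by
  have hlog := tendsto_log_natCast
  have h1 : Tendsto (fun T : ℕ => Real.log T * q T) atTop (𝓝 0) := by
    have := hq.tendsto_div_nhds_zero
    refine this.congr fun T => ?_
    rw [div_div_eq_mul_div, div_one, mul_comm]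
  have h2 : Tendsto (fun T => √(θ T)) atTop (𝓝 0) := by
    have := (Real.continuous_sqrt.tendsto 0).comp hθ
    rwa [Real.sqrt_zero] at this
  have h3 : Tendsto (fun T : ℕ => (K * Real.log T + 1) ^ 2 * Real.exp (-r * Real.log T)) atTop
      (𝓝 0) := by
    have e : ∀ n : ℕ, Tendsto (fun x : ℝ => x ^ n * Real.exp (-r * x)) atTop (𝓝 0) := fun n => by
      have := tendsto_rpow_mul_exp_neg_mul_atTop_nhds_zero n r hr
      simpa using this
    have h := (((e 2).const_mul (K ^ 2)).add ((e 1).const_mul (2 * K))).add (e 0)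
    simp only [mul_zero, add_zero] at h
    refine (h.comp hlog).congr fun T => ?_
    simp only [Function.comp]
    ring
  have h4 : Tendsto (fun T : ℕ => (g + (Real.log T)⁻¹) * (√(Real.log T))⁻¹) atTop (𝓝 0) := by
    have a1 : Tendsto (fun T : ℕ => g + (Real.log T)⁻¹) atTop (𝓝 (g + 0)) :=
      tendsto_const_nhds.add (tendsto_inv_atTop_zero.comp hlog)
    have a2 : Tendsto (fun T : ℕ => (√(Real.log T))⁻¹) atTop (𝓝 0) :=
      tendsto_inv_atTop_zero.comp (Real.tendsto_sqrt_atTop.comp hlog)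
    simpa using a1.mul a2
  have h5 : Tendsto (fun T : ℕ => Real.log T / ((T - 1 : ℕ) : ℝ)) atTop (𝓝 0) := by
    have h6 : Tendsto (fun T : ℕ => Real.log T / (T : ℝ)) atTop (𝓝 0) := by
      have := Real.isLittleO_log_id_atTop.tendsto_div_nhds_zero
      exact this.comp tendsto_natCast_atTop_atTop
    have h7 := h6.const_mul 2
    rw [mul_zero] at h7
    refine squeeze_zero' ?_ ?_ h7
    · filter_upwards [eventually_ge_atTop 1] with T hT
      have : (1 : ℝ) ≤ T := by exact_mod_cast hT
      exact div_nonneg (Real.log_nonneg this) (Nat.cast_nonneg _)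
    · filter_upwards [eventually_ge_atTop 2] with T hT
      have hT' : (2 : ℝ) ≤ T := by exact_mod_cast hT
      have hl : 0 ≤ Real.log T := Real.log_nonneg (by linarith)
      rw [Nat.cast_sub (by omega), Nat.cast_one, div_le_iff₀ (by linarith)]
      have : 2 * (Real.log T / T) * (T - 1) = Real.log T * (2 * (T - 1) / T) := by ring
      rw [this]
      refine le_mul_of_one_le_right hl ?_
      rw [one_le_div (by linarith)]
      linarith
  simpa using ((((h1.const_mul K).add (h2.const_mul C)).add h3).add h4).add (h5.const_mul K)

end

end ScanCusum

theorem theorem4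
    -- the law of the jumps, the noise level and the scale parameter
    (F : MeasureTheory.Measure ℝ) [MeasureTheory.IsProbabilityMeasure F] (hF : F {0} = 0)
    (σ : ℝ) (hσ : 0 < σ) (ρ : ℝ) (hρ : 1 < ρ) (hρ' : ρ ≤ 2)
    -- the laws of the intensities
    (G : ℝ → MeasureTheory.Measure ℝ)
    (hG : ∀ p ∈ Set.Ioo (0 : ℝ) 1, MeasureTheory.IsProbabilityMeasure (G p) ∧
      G p (Set.Icc 0 1)ᶜ = 0 ∧ ∫ x, x ∂(G p) = p)
    (hG0 : Filter.Tendsto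
      (fun p : ℝ => p⁻¹ * ∫ x in Set.Ioi (0 : ℝ), (1 - ProbabilityTheory.cdf (G p) x) ^ 2)
      (nhdsWithin 0 (Set.Ioi 0)) (nhds 0))
    (q : ℕ → ℝ) (hq : ∀ T, q T ∈ Set.Ioo (0 : ℝ) 1)
    (hq0 : q =o[Filter.atTop] fun T : ℕ => 1 / Real.log T)
    -- for every length of the sequence, the change-point model
    (Ω : ℕ → Type*) [∀ T, MeasurableSpace (Ω T)]
    (P : ∀ T, MeasureTheory.Measure (Ω T)) [∀ T, MeasureTheory.IsProbabilityMeasure (P T)]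
    (a : ∀ T, ℕ → Ω T → ℝ) (Y : ∀ T, ℕ → Ω T → Bool) (Δ μ X : ∀ T, ℕ → Ω T → ℝ)
    (hM : ∀ T, ScanCusum.IsModel T (G (q T)) F σ (P T) (a T) (Y T) (Δ T) (μ T) (X T))
    -- an arbitrary rule to break ties
    (pick : Finset ℕ → ℕ) (hpick : ∀ s : Finset ℕ, s.Nonempty → pick s ∈ s) :
    Filter.Tendsto
      (fun T => ScanCusum.beta T (P T) (Y T) fun ω =>
        ScanCusum.extendedScan pick ρ σ T (ScanCusum.cScan T)
          (fun t => X T t ω) (fun t => a T t ω))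
      Filter.atTop (nhds 1) := by
  have hθ : Filter.Tendsto (fun T => (q T)⁻¹ *
      ∫ x in Set.Ioi (0 : ℝ), (1 - ProbabilityTheory.cdf (G (q T)) x) ^ 2) Filter.atTop
      (nhds 0) := by
    refine hG0.comp (tendsto_nhdsWithin_iff.2 ⟨?_, Filter.Eventually.of_forall fun T => (hq T).1⟩)
    refine hq0.trans_tendsto ?_
    simpa [Function.comp_def] using
      tendsto_inv_atTop_zero.comp ScanCusum.tendsto_log_natCast
  have key : ∀ κ : ℝ, 0 < κ → κ ≤ 1 → ∀ᶠ T in Filter.atTop,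
      ENNReal.ofReal (1 - 36 * κ) ≤ ScanCusum.beta T (P T) (Y T) fun ω =>
        ScanCusum.extendedScan pick ρ σ T (ScanCusum.cScan T)
          (fun t => X T t ω) (fun t => a T t ω) := by
    intro κ hκ hκ1
    obtain ⟨A, hA1, hA2⟩ := ScanCusum.exists_tuning F hF hσ (ε := κ ^ 2 / 4) (by positivity)
    have hδ := A.hδ
    have hζ := A.hζ
    set K : ℝ := 16 * σ ^ 2 / A.δ ^ 2 with hK
    have hK0 : 0 < K := by positivity
    have hlim := ScanCusum.tendsto_vanishing_part hq0 hθ (24 * K)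
      (2 * (Real.exp A.loss * (1 - Real.exp (-A.slope / 2))⁻¹)) (A.ζ ^ 2 / (2 * σ ^ 2))
      (1 / Real.log ρ) (by positivity)
    have hsmall : ∀ᶠ T : ℕ in Filter.atTop, Real.log T ≤ (12 * K)⁻¹ * T := by
      have := (Real.isLittleO_log_id_atTop.bound (c := (12 * K)⁻¹) (by positivity))
      filter_upwards [tendsto_natCast_atTop_atTop.eventually this] with T hT
      simpa using (le_abs_self _).trans hT
    filter_upwards [hlim.eventually (gt_mem_nhds (show 0 < κ ^ 2 / 2 by positivity)), hsmall,
      ScanCusum.tendsto_log_natCast.eventually_ge_atTop 1,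
      ScanCusum.tendsto_log_natCast.eventually_ge_atTop (1 / K),
      ScanCusum.tendsto_log_natCast.eventually_ge_atTop (σ ^ 2 / A.ζ ^ 2),
      Filter.eventually_ge_atTop 2] with T h1 h2 h3 h4 h5 h6
    set L := Real.log T with hL
    obtain ⟨hGp, hGs, hGm⟩ := hG (q T) (hq T)
    obtain ⟨hq1, hq2⟩ := hq T
    obtain ⟨c1, c2, c3⟩ := ScanCusum.cScan_bounds h3
    set c := ScanCusum.cScan T with hc
    set θ := (q T)⁻¹ * ∫ x in Set.Ioi (0 : ℝ), (1 - ProbabilityTheory.cdf (G (q T)) x) ^ 2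
    have hL0 : 0 < L := by linarith
    have hT' : (2 : ℝ) ≤ T := by exact_mod_cast h6
    have hc0 : 0 < c := lt_of_lt_of_le (by positivity) c1
    have hKL : 1 ≤ K * L := by
      rw [div_le_iff₀ hK0] at h4
      linarith
    obtain ⟨bs, hb1, hb2⟩ := ScanCusum.exists_halfLen hρ hρ' hKL
    set l := ScanCusum.halfLen ρ bs with hl
    have hbs : bs ≤ ScanCusum.lastScale ρ T := by
      refine ScanCusum.le_lastScale hρ ?_
      rw [← hl]
      have : (2 * l + 1 : ℝ) ≤ T := by
        have h7 := mul_le_mul_of_nonneg_left h2 (show 0 ≤ 6 * K by positivity)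
        have h8 : 6 * K * ((12 * K)⁻¹ * T) = T / 2 := by field_simp; norm_num
        linarith
      exact_mod_cast this
    have hn : (0 : ℝ) < ((T - 1 : ℕ) : ℝ) := by
      have : 0 < T - 1 := by omega
      exact_mod_cast this
    have hζL : σ ^ 2 ≤ A.ζ ^ 2 * L := by
      rw [div_le_iff₀ (by positivity)] at h5
      linarith
    have hR : ((4 * l : ℕ) : ℝ) ≤ 12 * (K * L) := by
      push_cast
      linarith
    have hsum := ScanCusum.sum_badEvent_le (hM T) hσ A hGs hGm hq1 (θ := θ) rfl hρ (R := 4 * l)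
      hζL hc0
    refine ScanCusum.le_beta (hM T) hGm hq1 rfl (mul_pos hn hq1) hκ hκ1
      (fun t ht => (hM T).measurableSet_badEvent A hρ ht) (fun t _ => ScanCusum.badEvent_subset)
      (hsum.trans ?_) fun ω => ScanCusum.card_changePoints_le (hM T) hσ hρ A hL0 c1 c2 hb1
        (hb2.trans_eq (by rw [hK, ScanCusum.Tuning.maxLen]; ring)) hbs hpick ω
    have t1 : 2 * ((4 * l : ℕ) : ℝ) * q T ≤ 24 * K * (L * q T) := by
      have := mul_le_mul_of_nonneg_right hR hq1.le
      linarith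
    have t2 : (2 * ((4 * l : ℕ) : ℝ) + 1) ^ 2 * Real.exp (-(A.ζ ^ 2 * L) / (2 * σ ^ 2)) ≤
        (24 * K * L + 1) ^ 2 * Real.exp (-(A.ζ ^ 2 / (2 * σ ^ 2)) * L) := by
      have e : -(A.ζ ^ 2 * L) / (2 * σ ^ 2) = -(A.ζ ^ 2 / (2 * σ ^ 2)) * L := by ring
      rw [e]
      refine mul_le_mul_of_nonneg_right (pow_le_pow_left₀ (by positivity) ?_ 2) (Real.exp_pos _).le
      linarith
    have t3 : (((ScanCusum.lastScale ρ T : ℝ) + 1) * T) * (Real.exp (-c ^ 2 / 2) / c) ≤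
        (1 / Real.log ρ + L⁻¹) * (√L)⁻¹ := by
      have hs : √L ≤ c := by
        refine le_trans ?_ c1
        refine le_mul_of_one_le_left (Real.sqrt_nonneg _) ?_
        rw [Real.one_le_sqrt]
        norm_num
      have hls := ScanCusum.lastScale_le hρ (T := T) (by omega)
      rw [← hL] at hls
      have hlρ := Real.log_pos hρ
      rw [c3]
      calc (((ScanCusum.lastScale ρ T : ℝ) + 1) * T) * ((T * L)⁻¹ / c)
          = ((ScanCusum.lastScale ρ T : ℝ) + 1) * L⁻¹ * c⁻¹ := by field_simp
        _ ≤ (L / Real.log ρ + 1) * L⁻¹ * (√L)⁻¹ := by gcongr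
        _ = _ := by field_simp
    have t4 : 2 * ((4 * l : ℕ) : ℝ) ≤ 24 * K * (L / ((T - 1 : ℕ) : ℝ)) * ((T - 1 : ℕ) : ℝ) := by
      have : 24 * K * (L / ((T - 1 : ℕ) : ℝ)) * ((T - 1 : ℕ) : ℝ) = 24 * K * L := by
        field_simp
      rw [this]
      linarith
    have hQ : ScanCusum.badBound A F (4 * l) L c (q T) ((ScanCusum.lastScale ρ T + 1) * T) θ +
        24 * K * (L / ((T - 1 : ℕ) : ℝ)) ≤ κ ^ 2 := by
      rw [ScanCusum.badBound]
      linarith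
    calc _ ≤ ((T - 1 : ℕ) : ℝ) * q T *
          ScanCusum.badBound A F (4 * l) L c (q T) ((ScanCusum.lastScale ρ T + 1) * T) θ +
          24 * K * (L / ((T - 1 : ℕ) : ℝ)) * ((T - 1 : ℕ) : ℝ) * q T := by gcongr
      _ = ((T - 1 : ℕ) : ℝ) * q T * (ScanCusum.badBound A F (4 * l) L c (q T)
          ((ScanCusum.lastScale ρ T + 1) * T) θ + 24 * K * (L / ((T - 1 : ℕ) : ℝ))) := by ring
      _ ≤ ((T - 1 : ℕ) : ℝ) * q T * κ ^ 2 := by gcongr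
      _ = _ := by ring
  refine tendsto_order.2 ⟨fun y hy => ?_, fun y hy =>
    Filter.Eventually.of_forall fun T => (ScanCusum.beta_le_one _ _ _).trans_lt hy⟩
  have hy' : y.toReal < 1 := ENNReal.toReal_lt_of_lt_ofReal (by rwa [ENNReal.ofReal_one])
  filter_upwards [key (min 1 ((1 - y.toReal) / 72)) (lt_min one_pos (by linarith))
    (min_le_left _ _)] with T hT
  refine lt_of_lt_of_le ?_ hT
  rw [ENNReal.lt_ofReal_iff_toReal_lt hy.ne_top]
  have := min_le_right 1 ((1 - y.toReal) / 72)
  linarith
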